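/- **Setting.** Let $G$ be a connected Lie group of dimension $n$ with Lie algebra $\mathfrak g$, left Haar measure $dx$, and a basis $X_1,\dots,X_n$ of $\mathfrak g$. Let $\mathcal S$ be a Hausdorff locally convex space over $\mathbb C$ (e.g. a Fréchet space) with conjugate dual $\mathcal S^*$ (weak-* topology), and suppose that $\mathcal S$ is linearly, injectively and continuously embedded in $\mathcal S^*$. Let $\rho:G\to GL(\mathcal S)$ be a projective representation with cocycle $\sigma$: $\rho(1)=\mathrm{id}$, $\rho(xy)=\sigma(x,y)\rho(x)\rho(y)$ with $\sigma:G\times G\to\mathbb T$ Borel, and all functions $x\mapsto\langle\lambda,\rho(x)v\rangle$ are Borel, and continuous in a neighbourhood of $e$ (depending on $\lambda\in\mathcal S^*$, $v\in\mathcal S$). Assume that $\sigma$ is $C^\infty$ in a neighbourhood of $(e,e)$. Put $\langle\rho^*(x)\lambda,v\rangle=\langle\lambda,\rho(x)^{-1}v\rangle$, $W_v(\lambda)(x)=\langle\lambda,\rho(x)v\rangle$, $\ell^\sigma_yf(x)=\overline{\sigma(y,y^{-1}x)}f(y^{-1}x)$, $r^\sigma_yf(x)=\sigma(x,y)f(xy)$,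 $f\#g(x)=\int f(y)\,\ell^\sigma_yg(x)\,dy$, and write $\ell_y,r_y,*$ for the same operations with $\sigma=1$. $B\neq\{0\}$ is a BF-space: a Banach space of (a.e. classes of) measurable functions on $G$ in which norm convergence implies convergence in measure on compact sets. It is solid ($f$ measurable, $|f|\le|g|$, $g\in B$ imply $f\in B$), invariant under $\ell^\sigma_y$ and $r^\sigma_y$ with norms bounded uniformly for $y$ in compact sets, and $y\mapsto \ell_yf$, $y\mapsto r_yf$ are continuous $G\to B$ for every $f\in B$. $0\ne u\in\mathcal S$ is a vector such that: * $u$ is $\rho$-cyclic (the span of $\{\rho(x)u\}$ is dense in $\mathcal S$) and $W_u(\lambda)\#W_u(u)=W_u(\lambda)$ for all $\lambda\in\mathcal S^*$, the integrals existing; * for all $f\in B$, $v\in\mathcal S$ the integral $f\#W_v(u)(1)$ exists, and $(f,v)\mapsto f\#W_v(u)(1)$ is continuous on $B\times\mathcal S$; * $u$ is weakly $\rho$-differentiable and weakly $\rho^*$-differentiable up to order $n$; here $\rho(X)v\in\mathcal S$ is given by $\langle\lambda,\rho(X)v\rangle=\frac{d}{dt}|_{t=0}\langle\lambda,\rho(\exp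 tX)v\rangle$ for all $\lambda\in\mathcal S^*$, and $\rho^*(X)\lambda\in\mathcal S^*$ by $\langle\rho^*(X)\lambda,v\rangle=\frac{d}{dt}|_{t=0}\langle\rho^*(\exp tX)\lambda,v\rangle$ for all $v\in\mathcal S$; * for all $0\le k\le n$ and $Y_1,\dots,Y_k\in\mathfrak g$ the operators $f\mapsto f*|W_u(\rho^*(Y_1)\cdots\rho^*(Y_k)u)|$ and $f\mapsto f*|W_{\rho(Y_1)\cdots\rho(Y_k)u}(u)|$ are bounded on $B$. Let $\mathrm{Co}=\{\lambda\in\mathcal S^*\mid W_u(\lambda)\in B\}$ with norm $\|W_u(\lambda)\|_B$, and $B_u^\#=\{f\in B\mid f\#W_u(u)=f\}$; point values of $f\in B_u^\#$ are those of $f\#W_u(u)$. Let $U_\epsilon=\{e^{t_1X_1}\cdots e^{t_nX_n}\mid -\epsilon\le t_k\le\epsilon\}$. A countable family $\{x_i\}\subseteq G$ is $U_\epsilon$-dense if $G=\bigcup_i x_iU_\epsilon$, and well-spread if for some neighbourhood $V$ of $e$ it is a finite union of subfamilies for which the sets $x_iV$ are pairwise disjoint. A $U_\epsilon$-BUPU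 is a family of measurable functions $0\le\psi_i\le1$ vanishing outside $x_iU_\epsilon$ with $\sum_i\psi_i=1$. Let $\dot b=\{(c_i)\mid\sum_i|c_i|1_{x_iU_\epsilon}\in B\}$ with $\|(c_i)\|_{\dot b}=\|\sum_i|c_i|1_{x_iU_\epsilon}\|_B$. Bounded functionals $\Lambda_i$ on $\mathrm{Co}$ form a *Banach frame* for $\mathrm{Co}$ w.r.t. $\dot b$ if $(\Lambda_i(\gamma))\in\dot b$ with norm equivalent to $\|\gamma\|_{\mathrm{Co}}$ and there is a bounded linear $R:\dot b\to\mathrm{Co}$ with $R((\Lambda_i(\gamma)))=\gamma$; together with $a_i\in\mathrm{Co}$ they form an *atomic decomposition* w.r.t. $\dot b$ if $(\Lambda_i(\gamma))\in\dot b$ with norm equivalent to $\|\gamma\|_{\mathrm{Co}}$ and $\gamma=\sum_i\Lambda_i(\gamma)a_i$ in $\mathcal S^*$. **Theorem.** 1. Let $\epsilon>0$ be such that $\sigma$ is $C^\infty$ on an open set containing $U_\epsilon\times U_\epsilon$. For every $U_\epsilon$-dense well-spread $\{x_i\}$ and every $U_\epsilon$-BUPU $\{\psi_i\}$ the operators $$T_1f=\Big(\sum_i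 f(x_i)\,\sigma(\cdot,\cdot^{-1}x_i)\,\psi_i\Big)\#W_u(u),\quad T_2f=\sum_i\lambda_i(f)\,\ell^\sigma_{x_i}W_u(u),\quad T_3f=\sum_ic_if(x_i)\,\ell^\sigma_{x_i}W_u(u),$$ with $\lambda_i(f)=\int f(y)\psi_i(y)\overline{\sigma(y,y^{-1}x_i)}\,dy$ and $c_i=\int\psi_i$, are well defined (the integrals exist, and the series converge absolutely at every point) bounded operators on $B_u^\#$. 2. There is $\epsilon_0>0$ such that for all $0<\epsilon\le\epsilon_0$, $\sigma$ is $C^\infty$ on an open set containing $U_\epsilon\times U_\epsilon$, and for every $U_\epsilon$-dense well-spread $\{x_i\}$ and every $U_\epsilon$-BUPU $\{\psi_i\}$: $W_u$ is a linear bijection $\mathrm{Co}\to B_u^\#$; $T_1,T_2,T_3$ are invertible on $B_u^\#$ with bounded inverses; $\rho^*(x_i)u\in\mathrm{Co}$; the family $\{\rho^*(x_i)u\}$, i.e. the functionals $\gamma\mapsto\langle\gamma,\rho(x_i)u\rangle=W_u(\gamma)(x_i)$, is a Banach frame for $\mathrm{Co}$ w.r.t. $\dot b$; and $\{\lambda_i\circ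 T_2^{-1}\circ W_u,\ \rho^*(x_i)u\}$ and $\{\gamma\mapsto c_i(T_3^{-1}W_u(\gamma))(x_i),\ \rho^*(x_i)u\}$ are atomic decompositions of $\mathrm{Co}$ w.r.t. $\dot b$. Every $\gamma\in\mathrm{Co}$ is reconstructed by $$\gamma=W_u^{-1}T_1^{-1}\Big(\sum_iW_u(\gamma)(x_i)\,\big(\sigma(\cdot,\cdot^{-1}x_i)\psi_i\big)\#W_u(u)\Big),$$ $$\gamma=\sum_i\lambda_i\big(T_2^{-1}W_u(\gamma)\big)\,\rho^*(x_i)u,\qquad \gamma=\sum_ic_i\,\big(T_3^{-1}W_u(\gamma)\big)(x_i)\,\rho^*(x_i)u.$$ The series converge unconditionally in $\mathcal S^*$ (in the first formula, the series in brackets, whose terms lie in $B_u^\#$, after applying $W_u^{-1}$); if $C_c(G)$ is dense in $B$ they converge unconditionally in the norm of $\mathrm{Co}$ (of $B_u^\#$ for the series in brackets). -/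

import Mathlib

open MeasureTheory Filter Topology Set
open scoped Manifold ContDiff ComplexConjugate

namespace ProjCoorbit

noncomputable section

/-! ### The exponential map of a Lie group -/

section Lie

variable {n : ℕ} {G : Type*} [TopologicalSpace G]
  [ChartedSpace (EuclideanSpace ℝ (Fin n)) G] [Group G]

open Classical in
/-- The Lie group exponential: `lieExp X = γ 1`, where `γ` is the integral curve through the
identity of the left-invariant vector field with value `X` at the identity. -/
def lieExp (X : GroupLieAlgebra (𝓡 n) G) : G :=
  if h : ∃ γ : ℝ → G, γ 0 = 1 ∧
      IsMIntegralCurve (I := 𝓡 n) γ (mulInvariantVectorField (I := 𝓡 n) X)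
  then h.choose 1 else 1

/-- `U_ε = {exp(t₁X₁) ⋯ exp(tₙXₙ) | -ε ≤ tₖ ≤ ε}`. -/
def boxNhd (X : Module.Basis (Fin n) ℝ (GroupLieAlgebra (𝓡 n) G)) (ε : ℝ) : Set G :=
  {g | ∃ t : Fin n → ℝ, (∀ k, -ε ≤ t k ∧ t k ≤ ε) ∧
    g = (List.ofFn fun k => lieExp (t k • X k)).prod}

/-- `σ` is smooth on some open subset of `G × G` containing the set `A`. -/
def SmoothNear (σ : G → G → Circle) (A : Set (G × G)) : Prop :=
  ∃ O : Set (G × G), IsOpen O ∧ A ⊆ O ∧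
    ContMDiffOn ((𝓡 n).prod (𝓡 n)) 𝓘(ℝ, ℂ) ∞ (fun p : G × G => (σ p.1 p.2 : ℂ)) O

end Lie

/-! ### Projective representations and the dual representation

`S →L⋆[ℂ] ℂ` is the conjugate dual of `S`; it is only ever used with the weak-* topology, that is,
with convergence tested against every `v : S`. -/

section Rep

variable (G S : Type*) [Group G] [MeasurableSpace G]
  [AddCommGroup S] [Module ℂ S] [TopologicalSpace S]

/-- A projective representation of `G` on `S` together with its multiplier `σ`. -/
structure ProjRep where
  toFun : G → (S ≃L[ℂ] S)
  σ : G → G → Circle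
  map_one : toFun 1 = ContinuousLinearEquiv.refl ℂ S
  measurable_σ : Measurable fun p : G × G => (σ p.1 p.2 : ℂ)
  map_mul : ∀ x y v, toFun (x * y) v = (σ x y : ℂ) • toFun x (toFun y v)
  measurable_coeff : ∀ (v : S) (l : S →L⋆[ℂ] ℂ), Measurable fun x => l (toFun x v)

variable {G S}

/-- The dual representation, `⟨ρ*(x)λ, v⟩ = ⟨λ, ρ(x)⁻¹ v⟩`. -/
def ProjRep.dual (ρ : ProjRep G S) (x : G) (l : S →L⋆[ℂ] ℂ) : S →L⋆[ℂ] ℂ :=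
  l.comp ((ρ.toFun x).symm : S →L[ℂ] S)

/-- The wavelet transform, `W_v(λ)(x) = ⟨λ, ρ(x) v⟩`. -/
def ProjRep.wav (ρ : ProjRep G S) (v : S) (l : S →L⋆[ℂ] ℂ) (x : G) : ℂ := l (ρ.toFun x v)

/-- Weak continuity near the identity. -/
def ProjRep.WeaklyContinuousNearOne [TopologicalSpace G] (ρ : ProjRep G S) : Prop :=
  ∀ (l : S →L⋆[ℂ] ℂ) (v : S), ∃ U ∈ 𝓝 (1 : G), ContinuousOn (fun x => l (ρ.toFun x v)) U

/-- `v` is `ρ`-cyclic. -/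
def ProjRep.Cyclic (ρ : ProjRep G S) (v : S) : Prop :=
  Dense (Submodule.span ℂ (range fun x => ρ.toFun x v) : Set S)

end Rep

/-! ### Weak derivatives -/

section WeakDeriv

variable {n : ℕ} {G S : Type*} [TopologicalSpace G]
  [ChartedSpace (EuclideanSpace ℝ (Fin n)) G] [Group G] [MeasurableSpace G]
  [AddCommGroup S] [Module ℂ S] [TopologicalSpace S]

/-- `w = ρ(X)v`, the weak derivative at `t = 0` of `ρ(exp(tX))v`. -/
def ProjRep.HasWeakDeriv (ρ : ProjRep G S) (X : GroupLieAlgebra (𝓡 n) G) (v w : S) : Prop :=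
  ∀ l : S →L⋆[ℂ] ℂ, HasDerivAt (fun t : ℝ => l (ρ.toFun (lieExp (t • X)) v)) (l w) 0

/-- `m = ρ*(X)l`, the weak derivative at `t = 0` of `ρ*(exp(tX))l`. -/
def ProjRep.HasDualWeakDeriv (ρ : ProjRep G S) (X : GroupLieAlgebra (𝓡 n) G)
    (l m : S →L⋆[ℂ] ℂ) : Prop :=
  ∀ v : S, HasDerivAt (fun t : ℝ => ρ.dual (lieExp (t • X)) l v) (m v) 0

open Classical in
/-- `ρ(X)v` (zero if the weak derivative does not exist). -/
def ProjRep.weakDeriv (ρ : ProjRep G S) (X : GroupLieAlgebra (𝓡 n) G) (v : S) : S :=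
  if h : ∃ w, ρ.HasWeakDeriv X v w then h.choose else 0

open Classical in
/-- `ρ*(X)l` (zero if the weak derivative does not exist). -/
def ProjRep.dualWeakDeriv (ρ : ProjRep G S) (X : GroupLieAlgebra (𝓡 n) G)
    (l : S →L⋆[ℂ] ℂ) : S →L⋆[ℂ] ℂ :=
  if h : ∃ m, ρ.HasDualWeakDeriv X l m then h.choose else 0

/-- `ρ(Y₁)ρ(Y₂)⋯ρ(Yₖ)v` for the list `[Y₁, …, Yₖ]`. -/
def ProjRep.iterDeriv (ρ : ProjRep G S) (Ys : List (GroupLieAlgebra (𝓡 n) G)) (v : S) : S :=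
  Ys.foldr (fun Y w => ρ.weakDeriv Y w) v

/-- `ρ*(Y₁)ρ*(Y₂)⋯ρ*(Yₖ)l` for the list `[Y₁, …, Yₖ]`. -/
def ProjRep.iterDualDeriv (ρ : ProjRep G S) (Ys : List (GroupLieAlgebra (𝓡 n) G))
    (l : S →L⋆[ℂ] ℂ) : S →L⋆[ℂ] ℂ :=
  Ys.foldr (fun Y m => ρ.dualWeakDeriv Y m) l

/-- `v` is weakly `ρ`-differentiable up to order `k`. -/
def ProjRep.WeaklyDiff (ρ : ProjRep G S) (k : ℕ) (v : S) : Prop :=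
  ∀ (Ys : List (GroupLieAlgebra (𝓡 n) G)), Ys.length < k → ∀ Y : GroupLieAlgebra (𝓡 n) G,
    ∃ w, ρ.HasWeakDeriv Y (ρ.iterDeriv Ys v) w

/-- `l` is weakly `ρ*`-differentiable up to order `k`. -/
def ProjRep.DualWeaklyDiff (ρ : ProjRep G S) (k : ℕ) (l : S →L⋆[ℂ] ℂ) : Prop :=
  ∀ (Ys : List (GroupLieAlgebra (𝓡 n) G)), Ys.length < k → ∀ Y : GroupLieAlgebra (𝓡 n) G,
    ∃ m, ρ.HasDualWeakDeriv Y (ρ.iterDualDeriv Ys l) m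

end WeakDeriv

/-! ### Twisted translations and twisted convolution -/

section Twisted

variable {G : Type*} [Group G]

/-- Twisted left translation. -/
def twL (σ : G → G → Circle) (y : G) (f : G → ℂ) (x : G) : ℂ :=
  conj (σ y (y⁻¹ * x) : ℂ) * f (y⁻¹ * x)

/-- Twisted right translation. -/
def twR (σ : G → G → Circle) (y : G) (f : G → ℂ) (x : G) : ℂ := (σ x y : ℂ) * f (x * y)

/-- The constant cocycle: with it, `twL`, `twR`, `twConv` are the untwisted operations. -/
def trivCocycle : G → G → Circle := fun _ _ => 1

variable [MeasurableSpace G]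

/-- Existence of the integral defining `(f # g)(x)`. -/
def TwConvExists (μ : Measure G) (σ : G → G → Circle) (f g : G → ℂ) (x : G) : Prop :=
  Integrable (fun y => f y * twL σ y g x) μ

/-- Twisted convolution `(f # g)(x) = ∫ f(y) (ℓ^σ_y g)(x) dy`. -/
def twConv (μ : Measure G) (σ : G → G → Circle) (f g : G → ℂ) (x : G) : ℂ :=
  ∫ y, f y * twL σ y g x ∂μ

end Twisted

/-! ### Banach function spaces -/

section BF

variable {G : Type*} [TopologicalSpace G] [Group G] [MeasurableSpace G]

/-- A BF-space: a Banach space `B` (completeness being an instance) of a.e. classes of measurable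
functions, in which norm convergence implies convergence in measure on compact sets. -/
structure BFSpace (μ : Measure G) (B : Type*) [NormedAddCommGroup B] [NormedSpace ℂ B] where
  toAE : B →ₗ[ℂ] (G →ₘ[μ] ℂ)
  injective : Function.Injective toAE
  tendsto_measure : ∀ b : ℕ → B, Tendsto b atTop (𝓝 0) → ∀ K : Set G, IsCompact K →
    TendstoInMeasure (μ.restrict K) (fun k => (toAE (b k) : G → ℂ)) atTop (fun _ => 0)

variable {μ : Measure G} {B : Type*} [NormedAddCommGroup B] [NormedSpace ℂ B]

/-- The function `g` is a representative of the element `f` of the BF-space. -/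
def BFSpace.Rep (𝓑 : BFSpace μ B) (f : B) (g : G → ℂ) : Prop := (𝓑.toAE f : G → ℂ) =ᵐ[μ] g

/-- `|f| ≤ |g|`, `f` measurable and `g ∈ B` imply `f ∈ B`. -/
def BFSpace.Solid (𝓑 : BFSpace μ B) : Prop :=
  ∀ (g : B) (f : G → ℂ), AEStronglyMeasurable f μ → (∀ᵐ x ∂μ, ‖f x‖ ≤ ‖𝓑.toAE g x‖) →
    ∃ f' : B, 𝓑.Rep f' f

/-- `B` is invariant under the operators `T y`, `y ∈ G`, and these are uniformly bounded for `y` in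
a compact set. -/
def BFSpace.BddTransl (𝓑 : BFSpace μ B) (T : G → (G → ℂ) → G → ℂ) : Prop :=
  (∀ y f, ∃ g : B, 𝓑.Rep g (T y (𝓑.toAE f))) ∧
  ∀ K : Set G, IsCompact K → ∃ C : ℝ, ∀ y ∈ K, ∀ f g : B, 𝓑.Rep g (T y (𝓑.toAE f)) →
    ‖g‖ ≤ C * ‖f‖

/-- `y ↦ T y f` is a continuous map `G → B` for every `f ∈ B`. -/
def BFSpace.ContTransl (𝓑 : BFSpace μ B) (T : G → (G → ℂ) → G → ℂ) : Prop :=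
  ∀ f : B, ∃ L : G → B, (∀ y, 𝓑.Rep (L y) (T y (𝓑.toAE f))) ∧ Continuous L

/-- `f ↦ f * |k|` (untwisted convolution) is a bounded operator on `B`. -/
def BFSpace.BddAbsConv (𝓑 : BFSpace μ B) (k : G → ℂ) : Prop :=
  ∃ C : ℝ, ∀ f : B,
    (∀ᵐ x ∂μ, TwConvExists μ trivCocycle (𝓑.toAE f) (fun z => (‖k z‖ : ℂ)) x) ∧
    ∃ g : B, 𝓑.Rep g (twConv μ trivCocycle (𝓑.toAE f) fun z => (‖k z‖ : ℂ)) ∧ ‖g‖ ≤ C * ‖f‖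

/-- `C_c(G)` is dense in `B`. -/
def BFSpace.CcDense (𝓑 : BFSpace μ B) : Prop :=
  Dense {f : B | ∃ g : G → ℂ, Continuous g ∧ HasCompactSupport g ∧ 𝓑.Rep f g}

/-- The canonical pointwise values `(f # φ)(x)` of `f`; they are the values used for sampling
elements of the reproducing kernel space. -/
def BFSpace.ev (𝓑 : BFSpace μ B) (σ : G → G → Circle) (φ : G → ℂ) (f : B) (x : G) : ℂ :=
  twConv μ σ (𝓑.toAE f) φ x

/-- The reproducing kernel space `{f ∈ B | f # φ = f}`. -/
def BFSpace.repro (𝓑 : BFSpace μ B) (σ : G → G → Circle) (φ : G → ℂ) : Submodule ℂ B where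
  carrier := {f | (∀ x, TwConvExists μ σ (𝓑.toAE f) φ x) ∧ 𝓑.Rep f (𝓑.ev σ φ f)}
  zero_mem' := by
    have h0 : (𝓑.toAE 0 : G → ℂ) =ᵐ[μ] 0 := by
      rw [map_zero]; exact AEEqFun.coeFn_zero
    have h1 : ∀ x, (fun y => 𝓑.toAE 0 y * twL σ y φ x) =ᵐ[μ] fun _ => (0 : ℂ) := by
      intro x
      filter_upwards [h0] with y hy
      rw [hy]; simp
    refine ⟨fun x => (integrable_zero G ℂ μ).congr (h1 x).symm, ?_⟩
    refine h0.trans (Eventually.of_forall fun x => ?_)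
    simp only [BFSpace.ev, twConv, integral_congr_ae (h1 x), integral_zero, Pi.zero_apply]
  add_mem' := by
    rintro f g ⟨hf, hf'⟩ ⟨hg, hg'⟩
    have h0 : (𝓑.toAE (f + g) : G → ℂ) =ᵐ[μ] 𝓑.toAE f + 𝓑.toAE g := by
      rw [map_add]; exact AEEqFun.coeFn_add _ _
    have h1 : ∀ x, (fun y => 𝓑.toAE (f + g) y * twL σ y φ x) =ᵐ[μ]
        fun y => 𝓑.toAE f y * twL σ y φ x + 𝓑.toAE g y * twL σ y φ x := by
      intro x
      filter_upwards [h0] with y hy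
      rw [hy]; simp [add_mul]
    refine ⟨fun x => ((hf x).add (hg x)).congr (h1 x).symm, ?_⟩
    refine h0.trans ((hf'.add hg').trans (Eventually.of_forall fun x => ?_))
    simp only [BFSpace.ev, twConv, integral_congr_ae (h1 x)]
    exact (integral_add (hf x) (hg x)).symm
  smul_mem' := by
    rintro c f ⟨hf, hf'⟩
    have h0 : (𝓑.toAE (c • f) : G → ℂ) =ᵐ[μ] c • ⇑(𝓑.toAE f) := by
      rw [map_smul]; exact AEEqFun.coeFn_smul _ _
    have h1 : ∀ x, (fun y => 𝓑.toAE (c • f) y * twL σ y φ x) =ᵐ[μ]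
        fun y => c * (𝓑.toAE f y * twL σ y φ x) := by
      intro x
      filter_upwards [h0] with y hy
      rw [hy]; simp [mul_assoc]
    refine ⟨fun x => ((hf x).const_mul c).congr (h1 x).symm, ?_⟩
    refine h0.trans ((hf'.const_smul c).trans (Eventually.of_forall fun x => ?_))
    simp only [BFSpace.ev, twConv, integral_congr_ae (h1 x), integral_const_mul, Pi.smul_apply,
      smul_eq_mul]

end BF

/-! ### Coorbit spaces -/

section Coorbit

variable {G S : Type*} [TopologicalSpace G] [Group G] [MeasurableSpace G]
  [AddCommGroup S] [Module ℂ S] [TopologicalSpace S]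
  {μ : Measure G} {B : Type*} [NormedAddCommGroup B] [NormedSpace ℂ B]

/-- The coorbit space `{l ∈ S* | W_u(l) ∈ B}`. -/
def coorbit (ρ : ProjRep G S) (𝓑 : BFSpace μ B) (u : S) : Submodule ℂ (S →L⋆[ℂ] ℂ) where
  carrier := {l | ∃ f : B, 𝓑.Rep f (ρ.wav u l)}
  zero_mem' := by
    refine ⟨0, ?_⟩
    have h0 : (𝓑.toAE 0 : G → ℂ) =ᵐ[μ] 0 := by
      rw [map_zero]; exact AEEqFun.coeFn_zero
    exact h0.trans (Eventually.of_forall fun x => by simp [ProjRep.wav])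
  add_mem' := by
    rintro l m ⟨f, hf⟩ ⟨g, hg⟩
    refine ⟨f + g, ?_⟩
    have h0 : (𝓑.toAE (f + g) : G → ℂ) =ᵐ[μ] 𝓑.toAE f + 𝓑.toAE g := by
      rw [map_add]; exact AEEqFun.coeFn_add _ _
    exact h0.trans ((hf.add hg).trans (Eventually.of_forall fun x => by simp [ProjRep.wav]))
  smul_mem' := by
    rintro c l ⟨f, hf⟩
    refine ⟨c • f, ?_⟩
    have h0 : (𝓑.toAE (c • f) : G → ℂ) =ᵐ[μ] c • ⇑(𝓑.toAE f) := by
      rw [map_smul]; exact AEEqFun.coeFn_smul _ _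
    exact h0.trans ((hf.const_smul c).trans (Eventually.of_forall fun x => by simp [ProjRep.wav]))

/-- The wavelet transform as a map from the coorbit space to `B`. -/
def coorbitW (ρ : ProjRep G S) (𝓑 : BFSpace μ B) (u : S) (l : coorbit ρ 𝓑 u) : B := l.2.choose

/-- The norm of the coorbit space, `‖l‖ = ‖W_u(l)‖_B`. -/
def coNorm (ρ : ProjRep G S) (𝓑 : BFSpace μ B) (u : S) (l : coorbit ρ 𝓑 u) : ℝ :=
  ‖coorbitW ρ 𝓑 u l‖

/-- `u` is `ρ`-analyzing, where `j : S → S*` is the embedding: `u` is cyclic and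
`W_u(l) # W_u(u) = W_u(l)` for all `l ∈ S*`. -/
def Analyzing (μ : Measure G) (ρ : ProjRep G S) (j : S →ₗ[ℂ] (S →L⋆[ℂ] ℂ)) (u : S) : Prop :=
  ρ.Cyclic u ∧ ∀ (l : S →L⋆[ℂ] ℂ) (x : G),
    TwConvExists μ ρ.σ (ρ.wav u l) (ρ.wav u (j u)) x ∧
    twConv μ ρ.σ (ρ.wav u l) (ρ.wav u (j u)) x = ρ.wav u l x

/-- The standing assumption of coorbit theory on `B`, `ρ`, `u`. -/
structure CoorbitAssumption (ρ : ProjRep G S) (j : S →ₗ[ℂ] (S →L⋆[ℂ] ℂ))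
    (𝓑 : BFSpace μ B) (u : S) : Prop where
  bddTransl_left : 𝓑.BddTransl (twL ρ.σ)
  ne_zero : u ≠ 0
  analyzing : Analyzing μ ρ j u
  exists_pairing : ∀ (f : B) (v : S), TwConvExists μ ρ.σ (𝓑.toAE f) (ρ.wav v (j u)) 1
  continuous_pairing : Continuous fun p : B × S =>
    twConv μ ρ.σ (𝓑.toAE p.1) (ρ.wav p.2 (j u)) 1

/-- The assumption under which atomic decompositions are obtained, on a Lie group of
dimension `n`. -/
structure AtomicAssumption {n : ℕ} [ChartedSpace (EuclideanSpace ℝ (Fin n)) G]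
    (ρ : ProjRep G S) (j : S →ₗ[ℂ] (S →L⋆[ℂ] ℂ)) (𝓑 : BFSpace μ B) (u : S) : Prop
    extends CoorbitAssumption ρ j 𝓑 u where
  solid : 𝓑.Solid
  bddTransl_right : 𝓑.BddTransl (twR ρ.σ)
  cont_left : 𝓑.ContTransl (twL trivCocycle)
  cont_right : 𝓑.ContTransl (twR trivCocycle)
  weaklyDiff : ρ.WeaklyDiff (n := n) n u
  dualWeaklyDiff : ρ.DualWeaklyDiff (n := n) n (j u)
  bdd_dualDeriv : ∀ Ys : List (GroupLieAlgebra (𝓡 n) G), Ys.length ≤ n →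
    𝓑.BddAbsConv (ρ.wav u (ρ.iterDualDeriv Ys (j u)))
  bdd_deriv : ∀ Ys : List (GroupLieAlgebra (𝓡 n) G), Ys.length ≤ n →
    𝓑.BddAbsConv (ρ.wav (ρ.iterDeriv Ys u) (j u))

end Coorbit

/-! ### Sampling sets, partitions of unity, sequence spaces -/

section Sampling

variable {G : Type*} [TopologicalSpace G] [Group G] [MeasurableSpace G] {ι : Type}

/-- `G = ⋃ xᵢ U`. -/
def UDense (U : Set G) (x : ι → G) : Prop := ∀ g, ∃ i, (x i)⁻¹ * g ∈ U

/-- The family is a finite union of `V`-separated families for some neighbourhood `V` of `1`. -/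
def WellSpread (x : ι → G) : Prop :=
  ∃ V ∈ 𝓝 (1 : G), ∃ (N : ℕ) (c : ι → Fin N), ∀ i k, i ≠ k → c i = c k →
    Disjoint ((fun g => x i * g) '' V) ((fun g => x k * g) '' V)

/-- A bounded uniform partition of unity subordinate to the sets `xᵢ U`. -/
structure IsBUPU (U : Set G) (x : ι → G) (ψ : ι → G → ℝ) : Prop where
  measurable : ∀ i, Measurable (ψ i)
  nonneg : ∀ i y, 0 ≤ ψ i y
  le_one : ∀ i y, ψ i y ≤ 1
  supp : ∀ i y, ψ i y ≠ 0 → (x i)⁻¹ * y ∈ U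
  sum_one : ∀ y, HasSum (fun i => ψ i y) 1

/-- The function `∑ᵢ |cᵢ| 1_{xᵢU}` (a finite sum at every point if `x` is well-spread and `U` is
relatively compact). -/
def stepFun (U : Set G) (x : ι → G) (c : ι → ℂ) (y : G) : ℂ :=
  ((∑' i, ‖c i‖ * U.indicator (fun _ => (1 : ℝ)) ((x i)⁻¹ * y) : ℝ) : ℂ)

variable {μ : Measure G} {B : Type*} [NormedAddCommGroup B] [NormedSpace ℂ B]

/-- Membership in the sequence space associated with `B`: `∑ᵢ |cᵢ| 1_{xᵢU} ∈ B`. -/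
def MemSeq (𝓑 : BFSpace μ B) (U : Set G) (x : ι → G) (c : ι → ℂ) : Prop :=
  ∃ f : B, 𝓑.Rep f (stepFun U x c)

open Classical in
/-- The norm `‖∑ᵢ |cᵢ| 1_{xᵢU}‖_B` of a member of the sequence space. -/
def seqNorm (𝓑 : BFSpace μ B) (U : Set G) (x : ι → G) (c : ι → ℂ) : ℝ :=
  if h : MemSeq 𝓑 U x c then ‖h.choose‖ else 0

end Sampling

/-! ### The sampling operators -/

section Operators

variable {G : Type*} [TopologicalSpace G] [Group G] [MeasurableSpace G]
  {μ : Measure G} {B : Type*} [NormedAddCommGroup B] [NormedSpace ℂ B] {ι : Type}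

/-- `λᵢ(f) = ∫ f(y) ψᵢ(y) conj σ(y, y⁻¹xᵢ) dy`. -/
def lam (𝓑 : BFSpace μ B) (σ : G → G → Circle) (φ : G → ℂ) (x : ι → G) (ψ : ι → G → ℝ)
    (f : B) (i : ι) : ℂ :=
  ∫ y, 𝓑.ev σ φ f y * (ψ i y : ℂ) * conj (σ y (y⁻¹ * x i) : ℂ) ∂μ

/-- `cᵢ = ∫ ψᵢ`. -/
def wt (μ : Measure G) (ψ : ι → G → ℝ) (i : ι) : ℂ := ((∫ y, ψ i y ∂μ : ℝ) : ℂ)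

/-- The function `y ↦ σ(y, y⁻¹xᵢ) ψᵢ(y)`. -/
def twBump (σ : G → G → Circle) (x : ι → G) (ψ : ι → G → ℝ) (i : ι) (y : G) : ℂ :=
  (σ y (y⁻¹ * x i) : ℂ) * (ψ i y : ℂ)

/-- `T f = (∑ᵢ f(xᵢ) σ(·, ·⁻¹xᵢ) ψᵢ) # φ`, where the sum and the convolution integral exist
everywhere. -/
def IsT1 (𝓑 : BFSpace μ B) (σ : G → G → Circle) (φ : G → ℂ) (x : ι → G) (ψ : ι → G → ℝ)
    (T : 𝓑.repro σ φ → 𝓑.repro σ φ) : Prop :=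
  ∀ f : 𝓑.repro σ φ,
    (∀ y, Summable fun i => 𝓑.ev σ φ f (x i) * twBump σ x ψ i y) ∧
    ∀ z, TwConvExists μ σ (fun y => ∑' i, 𝓑.ev σ φ f (x i) * twBump σ x ψ i y) φ z ∧
      𝓑.ev σ φ (T f) z = twConv μ σ (fun y => ∑' i, 𝓑.ev σ φ f (x i) * twBump σ x ψ i y) φ z

/-- `T f = ∑ᵢ λᵢ(f) ℓ^σ_{xᵢ} φ`, where the integrals exist and the sum converges absolutely at
every point. -/
def IsT2 (𝓑 : BFSpace μ B) (σ : G → G → Circle) (φ : G → ℂ) (x : ι → G) (ψ : ι → G → ℝ)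
    (T : 𝓑.repro σ φ → 𝓑.repro σ φ) : Prop :=
  ∀ f : 𝓑.repro σ φ,
    (∀ i, Integrable
      (fun y => 𝓑.ev σ φ f y * (ψ i y : ℂ) * conj (σ y (y⁻¹ * x i) : ℂ)) μ) ∧
    ∀ z, HasSum (fun i => lam 𝓑 σ φ x ψ f i * twL σ (x i) φ z) (𝓑.ev σ φ (T f) z)

/-- `T f = ∑ᵢ cᵢ f(xᵢ) ℓ^σ_{xᵢ} φ`, where the integrals exist and the sum converges absolutely at
every point. -/
def IsT3 (𝓑 : BFSpace μ B) (σ : G → G → Circle) (φ : G → ℂ) (x : ι → G) (ψ : ι → G → ℝ)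
    (T : 𝓑.repro σ φ → 𝓑.repro σ φ) : Prop :=
  (∀ i, Integrable (ψ i) μ) ∧ ∀ f : 𝓑.repro σ φ,
    ∀ z, HasSum (fun i => wt μ ψ i * 𝓑.ev σ φ f (x i) * twL σ (x i) φ z) (𝓑.ev σ φ (T f) z)

end Operators

/-! ### Banach frames and atomic decompositions -/

section Frames

variable {G S : Type*} [TopologicalSpace G] [Group G] [MeasurableSpace G]
  [AddCommGroup S] [Module ℂ S] [TopologicalSpace S]
  {μ : Measure G} {B : Type*} [NormedAddCommGroup B] [NormedSpace ℂ B] {ι : Type}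

/-- `Λ` is a bounded linear functional on the coorbit space. -/
def IsBddFunctional (ρ : ProjRep G S) (𝓑 : BFSpace μ B) (u : S)
    (Λ : coorbit ρ 𝓑 u → ℂ) : Prop :=
  ∃ L : coorbit ρ 𝓑 u →ₗ[ℂ] ℂ, (∀ γ, L γ = Λ γ) ∧ ∃ C : ℝ, ∀ γ, ‖Λ γ‖ ≤ C * coNorm ρ 𝓑 u γ

/-- The coefficients `(Λᵢ(γ))ᵢ` lie in the sequence space and their norm is equivalent to that
of `γ`. -/
def NormEquiv (ρ : ProjRep G S) (𝓑 : BFSpace μ B) (u : S) (U : Set G) (x : ι → G)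
    (Λ : ι → coorbit ρ 𝓑 u → ℂ) : Prop :=
  (∀ γ, MemSeq 𝓑 U x fun i => Λ i γ) ∧
  ∃ A > 0, ∃ C : ℝ, ∀ γ, A * coNorm ρ 𝓑 u γ ≤ seqNorm 𝓑 U x (fun i => Λ i γ) ∧
    seqNorm 𝓑 U x (fun i => Λ i γ) ≤ C * coNorm ρ 𝓑 u γ

/-- The functionals `Λᵢ` form a Banach frame of the coorbit space with respect to the sequence
space: the norms are equivalent and there is a bounded linear reconstruction operator defined on
the whole sequence space. -/
def IsBanachFrame (ρ : ProjRep G S) (𝓑 : BFSpace μ B) (u : S) (U : Set G) (x : ι → G)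
    (Λ : ι → coorbit ρ 𝓑 u → ℂ) : Prop :=
  (∀ i, IsBddFunctional ρ 𝓑 u (Λ i)) ∧ NormEquiv ρ 𝓑 u U x Λ ∧
  ∃ R : (ι → ℂ) →ₗ.[ℂ] coorbit ρ 𝓑 u,
    (∀ c, c ∈ R.domain ↔ MemSeq 𝓑 U x c) ∧
    (∃ C : ℝ, ∀ c : R.domain, coNorm ρ 𝓑 u (R c) ≤ C * seqNorm 𝓑 U x c) ∧
    ∀ (γ : coorbit ρ 𝓑 u) (c : R.domain), (∀ i, (c : ι → ℂ) i = Λ i γ) → R c = γ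

/-- The functionals `Λᵢ` and atoms `aᵢ` form an atomic decomposition of the coorbit space with
respect to the sequence space, `γ = ∑ᵢ Λᵢ(γ) aᵢ` holding with weak-* convergence in `S*`. -/
def IsAtomicDecomp (ρ : ProjRep G S) (𝓑 : BFSpace μ B) (u : S) (U : Set G) (x : ι → G)
    (Λ : ι → coorbit ρ 𝓑 u → ℂ) (a : ι → coorbit ρ 𝓑 u) : Prop :=
  (∀ i, IsBddFunctional ρ 𝓑 u (Λ i)) ∧ NormEquiv ρ 𝓑 u U x Λ ∧
  ∀ (γ : coorbit ρ 𝓑 u) (v : S),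
    HasSum (fun i => Λ i γ * (a i : S →L⋆[ℂ] ℂ) v) ((γ : S →L⋆[ℂ] ℂ) v)

end Frames

end

end ProjCoorbit

/-!
The mechanism is that `n` weak derivatives control a matrix coefficient locally, and that solidity,
translation continuity and boundedness of convolution with the coefficients of the derivatives of
`u` convert this local control into norm estimates on `B`.

*Local estimates.* Let `H` be a coefficient `x ↦ ⟨λ, ρ(x)v⟩` with `v` weakly differentiable up to
order `n = dim G`. The inverse function theorem, applied to products of one-parameter subgroups,
makes `H`, up to the smooth phase coming from the cocycle, differentiable in a chart at `1`.
Integrating along one coordinate direction after the other, the fundamental theorem of calculus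
bounds the oscillation of `H` near `x` by the integral of the translate `w ↦ M(xw)` against a
finite measure of small mass with compact support, where `M(x) = ∑ |⟨λ, ρ(x)ρ(Y₁)⋯ρ(Yₖ)v⟩|` sums
over words of length `k ≤ n` in a basis. The measure may be singular, since `B` is invariant under
translations. These are `CoeffFamily.exists_osc_measure` and
`CoeffFamily.exists_max_measure`; `CoeffFamily` covers `ρ` and `ρ*` at once.

*From pointwise to norm bounds.* `BFSpace.Dom 𝓑 Φ M` says that `Φ ≤ |f|` a.e. for some `f` in `B` of
norm at most `M`. A solid BF-space has a solidity constant (`exists_solid_const`), and averages of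
translates of a dominated function are dominated, the witness being a Bochner integral in `B`
(`exists_dom_average`, `DomConv.exists_left_average`). The result is that local maximal functions of
wavelet transforms are dominated, and their local oscillations are dominated with constants tending
to `0` with the neighbourhood: `exists_right_max` and `exists_right_osc` for differentiability of
`u` under `ρ`, `domConv_left_max` and `exists_left_osc` for that under `ρ*`.

*Correspondence.* Each `f` in `B` defines the functional `synth f = ∫ f(y) ρ*(y)u dy` on `S`, and
`f # W_u(u) = W_u(synth f)`. Hence `W_u` maps the coorbit space bijectively onto the reproducing
kernel space (`waveletEquiv`), and all statements can be moved from one side to the other.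

*Sampling operators.* Since `σ(y, y⁻¹xᵢ)` is the phase that relates `W_u(λ)(xᵢ)` to `W_u(λ)(y)`, the
differences `I - T₁`, `I - T₂` and `T₂ - T₃` are controlled by right and left oscillations over
`U_ε⁻¹`. For small `ε` they have norm at most `1/4`, so that all three operators are inverted by
Neumann series (`exists_sampling_equiv`).

*Sequence spaces.* Coefficients obtained by sampling or by local averages lie in `ḃ` because the
corresponding step functions are bounded by a local maximal function (`exists_dom_stepSum`).
Conversely `∑ cᵢαᵢ` converges weakly to an element of the coorbit space whose norm is bounded by that
of `c` in `ḃ`, for `αᵢ = ρ*(xᵢ)u` and for the functionals of the bumps (`Synthesizes`). Together with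
the inverses of `T₁, T₂, T₃` this gives the frame and the two atomic decompositions. If `C_c(G)` is
dense in `B`, tails of sequences in `ḃ` have small norm (`MemSeq.exists_tail_le`), so that the weak
convergence improves to norm convergence (`hasSum_of_ccDense`).
-/

namespace ProjCoorbit

open scoped ENNReal NNReal Pointwise

set_option linter.unusedSectionVars false

/-! ### One-parameter subgroups -/

section LieExp

variable {n : ℕ} {G : Type*} [TopologicalSpace G]
  [ChartedSpace (EuclideanSpace ℝ (Fin n)) G] [Group G] [LieGroup (𝓡 n) ∞ G]

lemma mfderiv_mul_left_mulInvariantVectorField (X : GroupLieAlgebra (𝓡 n) G) (g h : G) :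
    mfderiv (𝓡 n) (𝓡 n) (fun a => g * a) h (mulInvariantVectorField (I := 𝓡 n) X h) =
      mulInvariantVectorField (I := 𝓡 n) X (g * h) := by
  have : (fun a : G => g * h * a) = (fun a => g * a) ∘ (fun a => h * a) := by
    ext a; simp [mul_assoc]
  simp only [mulInvariantVectorField]
  rw [this, mfderiv_comp_of_eq (I' := 𝓡 n) (y := h)
    ((contMDiff_mul_left (I := 𝓡 n) (n := ∞)).contMDiffAt.mdifferentiableAt (by simp))
    ((contMDiff_mul_left (I := 𝓡 n) (n := ∞)).contMDiffAt.mdifferentiableAt (by simp)) (by simp)]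
  have key : ∀ (k : G) (_ : k = h) (v : EuclideanSpace ℝ (Fin n)),
      (mfderiv (𝓡 n) (𝓡 n) (fun a => g * a) h :
        EuclideanSpace ℝ (Fin n) →L[ℝ] EuclideanSpace ℝ (Fin n)) v =
      (mfderiv (𝓡 n) (𝓡 n) (fun a => g * a) k :
        EuclideanSpace ℝ (Fin n) →L[ℝ] EuclideanSpace ℝ (Fin n)) v := by
    rintro _ rfl v; rfl
  exact key _ (mul_one h) _

lemma IsMIntegralCurveOn.mul_left {X : GroupLieAlgebra (𝓡 n) G} {γ : ℝ → G} {s : Set ℝ}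
    (h : IsMIntegralCurveOn (I := 𝓡 n) γ (mulInvariantVectorField (I := 𝓡 n) X) s) (g : G) :
    IsMIntegralCurveOn (I := 𝓡 n) (fun t => g * γ t)
      (mulInvariantVectorField (I := 𝓡 n) X) s := by
  intro t ht
  have h1 := h t ht
  have h2 : HasMFDerivAt (𝓡 n) (𝓡 n) (fun a => g * a) (γ t)
      (mfderiv (𝓡 n) (𝓡 n) (fun a => g * a) (γ t)) :=
    ((contMDiff_mul_left (I := 𝓡 n) (n := ∞)).contMDiffAt.mdifferentiableAt
      (by simp)).hasMFDerivAt
  have h3 := h2.comp_hasMFDerivWithinAt t h1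
  rw [← mfderiv_mul_left_mulInvariantVectorField]
  have key : ∀ (T : EuclideanSpace ℝ (Fin n) →L[ℝ] EuclideanSpace ℝ (Fin n))
      (w : EuclideanSpace ℝ (Fin n)), (1 : ℝ →L[ℝ] ℝ).smulRight (T w) =
      T.comp ((1 : ℝ →L[ℝ] ℝ).smulRight w) := by
    intro T w; ext1; simp
  exact h3.congr_mfderiv (key _ _).symm

lemma contMDiff_mulInvariantVectorField_one (X : GroupLieAlgebra (𝓡 n) G) :
    ContMDiff (𝓡 n) (𝓡 n).tangent 1
      (fun g => (⟨g, mulInvariantVectorField (I := 𝓡 n) X g⟩ : TangentBundle (𝓡 n) G)) := by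
  have : LieGroup (𝓡 n) (minSmoothness ℝ 3) G := LieGroup.of_le (n := ∞)
    (by rw [minSmoothness_of_isRCLikeNormedField]; exact WithTop.coe_le_coe.2 (le_top : (3 : ℕ∞) ≤ ⊤))
  refine (contMDiff_mulInvariantVectorField X).of_le ?_
  simp

variable [T2Space G]

/-- Left-invariant vector fields are complete: left translation of one local integral curve gives
integral curves of the same lifetime through every point. -/
lemma exists_oneParam (X : GroupLieAlgebra (𝓡 n) G) :
    ∃ γ : ℝ → G, γ 0 = 1 ∧
      IsMIntegralCurve (I := 𝓡 n) γ (mulInvariantVectorField (I := 𝓡 n) X) := by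
  have : IsManifold (𝓡 n) 1 G := IsManifold.of_le (n := ∞) (by simp)
  have hv := contMDiff_mulInvariantVectorField_one (G := G) X
  obtain ⟨γ, h0, hγ⟩ := exists_isMIntegralCurveAt_of_contMDiffAt_boundaryless (I := 𝓡 n) 0
    (hv.contMDiffAt (x := (1 : G)))
  obtain ⟨ε, hε, hγ⟩ := isMIntegralCurveAt_iff'.1 hγ
  refine exists_isMIntegralCurve_of_isMIntegralCurveOn hv hε (fun g => ?_) 1
  refine ⟨fun t => g * γ t, by simp [h0], ?_⟩
  have := IsMIntegralCurveOn.mul_left hγ g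
  rwa [Real.ball_eq_Ioo, zero_sub, zero_add] at this

lemma oneParam_unique {X : GroupLieAlgebra (𝓡 n) G} {γ γ' : ℝ → G}
    (hγ : IsMIntegralCurve (I := 𝓡 n) γ (mulInvariantVectorField (I := 𝓡 n) X))
    (hγ' : IsMIntegralCurve (I := 𝓡 n) γ' (mulInvariantVectorField (I := 𝓡 n) X))
    (h : γ 0 = γ' 0) : γ = γ' := by
  have : IsManifold (𝓡 n) 1 G := IsManifold.of_le (n := ∞) (by simp)
  exact isMIntegralCurve_Ioo_eq_of_contMDiff_boundaryless
    (contMDiff_mulInvariantVectorField_one (G := G) X) hγ hγ' h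

lemma lieExp_smul_eq {X : GroupLieAlgebra (𝓡 n) G} {γ : ℝ → G} (h0 : γ 0 = 1)
    (hγ : IsMIntegralCurve (I := 𝓡 n) γ (mulInvariantVectorField (I := 𝓡 n) X)) (t : ℝ) :
    lieExp (t • X) = γ t := by
  have hex := exists_oneParam (G := G) (t • X)
  rw [lieExp, dif_pos hex]
  have h1 := hγ.comp_mul t
  have h2 : IsMIntegralCurve (I := 𝓡 n) (γ ∘ fun s => s * t)
      (mulInvariantVectorField (I := 𝓡 n) (t • X)) := by
    rw [mulInvariantVectorField_smul]; exact h1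
  have := oneParam_unique hex.choose_spec.2 h2 (by simp [hex.choose_spec.1, h0])
  rw [this]; simp

lemma isMIntegralCurve_lieExp (X : GroupLieAlgebra (𝓡 n) G) :
    IsMIntegralCurve (I := 𝓡 n) (fun t : ℝ => (lieExp (t • X) : G))
      (mulInvariantVectorField (I := 𝓡 n) X) := by
  obtain ⟨γ, h0, hγ⟩ := exists_oneParam (G := G) X
  have : (fun t : ℝ => (lieExp (t • X) : G)) = γ := funext fun t => lieExp_smul_eq h0 hγ t
  rwa [this]

lemma lieExp_zero : (lieExp (0 : GroupLieAlgebra (𝓡 n) G) : G) = 1 := by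
  obtain ⟨γ, h0, hγ⟩ := exists_oneParam (G := G) (0 : GroupLieAlgebra (𝓡 n) G)
  have := lieExp_smul_eq h0 hγ 0
  rwa [smul_zero, h0] at this

lemma lieExp_add_smul (X : GroupLieAlgebra (𝓡 n) G) (s t : ℝ) :
    (lieExp ((s + t) • X) : G) = lieExp (s • X) * lieExp (t • X) := by
  have h := isMIntegralCurve_lieExp (G := G) X
  -- both sides, as functions of `t`, solve the same initial value problem
  have h1 : IsMIntegralCurve (I := 𝓡 n) (fun t : ℝ => (lieExp (s • X) * lieExp (t • X) : G))
      (mulInvariantVectorField (I := 𝓡 n) X) := by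
    rw [isMIntegralCurve_iff_isMIntegralCurveOn] at h ⊢
    exact IsMIntegralCurveOn.mul_left h _
  have h2 := h.comp_add s
  have := congrFun (oneParam_unique h1 h2 (by simp [lieExp_zero])) t
  simp only [Function.comp_apply] at this
  rw [this, add_comm]

lemma continuous_lieExp_smul (X : GroupLieAlgebra (𝓡 n) G) :
    Continuous fun t : ℝ => (lieExp (t • X) : G) :=
  continuous_iff_continuousAt.2 fun t => (isMIntegralCurve_lieExp X t).continuousAt

variable (n G) in
/-- The identification of the Lie algebra `T₁G` with the model space given by the preferred chart
at the identity. -/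
noncomputable def lieModel : GroupLieAlgebra (𝓡 n) G ≃ₗ[ℝ] EuclideanSpace ℝ (Fin n) :=
  LinearEquiv.refl ℝ (EuclideanSpace ℝ (Fin n))

/-- In the preferred chart at the identity, where `T₁G` is identified with the model space, the
one-parameter subgroup of `X` has velocity `X` at time `0`. -/
lemma hasDerivAt_extChartAt_lieExp (X : GroupLieAlgebra (𝓡 n) G) :
    HasDerivAt (fun t : ℝ => extChartAt (𝓡 n) (1 : G) (lieExp (t • X))) (lieModel n G X) 0 := by
  have : IsManifold (𝓡 n) 1 G := IsManifold.of_le (n := ∞) (by simp)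
  have h0 : (lieExp ((0 : ℝ) • X) : G) = 1 := by rw [zero_smul, lieExp_zero]
  have h := isMIntegralCurve_lieExp (G := G) X
  have h1 := (h.isMIntegralCurveAt 0).eventually_hasDerivAt.self_of_nhds
  have h2 : (mulInvariantVectorField (I := 𝓡 n) X (1 : G) : EuclideanSpace ℝ (Fin n)) = X := by
    have key : ∀ (f : G → G) (_ : f = id),
        (mfderiv (𝓡 n) (𝓡 n) f 1 : EuclideanSpace ℝ (Fin n) →L[ℝ] EuclideanSpace ℝ (Fin n)) X =
          X := by
      rintro _ rfl
      exact congrArg (fun T : EuclideanSpace ℝ (Fin n) →L[ℝ] EuclideanSpace ℝ (Fin n) => T X)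
        (mfderiv_id (I := 𝓡 n) (x := (1 : G)))
    exact key _ (by ext; simp)
  have key : ∀ (g : G) (_ : g = 1), HasDerivAt
      (extChartAt (𝓡 n) g ∘ fun t : ℝ => (lieExp (t • X) : G))
      (tangentCoordChange (𝓡 n) g g g
        (mulInvariantVectorField (I := 𝓡 n) X g : EuclideanSpace ℝ (Fin n))) 0 →
      HasDerivAt (fun t : ℝ => extChartAt (𝓡 n) (1 : G) (lieExp (t • X)))
        (X : EuclideanSpace ℝ (Fin n)) 0 := by
    rintro _ rfl hd
    have h3 := tangentCoordChange_self (I := 𝓡 n) (x := (1 : G)) (z := 1)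
      (v := (mulInvariantVectorField (I := 𝓡 n) X (1 : G) : EuclideanSpace ℝ (Fin n))) (by simp)
    rw [h2] at h3
    rw [h2, h3] at hd
    exact hd
  exact key _ h0 h1

end LieExp

/-! ### Differentiation along one-parameter subgroups in coordinates -/

section Coordinates

variable {n : ℕ} {G : Type*} [TopologicalSpace G]
  [ChartedSpace (EuclideanSpace ℝ (Fin n)) G] [Group G] [LieGroup (𝓡 n) ∞ G]

lemma extChartAt_target_mem_nhds_one :
    (extChartAt (𝓡 n) (1 : G)).target ∈ 𝓝 (extChartAt (𝓡 n) (1 : G) 1) :=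
  extChartAt_target_mem_nhds (I := 𝓡 n) (1 : G)

/-- A map on `G × G` that is smooth near `(1, 1)` is smooth in the coordinates of the chart at the
identity. -/
lemma contDiffAt_chart_of_contMDiffAt {F : Type*} [NormedAddCommGroup F] [NormedSpace ℝ F]
    {f : G × G → F}
    (hf : ContMDiffAt ((𝓡 n).prod (𝓡 n)) 𝓘(ℝ, F) ∞ f (1, 1)) :
    ContDiffAt ℝ ∞ (fun p : EuclideanSpace ℝ (Fin n) × EuclideanSpace ℝ (Fin n) =>
      f ((extChartAt (𝓡 n) (1 : G)).symm p.1, (extChartAt (𝓡 n) (1 : G)).symm p.2))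
      (extChartAt (𝓡 n) (1 : G) 1, extChartAt (𝓡 n) (1 : G) 1) := by
  rw [← contMDiffAt_iff_contDiffAt]
  have hs : ContMDiffAt 𝓘(ℝ, EuclideanSpace ℝ (Fin n)) (𝓡 n) ∞
      (extChartAt (𝓡 n) (1 : G)).symm (extChartAt (𝓡 n) (1 : G) 1) :=
    (contMDiffOn_extChartAt_symm (1 : G)).contMDiffAt extChartAt_target_mem_nhds_one
  have h1 : ContMDiffAt 𝓘(ℝ, EuclideanSpace ℝ (Fin n) × EuclideanSpace ℝ (Fin n))
      ((𝓡 n).prod (𝓡 n)) ∞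
      (fun p : EuclideanSpace ℝ (Fin n) × EuclideanSpace ℝ (Fin n) =>
      ((extChartAt (𝓡 n) (1 : G)).symm p.1, (extChartAt (𝓡 n) (1 : G)).symm p.2))
      (extChartAt (𝓡 n) (1 : G) 1, extChartAt (𝓡 n) (1 : G) 1) :=
    (hs.comp (_, _) contDiff_fst.contMDiff.contMDiffAt).prodMk
      (hs.comp (_, _) contDiff_snd.contMDiff.contMDiffAt)
  refine ContMDiffAt.comp (_, _) ?_ h1
  simpa using hf

lemma contMDiffAt_extChartAt_comp {f : G × G → G}
    (hf : ContMDiffAt ((𝓡 n).prod (𝓡 n)) (𝓡 n) ∞ f (1, 1)) (h1 : f (1, 1) = 1) :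
    ContMDiffAt ((𝓡 n).prod (𝓡 n)) 𝓘(ℝ, EuclideanSpace ℝ (Fin n)) ∞
      (fun p => extChartAt (𝓡 n) (1 : G) (f p)) (1, 1) := by
  refine ContMDiffAt.comp (1, 1) ?_ hf
  rw [h1]
  exact contMDiffAt_extChartAt

variable (G) in
/-- Multiplication in the coordinates of the chart at the identity. -/
noncomputable def chartMul (p : EuclideanSpace ℝ (Fin n) × EuclideanSpace ℝ (Fin n)) :
    EuclideanSpace ℝ (Fin n) :=
  extChartAt (𝓡 n) (1 : G)
    ((extChartAt (𝓡 n) (1 : G)).symm p.1 * (extChartAt (𝓡 n) (1 : G)).symm p.2)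

variable (G) in
/-- The map `(g, h) ↦ g⁻¹h` in the coordinates of the chart at the identity. -/
noncomputable def chartDiv (p : EuclideanSpace ℝ (Fin n) × EuclideanSpace ℝ (Fin n)) :
    EuclideanSpace ℝ (Fin n) :=
  extChartAt (𝓡 n) (1 : G)
    (((extChartAt (𝓡 n) (1 : G)).symm p.1)⁻¹ * (extChartAt (𝓡 n) (1 : G)).symm p.2)

lemma contDiffAt_chartMul : ContDiffAt ℝ ∞ (chartMul (n := n) G)
    (extChartAt (𝓡 n) (1 : G) 1, extChartAt (𝓡 n) (1 : G) 1) :=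
  contDiffAt_chart_of_contMDiffAt (contMDiffAt_extChartAt_comp
    ((contMDiff_mul (𝓡 n) ∞ (G := G)).contMDiffAt) (by simp))

lemma contDiffAt_chartDiv : ContDiffAt ℝ ∞ (chartDiv (n := n) G)
    (extChartAt (𝓡 n) (1 : G) 1, extChartAt (𝓡 n) (1 : G) 1) :=
  contDiffAt_chart_of_contMDiffAt (f := fun p : G × G => extChartAt (𝓡 n) (1 : G) (p.1⁻¹ * p.2))
    (contMDiffAt_extChartAt_comp
    ((contMDiff_fst.inv.mul contMDiff_snd).contMDiffAt) (by simp))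

/-- The one-parameter product `∏ exp(tₖXₖ)` over a list of indices. -/
noncomputable def expProd (X : Fin n → GroupLieAlgebra (𝓡 n) G) (ks : List (Fin n))
    (t : Fin n → ℝ) : G :=
  (ks.map fun k => lieExp (t k • X k)).prod

variable [T2Space G]

lemma continuous_expProd [IsTopologicalGroup G] (X : Fin n → GroupLieAlgebra (𝓡 n) G)
    (ks : List (Fin n)) :
    Continuous (expProd X ks) := by
  induction ks with
  | nil => exact (continuous_const (y := (1 : G))).congr fun t => by simp [expProd]
  | cons k ks ih =>
    have : expProd X (k :: ks) = fun t => lieExp (t k • X k) * expProd X ks t := by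
      ext t; simp [expProd]
    rw [this]
    exact ((continuous_lieExp_smul (X k)).comp (continuous_apply k)).mul ih

lemma expProd_zero (X : Fin n → GroupLieAlgebra (𝓡 n) G) (ks : List (Fin n)) :
    expProd X ks 0 = 1 := by
  induction ks with
  | nil => simp [expProd]
  | cons k ks ih => simp_all [expProd, lieExp_zero]

lemma chart_symm_apply_one :
    (extChartAt (𝓡 n) (1 : G)).symm (extChartAt (𝓡 n) (1 : G) 1) = 1 :=
  (extChartAt (𝓡 n) (1 : G)).left_inv (mem_extChartAt_source (I := 𝓡 n) (1 : G))

lemma eventually_chart_symm_chart :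
    ∀ᶠ g in 𝓝 (1 : G), (extChartAt (𝓡 n) (1 : G)).symm (extChartAt (𝓡 n) (1 : G) g) = g := by
  filter_upwards [extChartAt_source_mem_nhds (I := 𝓡 n) (1 : G)] with g hg
  exact (extChartAt (𝓡 n) (1 : G)).left_inv hg

lemma chartMul_eq {g h : G}
    (hg : (extChartAt (𝓡 n) (1 : G)).symm (extChartAt (𝓡 n) (1 : G) g) = g)
    (hh : (extChartAt (𝓡 n) (1 : G)).symm (extChartAt (𝓡 n) (1 : G) h) = h) :
    chartMul G (extChartAt (𝓡 n) (1 : G) g, extChartAt (𝓡 n) (1 : G) h) =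
      extChartAt (𝓡 n) (1 : G) (g * h) := by
  simp only [chartMul, hg, hh]

lemma hasStrictDerivAt_chart_lieExp (X : GroupLieAlgebra (𝓡 n) G) :
    HasStrictDerivAt (fun t : ℝ => extChartAt (𝓡 n) (1 : G) (lieExp (t • X)))
      (lieModel n G X) 0 := by
  have hX := hasDerivAt_extChartAt_lieExp (G := G) X
  set κ := extChartAt (𝓡 n) (1 : G) with hκ
  set f' : ℝ → EuclideanSpace ℝ (Fin n) := fun t =>
    fderiv ℝ (chartMul G) (κ (lieExp (t • X)), κ 1) (0, (lieModel n G X)) with hf'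
  have hexp : Tendsto (fun t : ℝ => (lieExp (t • X) : G)) (𝓝 0) (𝓝 1) := by
    have := (continuous_lieExp_smul (G := G) X).tendsto 0
    rwa [zero_smul, lieExp_zero] at this
  have hκc : ContinuousAt κ (1 : G) := continuousAt_extChartAt (I := 𝓡 n) (1 : G)
  have hpair : Tendsto (fun t : ℝ => (κ (lieExp (t • X)), κ 1)) (𝓝 0) (𝓝 (κ 1, κ 1)) :=
    (hκc.tendsto.comp hexp).prodMk_nhds tendsto_const_nhds
  have hm := contDiffAt_chartMul (n := n) (G := G)
  have hm1 : ∀ᶠ p in 𝓝 (κ 1, κ 1), DifferentiableAt ℝ (chartMul G) p :=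
    ((hm.of_le (m := 1) (by simp)).eventually (by simp)).mono fun p hp =>
      hp.differentiableAt (by simp)
  have hder : ∀ᶠ t in 𝓝 (0 : ℝ), HasDerivAt (fun t : ℝ => κ (lieExp (t • X))) (f' t) t := by
    filter_upwards [hpair.eventually hm1,
      hexp.eventually (eventually_chart_symm_chart (n := n) (G := G))] with t ht ht'
    have h1 : HasDerivAt (fun s : ℝ => chartMul G (κ (lieExp (t • X)), κ (lieExp (s • X))))
        (f' t) 0 := by
      have h2 : HasDerivAt (fun s : ℝ => (κ (lieExp (t • X)), κ (lieExp (s • X))))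
        (0, (lieModel n G X)) 0 := (hasDerivAt_const _ _).prodMk hX
      refine HasFDerivAt.comp_hasDerivAt_of_eq (0 : ℝ) (ht.hasFDerivAt) h2 ?_
      simp [lieExp_zero]
    have h3 : HasDerivAt (fun s : ℝ => κ (lieExp ((t + s) • X))) (f' t) 0 := by
      refine h1.congr_of_eventuallyEq ?_
      filter_upwards [hexp.eventually (eventually_chart_symm_chart (n := n) (G := G))] with s hs
      rw [chartMul_eq ht' hs, lieExp_add_smul]
    have h4 := HasDerivAt.comp_sub_const (f := fun s : ℝ => κ (lieExp ((t + s) • X))) t t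
      (by simpa using h3)
    simpa using h4
  have hcont : ContinuousAt f' 0 := by
    have h1 : ContinuousAt (fderiv ℝ (chartMul (n := n) G)) (κ 1, κ 1) :=
      (hm.fderiv_right (m := 0) (by simp)).continuousAt
    have h2 : Tendsto (fun t : ℝ => fderiv ℝ (chartMul (n := n) G) (κ (lieExp (t • X)), κ 1)) (𝓝 0)
        (𝓝 (fderiv ℝ (chartMul (n := n) G) (κ 1, κ 1))) := h1.tendsto.comp hpair
    have h3 := ((ContinuousLinearMap.apply ℝ (EuclideanSpace ℝ (Fin n))
      ((0 : EuclideanSpace ℝ (Fin n)), (lieModel n G X))).continuous.tendsto _).comp h2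
    have h4 : f' 0 = fderiv ℝ (chartMul G) (κ 1, κ 1) (0, (lieModel n G X)) := by
      simp only [hf', zero_smul, lieExp_zero]
    rw [ContinuousAt, h4]
    exact h3
  have h5 := hasStrictDerivAt_of_hasDerivAt_of_continuousAt hder hcont
  rwa [hder.self_of_nhds.unique hX] at h5


lemma expProd_append_singleton (X : Fin n → GroupLieAlgebra (𝓡 n) G) (ks : List (Fin n))
    (k : Fin n) (t : Fin n → ℝ) :
    expProd X (ks ++ [k]) t = expProd X ks t * lieExp (t k • X k) := by
  simp [expProd]

lemma hasStrictFDerivAt_comp₂ {E F : Type*} [NormedAddCommGroup E] [NormedSpace ℝ E]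
    [NormedAddCommGroup F] [NormedSpace ℝ F] {m : F × F → F} {m' : F × F →L[ℝ] F}
    {f₁ f₂ : E → F} {f₁' f₂' : E →L[ℝ] F} {x : E} (hm : HasStrictFDerivAt m m' (f₁ x, f₂ x))
    (h₁ : HasStrictFDerivAt f₁ f₁' x) (h₂ : HasStrictFDerivAt f₂ f₂' x) :
    HasStrictFDerivAt (fun t => m (f₁ t, f₂ t)) (m'.comp (f₁'.prod f₂')) x :=
  HasStrictFDerivAt.comp x hm (h₁.prodMk h₂)

lemma fderiv_chartMul_one (a b : EuclideanSpace ℝ (Fin n)) :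
    fderiv ℝ (chartMul G) (extChartAt (𝓡 n) (1 : G) 1, extChartAt (𝓡 n) (1 : G) 1) (a, b) =
      a + b := by
  have hm := ((contDiffAt_chartMul (n := n) (G := G)).differentiableAt (by simp)).hasFDerivAt
  set κ := extChartAt (𝓡 n) (1 : G) with hκ
  have hev : ∀ᶠ p in 𝓝 (κ 1), κ (κ.symm p) = p := by
    filter_upwards [extChartAt_target_mem_nhds_one (n := n) (G := G)] with p hp
    exact κ.right_inv hp
  have h1 : fderiv ℝ (chartMul G) (κ 1, κ 1) (a, 0) = a := by
    have h := HasFDerivAt.comp (κ 1) (f := fun p => (id p, κ 1)) hm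
      ((hasFDerivAt_id (𝕜 := ℝ) (κ 1)).prodMk (hasFDerivAt_const (κ 1) (κ 1)))
    have h2 : HasFDerivAt (fun p => p) (ContinuousLinearMap.id ℝ (EuclideanSpace ℝ (Fin n)))
      (κ 1) := hasFDerivAt_id _
    have h3 := h2.congr_of_eventuallyEq (f₁ := chartMul G ∘ fun p => (id p, κ 1)) (by
      filter_upwards [hev] with p hp
      simp only [chartMul, Function.comp_apply, id]
      rw [chart_symm_apply_one, mul_one, ← hκ, hp])
    simpa using congrArg (fun T => T a) (h.unique h3)
  have h1' : fderiv ℝ (chartMul G) (κ 1, κ 1) (0, b) = b := by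
    have h := HasFDerivAt.comp (κ 1) (f := fun p => (κ 1, id p)) hm
      ((hasFDerivAt_const (κ 1) (κ 1)).prodMk (hasFDerivAt_id (𝕜 := ℝ) (κ 1)))
    have h2 : HasFDerivAt (fun p => p) (ContinuousLinearMap.id ℝ (EuclideanSpace ℝ (Fin n)))
      (κ 1) := hasFDerivAt_id _
    have h3 := h2.congr_of_eventuallyEq (f₁ := chartMul G ∘ fun p => (κ 1, id p)) (by
      filter_upwards [hev] with p hp
      simp only [chartMul, Function.comp_apply, id]
      rw [chart_symm_apply_one, one_mul, ← hκ, hp])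
    simpa using congrArg (fun T => T b) (h.unique h3)
  have : (a, b) = (a, 0) + (0, b) := by simp
  rw [this, map_add, h1, h1']

lemma hasStrictFDerivAt_chart_expProd [IsTopologicalGroup G]
    (X : Fin n → GroupLieAlgebra (𝓡 n) G) (ks : List (Fin n)) :
    HasStrictFDerivAt (fun t => extChartAt (𝓡 n) (1 : G) (expProd X ks t))
      ((ks.map fun k => (ContinuousLinearMap.proj (R := ℝ) (φ := fun _ : Fin n => ℝ) k).smulRight
        (lieModel n G (X k))).sum) 0 := by
  set κ := extChartAt (𝓡 n) (1 : G) with hκ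
  induction ks with
  | nil => 
    simp only [expProd, List.map_nil, List.prod_nil, List.sum_nil]
    exact hasStrictFDerivAt_const _ _
  | cons k ks ih =>
    have hm := contDiffAt_chartMul (n := n) (G := G)
    have hm' := hm.hasStrictFDerivAt (by simp)
    have hc : HasStrictFDerivAt (fun t : Fin n → ℝ => κ (lieExp (t k • X k)))
        ((ContinuousLinearMap.proj (R := ℝ) (φ := fun _ : Fin n => ℝ) k).smulRight
        (lieModel n G (X k))) 0 := by
      have h1 := (hasStrictDerivAt_chart_lieExp (X k)).hasStrictFDerivAt
      have h2 := (ContinuousLinearMap.proj (R := ℝ) (φ := fun _ : Fin n => ℝ) k).hasStrictFDerivAt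
        (x := 0)
      refine (HasStrictFDerivAt.comp (0 : Fin n → ℝ) (by simpa using h1) h2).congr_fderiv ?_
      ext1; simp
    have hκk : Tendsto (fun t : Fin n → ℝ => (lieExp (t k • X k) : G)) (𝓝 0) (𝓝 1) := by
      have := ((continuous_lieExp_smul (G := G) (X k)).comp (continuous_apply k)).tendsto
        (0 : Fin n → ℝ)
      simpa [lieExp_zero, Function.comp_def] using this
    have hκs : Tendsto (expProd X ks) (𝓝 0) (𝓝 (1 : G)) := by
      have := (continuous_expProd X ks).tendsto 0
      rwa [expProd_zero] at this
    have h0 : (κ (lieExp ((0 : Fin n → ℝ) k • X k)), κ (expProd X ks 0)) = (κ 1, κ 1) := by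
      rw [expProd_zero, Pi.zero_apply, zero_smul, lieExp_zero]
    have hm'' : HasStrictFDerivAt (chartMul G) (fderiv ℝ (chartMul G) (κ 1, κ 1))
        (κ (lieExp ((0 : Fin n → ℝ) k • X k)), κ (expProd X ks 0)) := by rw [h0]; exact hm'
    have h3 := hasStrictFDerivAt_comp₂ hm'' hc ih
    refine (h3.congr_of_eventuallyEq ?_).congr_fderiv ?_
    · filter_upwards [hκk.eventually (eventually_chart_symm_chart (n := n) (G := G)),
        hκs.eventually (eventually_chart_symm_chart (n := n) (G := G))] with t ht ht'
      rw [hκ, chartMul_eq ht ht']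
      simp [expProd]
    · ext1 t
      simp only [ContinuousLinearMap.comp_apply, ContinuousLinearMap.prod_apply, List.map_cons,
        List.sum_cons, add_apply]
      exact fderiv_chartMul_one _ _

end Coordinates

section Coordinates

variable {n : ℕ} {G : Type*} [TopologicalSpace G]
  [ChartedSpace (EuclideanSpace ℝ (Fin n)) G] [Group G] [LieGroup (𝓡 n) ∞ G] [T2Space G]

/-- If `h` has derivatives `Dₖ` along the left-invariant fields `Xₖ` near `g`, continuous at `g`,
then `t ↦ h(g exp(t₁X₁)⋯exp(tₘXₘ))` is differentiable at `0`: telescope the product and apply the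
mean value inequality to each factor. -/
lemma hasFDerivAt_comp_expProd [IsTopologicalGroup G]
    (X : Fin n → GroupLieAlgebra (𝓡 n) G) {h : G → ℂ} {D : Fin n → G → ℂ} {g : G}
    (hd : ∀ᶠ g' in 𝓝 g, ∀ k, HasDerivAt (fun s : ℝ => h (g' * lieExp (s • X k))) (D k g') 0)
    (hD : ∀ k, ContinuousAt (D k) g) (ks : List (Fin n)) :
    HasFDerivAt (fun t => h (g * expProd X ks t))
      ((ks.map fun k => (ContinuousLinearMap.proj (R := ℝ) (φ := fun _ : Fin n => ℝ) k).smulRight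
        (D k g)).sum) 0 := by
  induction ks using List.reverseRecOn with
  | nil =>
    simp only [expProd, List.map_nil, List.prod_nil, List.sum_nil]
    exact hasFDerivAt_const _ _
  | append_singleton ks k ih =>
    have key : HasFDerivAt (fun t => h (g * expProd X (ks ++ [k]) t) - h (g * expProd X ks t))
        ((ContinuousLinearMap.proj (R := ℝ) (φ := fun _ : Fin n => ℝ) k).smulRight (D k g)) 0 := by
      -- the last factor: `h` minus its linear part has small derivative along `exp(sXₖ)`
      rw [hasFDerivAt_iff_isLittleO_nhds_zero, Asymptotics.isLittleO_iff]
      intro ε hε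
      set Ψ : (Fin n → ℝ) × ℝ → G := fun p => g * expProd X ks p.1 * lieExp (p.2 • X k) with hΨ
      have hΨc : Continuous Ψ := (continuous_const.mul ((continuous_expProd X ks).comp
        continuous_fst)).mul ((continuous_lieExp_smul (X k)).comp continuous_snd)
      have hΨ0 : Ψ 0 = g := by simp [hΨ, expProd_zero, lieExp_zero]
      have hT : Tendsto Ψ (𝓝 0) (𝓝 g) := by
        have := hΨc.tendsto 0; rwa [hΨ0] at this
      have hE := hT.eventually (hd.and ((hD k).eventually (Metric.closedBall_mem_nhds _ hε)))
      obtain ⟨δ, hδ, hball⟩ := Metric.eventually_nhds_iff_ball.1 hE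
      filter_upwards [Metric.ball_mem_nhds (0 : Fin n → ℝ) hδ] with t ht
      have ht' : ‖t‖ < δ := by simpa using ht
      have hmem : ∀ s ∈ Metric.ball (0 : ℝ) δ, (t, s) ∈ Metric.ball (0 : (Fin n → ℝ) × ℝ) δ := by
        intro s hs
        rw [mem_ball_zero_iff] at hs ⊢
        exact max_lt ht' hs
      set f : ℝ → ℂ := fun s => h (Ψ (t, s)) - s • D k g with hf
      have hder : ∀ s ∈ Metric.ball (0 : ℝ) δ,
          HasDerivWithinAt f (D k (Ψ (t, s)) - D k g) (Metric.ball (0 : ℝ) δ) s := by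
        intro s hs
        have h1 := (hball _ (hmem s hs)).1 k
        have h2 := HasDerivAt.comp_sub_const
          (f := fun r : ℝ => h (Ψ (t, s) * lieExp (r • X k))) s s (by simpa using h1)
        have h3 : (fun r : ℝ => h (Ψ (t, s) * lieExp ((r - s) • X k))) = fun r => h (Ψ (t, r)) := by
          ext r
          simp only [hΨ]
          rw [mul_assoc _ (lieExp (s • X k)), ← lieExp_add_smul]
          simp
        rw [h3] at h2
        have h4 : HasDerivAt (fun s : ℝ => s • D k g) (D k g) s := by
          simpa using (hasDerivAt_id s).smul_const (D k g)
        exact (h2.sub h4).hasDerivWithinAt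
      have hbd : ∀ s ∈ Metric.ball (0 : ℝ) δ, ‖D k (Ψ (t, s)) - D k g‖ ≤ ε := fun s hs => by
        have := (hball _ (hmem s hs)).2
        simpa [dist_eq_norm] using this
      have htk : t k ∈ Metric.ball (0 : ℝ) δ := by
        rw [mem_ball_zero_iff]; exact (norm_le_pi_norm t k).trans_lt ht'
      have hmv := (convex_ball (0 : ℝ) δ).norm_image_sub_le_of_norm_hasDerivWithin_le hder hbd
        (Metric.mem_ball_self hδ) htk
      have h5 : f (t k) - f 0 = h (g * expProd X (ks ++ [k]) (0 + t)) - h (g * expProd X ks (0 + t))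
          - (h (g * expProd X (ks ++ [k]) 0) - h (g * expProd X ks 0)) -
          ((ContinuousLinearMap.proj (R := ℝ) (φ := fun _ : Fin n => ℝ) k).smulRight (D k g)) t := by
        simp [hf, hΨ, expProd_append_singleton, expProd_zero, lieExp_zero, mul_assoc]
        ring
      rw [← h5]
      refine hmv.trans ?_
      rw [sub_zero]
      gcongr
      exact norm_le_pi_norm t k
    have := ih.add key
    refine (this.congr_of_eventuallyEq (Eventually.of_forall fun t => ?_)).congr_fderiv ?_
    · simp
    · simp

/-- The linear form on the model space with value `d k` at the basis vector `Xₖ`. -/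
noncomputable def frameForm (X : Module.Basis (Fin n) ℝ (GroupLieAlgebra (𝓡 n) G)) (d : Fin n → ℂ) :
    EuclideanSpace ℝ (Fin n) →L[ℝ] ℂ :=
  ∑ k, (LinearMap.toContinuousLinearMap
    ((X.map (lieModel n G)).coord k)).smulRight (d k)

lemma norm_frameForm_le (X : Module.Basis (Fin n) ℝ (GroupLieAlgebra (𝓡 n) G)) :
    ∃ C : ℝ, 0 ≤ C ∧ ∀ d : Fin n → ℂ, ‖frameForm X d‖ ≤ C * ∑ k, ‖d k‖ := by
  refine ⟨∑ k, ‖LinearMap.toContinuousLinearMap ((X.map (lieModel n G)).coord k)‖,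
    Finset.sum_nonneg fun _ _ => norm_nonneg _, fun d => ?_⟩
  refine (norm_sum_le _ _).trans ?_
  rw [Finset.mul_sum]
  refine Finset.sum_le_sum fun k _ => ?_
  rw [ContinuousLinearMap.norm_smulRight_apply]
  gcongr
  exact Finset.single_le_sum (f := fun k => ‖LinearMap.toContinuousLinearMap
    ((X.map (lieModel n G)).coord k)‖) (fun _ _ => norm_nonneg _) (Finset.mem_univ k)

/-- A function that is continuously differentiable along a left-invariant frame is differentiable
in coordinates. The inverse function theorem turns coordinates into canonical coordinates of the
second kind, for which `hasFDerivAt_comp_expProd` applies. -/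
lemma hasFDerivAt_chart_of_frame [IsTopologicalGroup G]
    (X : Module.Basis (Fin n) ℝ (GroupLieAlgebra (𝓡 n) G)) {h : G → ℂ} {D : Fin n → G → ℂ} {g : G}
    (hd : ∀ᶠ g' in 𝓝 g, ∀ k, HasDerivAt (fun s : ℝ => h (g' * lieExp (s • X k))) (D k g') 0)
    (hD : ∀ k, ContinuousAt (D k) g) :
    HasFDerivAt (fun q => h (g * (extChartAt (𝓡 n) (1 : G)).symm q))
      (frameForm X fun k => D k g) (extChartAt (𝓡 n) (1 : G) 1) := by
  set κ := extChartAt (𝓡 n) (1 : G) with hκ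
  set b := X.map (lieModel n G) with hb
  set ks := List.finRange n
  have h1 := hasFDerivAt_comp_expProd X hd hD ks
  have h2 := hasStrictFDerivAt_chart_expProd (fun k => X k) ks
  set e : (Fin n → ℝ) ≃L[ℝ] EuclideanSpace ℝ (Fin n) :=
    b.equivFun.symm.toContinuousLinearEquiv with he
  have he' : ((ks.map fun k => (ContinuousLinearMap.proj (R := ℝ)
      (φ := fun _ : Fin n => ℝ) k).smulRight (lieModel n G (X k))).sum) =
      (e : (Fin n → ℝ) →L[ℝ] EuclideanSpace ℝ (Fin n)) := by
    ext1 t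
    rw [← Fin.sum_univ_def]
    simp [he, hb, Module.Basis.equivFun_symm_apply]
  rw [he'] at h2
  have h0 : κ (expProd (fun k => X k) ks 0) = κ 1 := by rw [expProd_zero]
  set loc := h2.localInverse (fun t => κ (expProd (fun k => X k) ks t)) e 0
  have h3 : HasStrictFDerivAt loc (e.symm : EuclideanSpace ℝ (Fin n) →L[ℝ] (Fin n → ℝ)) (κ 1) := by
    have := h2.to_localInverse
    rwa [h0] at this
  have h4 : loc (κ 1) = 0 := by
    have := h2.localInverse_apply_image
    rwa [h0] at this
  have h5 : ∀ᶠ q in 𝓝 (κ 1), κ (expProd (fun k => X k) ks (loc q)) = q := by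
    have := h2.eventually_right_inverse
    rwa [h0] at this
  have h6 : ∀ᶠ q in 𝓝 (κ 1), κ.symm (κ (expProd (fun k => X k) ks (loc q))) =
      expProd (fun k => X k) ks (loc q) := by
    have hT : Tendsto (fun q => (expProd (fun k => X k) ks (loc q) : G)) (𝓝 (κ 1)) (𝓝 1) := by
      have h7 := (continuous_expProd (G := G) (fun k => X k) ks).tendsto 0
      rw [expProd_zero] at h7
      have h8 := h3.continuousAt.tendsto
      rw [h4] at h8
      exact h7.comp h8
    exact hT.eventually eventually_chart_symm_chart
  have h7 : HasFDerivAt (fun t => h (g * expProd (fun k => X k) ks t))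
      (((ks.map fun k => (ContinuousLinearMap.proj (R := ℝ) (φ := fun _ : Fin n => ℝ) k).smulRight
        (D k g)).sum)) (loc (κ 1)) := by rw [h4]; exact h1
  have h8 := (h7.comp (κ 1) h3.hasFDerivAt).congr_of_eventuallyEq
    (f₁ := fun q => h (g * κ.symm q)) (by
      filter_upwards [h5, h6] with q hq hq'
      rw [Function.comp_apply, ← hq', hq])
  refine h8.congr_fderiv ?_
  ext1 v
  rw [← Fin.sum_univ_def]
  simp [frameForm, he, hb]

/-- Quantitative form of `hasFDerivAt_chart_of_frame` in the chart at the identity itself. -/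
lemma exists_hasFDerivAt_chart_symm_le [IsTopologicalGroup G]
    (X : Module.Basis (Fin n) ℝ (GroupLieAlgebra (𝓡 n) G)) :
    ∃ C : ℝ, 0 ≤ C ∧ ∀ᶠ p in 𝓝 (extChartAt (𝓡 n) (1 : G) 1), ∀ (h : G → ℂ) (D : Fin n → G → ℂ),
      (∀ᶠ g' in 𝓝 ((extChartAt (𝓡 n) (1 : G)).symm p), ∀ k,
        HasDerivAt (fun s : ℝ => h (g' * lieExp (s • X k))) (D k g') 0) →
      (∀ k, ContinuousAt (D k) ((extChartAt (𝓡 n) (1 : G)).symm p)) →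
      ∃ f' : EuclideanSpace ℝ (Fin n) →L[ℝ] ℂ,
        HasFDerivAt (fun p => h ((extChartAt (𝓡 n) (1 : G)).symm p)) f' p ∧
        ‖f'‖ ≤ C * ∑ k, ‖D k ((extChartAt (𝓡 n) (1 : G)).symm p)‖ := by
  set κ := extChartAt (𝓡 n) (1 : G) with hκ
  obtain ⟨C₁, hC₁, hframe⟩ := norm_frameForm_le X
  have hm := contDiffAt_chartDiv (n := n) (G := G)
  have hdiag : Tendsto (fun p : EuclideanSpace ℝ (Fin n) => (p, p)) (𝓝 (κ 1)) (𝓝 (κ 1, κ 1)) :=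
    tendsto_id.prodMk_nhds tendsto_id
  have hm1 : ∀ᶠ p in 𝓝 (κ 1, κ 1), DifferentiableAt ℝ (chartDiv G) p :=
    ((hm.of_le (m := 1) (by simp)).eventually (by simp)).mono fun p hp =>
      hp.differentiableAt (by simp)
  have hcont : ContinuousAt (fderiv ℝ (chartDiv (n := n) G)) (κ 1, κ 1) :=
    (hm.fderiv_right (m := 0) (by simp)).continuousAt
  set C₂ := ‖fderiv ℝ (chartDiv (n := n) G) (κ 1, κ 1)‖ + 1
  have hm2 : ∀ᶠ p in 𝓝 (κ 1, κ 1), ‖fderiv ℝ (chartDiv (n := n) G) p‖ ≤ C₂ :=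
    (hcont.norm.tendsto.eventually (ge_mem_nhds (lt_add_one _)))
  have hsymm : ∀ᶠ p in 𝓝 (κ 1), ContinuousAt κ.symm p := by
    filter_upwards [eventually_eventually_nhds.2 (extChartAt_target_mem_nhds_one (G := G) (n := n))]
      with p hp
    exact (continuousOn_extChartAt_symm (I := 𝓡 n) (1 : G)).continuousAt hp
  refine ⟨C₁ * C₂, by positivity, ?_⟩
  filter_upwards [hdiag.eventually hm1, hdiag.eventually hm2, hsymm] with p hp1 hp2 hp3 h D hd hD
  set g := κ.symm p
  have hpp : chartDiv G (p, p) = κ 1 := by simp [chartDiv, hκ]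
  -- near `p` the function `h ∘ κ⁻¹` is `h(g ·) ∘ κ⁻¹` in the coordinates `κ(g⁻¹ κ⁻¹(p'))`
  have h1 := hasFDerivAt_chart_of_frame X hd hD
  have h2 : HasFDerivAt (fun p' => chartDiv G (p, p'))
      ((fderiv ℝ (chartDiv (n := n) G) (p, p)).comp (ContinuousLinearMap.inr ℝ _ _)) p :=
    HasFDerivAt.comp p (f := fun p' => (p, p')) hp1.hasFDerivAt (hasFDerivAt_prodMk_right p p)
  rw [← hκ, ← hpp] at h1
  have h3 := HasFDerivAt.comp p (f := fun p' => chartDiv G (p, p')) h1 h2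
  have h4 := h3.congr_of_eventuallyEq (f₁ := fun p' => h (κ.symm p')) (by
    have hT : Tendsto (fun p' => g⁻¹ * κ.symm p') (𝓝 p) (𝓝 1) := by
      have := (tendsto_const_nhds (x := g⁻¹)).mul hp3.tendsto
      rwa [inv_mul_cancel] at this
    filter_upwards [hT.eventually (eventually_chart_symm_chart (n := n) (G := G))] with p' hp'
    simp only [Function.comp_apply, chartDiv]
    rw [hp', mul_inv_cancel_left])
  refine ⟨_, h4, (ContinuousLinearMap.opNorm_comp_le _ _).trans ?_⟩
  have h5 : ‖(fderiv ℝ (chartDiv (n := n) G) (p, p)).comp (ContinuousLinearMap.inr ℝ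
      (EuclideanSpace ℝ (Fin n)) (EuclideanSpace ℝ (Fin n)))‖ ≤ C₂ := by
    refine (ContinuousLinearMap.opNorm_comp_le _ _).trans ?_
    refine (mul_le_of_le_one_right (norm_nonneg _) (ContinuousLinearMap.norm_inr_le_one ℝ _ _)).trans
      hp2
  calc _ ≤ (C₁ * ∑ k, ‖D k g‖) * C₂ := mul_le_mul (hframe _) h5 (norm_nonneg _)
        (mul_nonneg hC₁ (Finset.sum_nonneg fun _ _ => norm_nonneg _))
    _ = _ := by ring
end Coordinates

/-! ### Local estimates for coefficient functions -/

section Coeff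

variable {n : ℕ} {G : Type*} [TopologicalSpace G]
  [ChartedSpace (EuclideanSpace ℝ (Fin n)) G] [Group G] [MeasurableSpace G]

variable (n G) in
/-- The features shared by the coefficient functions of a projective representation and of its
dual: `H ℓ v g` stands for `⟨ℓ, π(g) v⟩`, `act ℓ g` for the functional `⟨ℓ, π(g) ·⟩`, and `c` for
the multiplier. No linear structure is needed on functionals and vectors. -/
structure CoeffFamily (Λ V : Type*) where
  H : Λ → V → G → ℂ
  act : Λ → G → Λ
  c : G → G → ℂ
  norm_c : ∀ g h, ‖c g h‖ = 1
  c_one : ∀ g, c g 1 = 1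
  H_mul : ∀ ℓ v g h, H ℓ v (g * h) = c g h * H (act ℓ g) v h
  measurable_H : ∀ ℓ v, Measurable (H ℓ v)
  continuousAt_one : ∀ ℓ v, ContinuousAt (H ℓ v) 1
  smooth : ContMDiffAt ((𝓡 n).prod (𝓡 n)) 𝓘(ℝ, ℂ) ∞ (fun p : G × G => c p.1 p.2) (1, 1)

variable {Λ V : Type*} (𝓗 : CoeffFamily n G Λ V)

namespace CoeffFamily

/-- `w = π(Y)v`, the weak derivative along the one-parameter subgroup of `Y`. -/
def HasDir (Y : GroupLieAlgebra (𝓡 n) G) (v w : V) : Prop :=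
  ∀ ℓ, HasDerivAt (fun t : ℝ => 𝓗.H ℓ v (lieExp (t • Y))) (𝓗.H ℓ w 1) 0

/-- `v` is `k` times weakly differentiable, with derivative in the direction `Xᵢ` given by
`der i`. -/
def Dif (X : Fin n → GroupLieAlgebra (𝓡 n) G) (der : Fin n → V → V) : ℕ → V → Prop
  | 0, _ => True
  | k + 1, v => (∀ i, 𝓗.HasDir (X i) v (der i v)) ∧ Dif X der k v ∧ ∀ i, Dif X der k (der i v)

/-- The sum (with multiplicities) of the absolute values of the coefficients of all derivatives of
order at most `k`. -/
noncomputable def maj (der : Fin n → V → V) : ℕ → V → Λ → G → ℝ≥0∞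
  | 0, v, ℓ, g => ‖𝓗.H ℓ v g‖ₑ
  | k + 1, v, ℓ, g => maj der k v ℓ g + ∑ i, maj der k (der i v) ℓ g

lemma H_act_one (ℓ : Λ) (v : V) (g : G) : 𝓗.H (𝓗.act ℓ g) v 1 = 𝓗.H ℓ v g := by
  have := 𝓗.H_mul ℓ v g 1
  rw [mul_one, 𝓗.c_one, one_mul] at this
  exact this.symm

lemma norm_H_act (ℓ : Λ) (v : V) (g h : G) : ‖𝓗.H (𝓗.act ℓ g) v h‖ = ‖𝓗.H ℓ v (g * h)‖ := by
  rw [𝓗.H_mul, norm_mul, 𝓗.norm_c, one_mul]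

lemma maj_act (der : Fin n → V → V) (k : ℕ) (v : V) (ℓ : Λ) (g h : G) :
    𝓗.maj der k v (𝓗.act ℓ g) h = 𝓗.maj der k v ℓ (g * h) := by
  induction k generalizing v with
  | zero => simp only [maj, ← ofReal_norm, norm_H_act]
  | succ k ih => simp only [maj, ih]

lemma measurable_maj (der : Fin n → V → V) (k : ℕ) (v : V) (ℓ : Λ) :
    Measurable (𝓗.maj der k v ℓ) := by
  induction k generalizing v with
  | zero => exact (𝓗.measurable_H ℓ v).enorm
  | succ k ih => exact (ih v).add (Finset.measurable_fun_sum _ fun i _ => ih (der i v))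

lemma maj_mono (der : Fin n → V → V) {k m : ℕ} (h : k ≤ m) (v : V) (ℓ : Λ) (g : G) :
    𝓗.maj der k v ℓ g ≤ 𝓗.maj der m v ℓ g := by
  induction h with
  | refl => exact le_rfl
  | step _ ih => exact ih.trans le_self_add

variable [LieGroup (𝓡 n) ∞ G] [T2Space G]

/-- The multiplier in the coordinates of the chart at the identity. -/
noncomputable def chartC (p : EuclideanSpace ℝ (Fin n) × EuclideanSpace ℝ (Fin n)) : ℂ :=
  𝓗.c ((extChartAt (𝓡 n) (1 : G)).symm p.1) ((extChartAt (𝓡 n) (1 : G)).symm p.2)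

lemma contDiffAt_chartC : ContDiffAt ℝ ∞ 𝓗.chartC
    (extChartAt (𝓡 n) (1 : G) 1, extChartAt (𝓡 n) (1 : G) 1) :=
  contDiffAt_chart_of_contMDiffAt 𝓗.smooth

lemma tendsto_chart_pair : Tendsto (fun g => (extChartAt (𝓡 n) (1 : G) g,
    extChartAt (𝓡 n) (1 : G) 1)) (𝓝 (1 : G))
    (𝓝 (extChartAt (𝓡 n) (1 : G) 1, extChartAt (𝓡 n) (1 : G) 1)) :=
  (continuousAt_extChartAt (I := 𝓡 n) (1 : G)).tendsto.prodMk_nhds tendsto_const_nhds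

lemma eventually_differentiableAt_chartC : ∀ᶠ g in 𝓝 (1 : G), DifferentiableAt ℝ 𝓗.chartC
    (extChartAt (𝓡 n) (1 : G) g, extChartAt (𝓡 n) (1 : G) 1) :=
  tendsto_chart_pair.eventually
    (((𝓗.contDiffAt_chartC.of_le (m := 1) (by simp)).eventually (by simp)).mono fun p hp =>
      hp.differentiableAt (by simp))

/-- The coefficient functions are all continuous on one neighbourhood of the identity. -/
lemma eventually_continuousAt [IsTopologicalGroup G] :
    ∀ᶠ g in 𝓝 (1 : G), ∀ ℓ v, ContinuousAt (𝓗.H ℓ v) g := by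
  set κ := extChartAt (𝓡 n) (1 : G) with hκ
  filter_upwards [𝓗.eventually_differentiableAt_chartC,
    eventually_chart_symm_chart (n := n) (G := G)] with g hg hg' ℓ v
  have hT : Tendsto (fun g' => g⁻¹ * g') (𝓝 g) (𝓝 1) := by
    have := (tendsto_const_nhds (x := g⁻¹)).mul (tendsto_id (x := 𝓝 g))
    simpa using this
  have hc : ContinuousAt (𝓗.c g) 1 := by
    have h1 : ContinuousAt (fun h => 𝓗.chartC (κ g, κ h)) 1 :=
      ContinuousAt.comp (f := fun h => (κ g, κ h)) hg.continuousAt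
        (continuousAt_const.prodMk (continuousAt_extChartAt (I := 𝓡 n) (1 : G)))
    refine h1.congr ?_
    filter_upwards [eventually_chart_symm_chart (n := n) (G := G)] with h hh
    rw [chartC, hg', hh]
  -- by the cocycle identity only continuity at the identity is needed
  have h2 : Tendsto (fun g' => 𝓗.c g (g⁻¹ * g') * 𝓗.H (𝓗.act ℓ g) v (g⁻¹ * g')) (𝓝 g)
      (𝓝 (𝓗.c g 1 * 𝓗.H (𝓗.act ℓ g) v 1)) :=
    (hc.tendsto.comp hT).mul ((𝓗.continuousAt_one _ v).tendsto.comp hT)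
  rw [𝓗.c_one, one_mul, H_act_one] at h2
  refine h2.congr fun g' => ?_
  rw [← 𝓗.H_mul, mul_inv_cancel_left]

/-- The logarithmic derivative of the multiplier `c(g, ·)` at the identity. -/
noncomputable def dc (Y : GroupLieAlgebra (𝓡 n) G) (g : G) : ℂ :=
  fderiv ℝ 𝓗.chartC (extChartAt (𝓡 n) (1 : G) g, extChartAt (𝓡 n) (1 : G) 1) (0, lieModel n G Y)

/-- The Leibniz rule along one-parameter subgroups at points near the identity: the multiplier
contributes a term of order zero. -/
lemma eventually_hasDerivAt_mul_lieExp :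
    ∀ᶠ g in 𝓝 (1 : G), ∀ ℓ v w Y, 𝓗.HasDir Y v w →
      HasDerivAt (fun s : ℝ => 𝓗.H ℓ v (g * lieExp (s • Y)))
        (𝓗.dc Y g * 𝓗.H ℓ v g + 𝓗.H ℓ w g) 0 := by
  set κ := extChartAt (𝓡 n) (1 : G) with hκ
  filter_upwards [𝓗.eventually_differentiableAt_chartC,
    eventually_chart_symm_chart (n := n) (G := G)] with g hg hg' ℓ v w Y hY
  have hexp : Tendsto (fun t : ℝ => (lieExp (t • Y) : G)) (𝓝 0) (𝓝 1) := by
    have := (continuous_lieExp_smul (G := G) Y).tendsto 0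
    rwa [zero_smul, lieExp_zero] at this
  have h1 : HasDerivAt (fun s : ℝ => 𝓗.chartC (κ g, κ (lieExp (s • Y)))) (𝓗.dc Y g) 0 := by
    refine HasFDerivAt.comp_hasDerivAt_of_eq (0 : ℝ) hg.hasFDerivAt
      ((hasDerivAt_const _ _).prodMk (hasDerivAt_extChartAt_lieExp Y)) ?_
    simp [lieExp_zero, hκ]
  have h2 : HasDerivAt (fun s : ℝ => 𝓗.c g (lieExp (s • Y))) (𝓗.dc Y g) 0 := by
    refine h1.congr_of_eventuallyEq ?_
    filter_upwards [hexp.eventually (eventually_chart_symm_chart (n := n) (G := G))] with s hs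
    rw [chartC, hg', hs]
  have h3 := h2.mul (hY (𝓗.act ℓ g))
  simp only [zero_smul, lieExp_zero, 𝓗.c_one, H_act_one, one_mul] at h3
  exact h3.congr_of_eventuallyEq (Eventually.of_forall fun s => 𝓗.H_mul _ _ _ _)

lemma eventually_continuousAt_dc (Y : GroupLieAlgebra (𝓡 n) G) :
    ∀ᶠ g in 𝓝 (1 : G), ContinuousAt (𝓗.dc Y) g := by
  have h1 : ∀ᶠ p in 𝓝 (extChartAt (𝓡 n) (1 : G) 1, extChartAt (𝓡 n) (1 : G) 1),
      ContinuousAt (fderiv ℝ 𝓗.chartC) p :=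
    ((𝓗.contDiffAt_chartC.of_le (m := 1) (by simp)).eventually (by simp)).mono fun p hp =>
      (hp.fderiv_right (m := 0) (by simp)).continuousAt
  filter_upwards [tendsto_chart_pair.eventually h1, extChartAt_source_mem_nhds (I := 𝓡 n) (1 : G)]
    with g hg hg'
  have h2 : ContinuousAt (fun g => fderiv ℝ 𝓗.chartC (extChartAt (𝓡 n) (1 : G) g,
      extChartAt (𝓡 n) (1 : G) 1)) g :=
    ContinuousAt.comp (f := fun g => (extChartAt (𝓡 n) (1 : G) g, extChartAt (𝓡 n) (1 : G) 1)) hg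
      ((continuousAt_extChartAt' hg').prodMk continuousAt_const)
  exact ((ContinuousLinearMap.apply ℝ ℂ ((0 : EuclideanSpace ℝ (Fin n)),
    lieModel n G Y)).continuous.continuousAt).comp h2

/-- In a ball around the identity in coordinates all coefficient functions of weakly differentiable
vectors are differentiable, with derivatives controlled by the coefficients of weak derivatives,
uniformly in the functional and the vector. -/
lemma exists_chart_ball [IsTopologicalGroup G]
    (X : Module.Basis (Fin n) ℝ (GroupLieAlgebra (𝓡 n) G)) :
    ∃ R : ℝ, 0 < R ∧ ∃ C : ℝ, 0 ≤ C ∧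
      Metric.closedBall (extChartAt (𝓡 n) (1 : G) 1) R ⊆ (extChartAt (𝓡 n) (1 : G)).target ∧
      ∀ p ∈ Metric.closedBall (extChartAt (𝓡 n) (1 : G) 1) R, ∀ ℓ v,
        ContinuousAt (fun p => 𝓗.H ℓ v ((extChartAt (𝓡 n) (1 : G)).symm p)) p ∧
        ∀ v' : Fin n → V, (∀ k, 𝓗.HasDir (X k) v (v' k)) →
        ∃ f' : EuclideanSpace ℝ (Fin n) →L[ℝ] ℂ,
          HasFDerivAt (fun p => 𝓗.H ℓ v ((extChartAt (𝓡 n) (1 : G)).symm p)) f' p ∧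
          ‖f'‖ ≤ C * (‖𝓗.H ℓ v ((extChartAt (𝓡 n) (1 : G)).symm p)‖ +
            ∑ k, ‖𝓗.H ℓ (v' k) ((extChartAt (𝓡 n) (1 : G)).symm p)‖) := by
  set κ := extChartAt (𝓡 n) (1 : G) with hκ
  obtain ⟨C₁, hC₁, hfd⟩ := exists_hasFDerivAt_chart_symm_le X
  set C₂ : ℝ := ∑ k, (‖𝓗.dc (X k) 1‖ + 1)
  have hdcle : ∀ᶠ g in 𝓝 (1 : G), ∀ k, ‖𝓗.dc (X k) g‖ ≤ ‖𝓗.dc (X k) 1‖ + 1 :=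
    eventually_all.2 fun k => ((𝓗.eventually_continuousAt_dc (X k)).self_of_nhds.norm).tendsto
      (ge_mem_nhds (lt_add_one _))
  have hgood := (𝓗.eventually_continuousAt.and (𝓗.eventually_hasDerivAt_mul_lieExp.and
    ((eventually_all.2 fun k => 𝓗.eventually_continuousAt_dc (X k)).and hdcle))).eventually_nhds
  have hsymm0 : Tendsto κ.symm (𝓝 (κ 1)) (𝓝 1) := by
    have := (continuousAt_extChartAt_symm (I := 𝓡 n) (1 : G)).tendsto
    rwa [chart_symm_apply_one] at this
  have hsymm : ∀ᶠ p in 𝓝 (κ 1), ContinuousAt κ.symm p := by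
    filter_upwards [eventually_eventually_nhds.2 (extChartAt_target_mem_nhds_one (G := G) (n := n))]
      with p hp
    exact (continuousOn_extChartAt_symm (I := 𝓡 n) (1 : G)).continuousAt hp
  have hall := hfd.and ((hsymm0.eventually hgood).and (hsymm.and
    (extChartAt_target_mem_nhds_one (G := G) (n := n))))
  obtain ⟨R, hR, hball⟩ := Metric.nhds_basis_closedBall.eventually_iff.1 hall
  refine ⟨R, hR, C₁ * (C₂ + n + 1), by positivity, fun p hp => (hball hp).2.2.2, ?_⟩
  intro p hp ℓ v
  obtain ⟨h1, h2, h3, -⟩ := hball hp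
  refine ⟨ContinuousAt.comp (f := κ.symm) (h2.self_of_nhds.1 ℓ v) h3, fun v' hv' => ?_⟩
  obtain ⟨f', hf', hle⟩ := h1 (𝓗.H ℓ v) (fun k g => 𝓗.dc (X k) g * 𝓗.H ℓ v g + 𝓗.H ℓ (v' k) g)
    (h2.mono fun g hg k => hg.2.1 ℓ v (v' k) (X k) (hv' k))
    (fun k => ((h2.self_of_nhds.2.2.1 k).mul (h2.self_of_nhds.1 ℓ v)).add
      (h2.self_of_nhds.1 ℓ (v' k)))
  refine ⟨f', hf', hle.trans ?_⟩
  rw [mul_assoc]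
  gcongr
  set g := κ.symm p
  calc ∑ k, ‖𝓗.dc (X k) g * 𝓗.H ℓ v g + 𝓗.H ℓ (v' k) g‖
      ≤ ∑ k, ((‖𝓗.dc (X k) 1‖ + 1) * ‖𝓗.H ℓ v g‖ + ‖𝓗.H ℓ (v' k) g‖) := by
        refine Finset.sum_le_sum fun k _ => (norm_add_le _ _).trans ?_
        rw [norm_mul]
        gcongr
        exact h2.self_of_nhds.2.2.2 k
    _ = C₂ * ‖𝓗.H ℓ v g‖ + ∑ k, ‖𝓗.H ℓ (v' k) g‖ := by
        rw [Finset.sum_add_distrib, Finset.sum_mul]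
    _ ≤ _ := by
        have hs : 0 ≤ ∑ k, ‖𝓗.H ℓ (v' k) g‖ := Finset.sum_nonneg fun _ _ => norm_nonneg _
        have hC₂ : 0 ≤ C₂ := Finset.sum_nonneg fun _ _ => by positivity
        have := norm_nonneg (𝓗.H ℓ v g)
        have hn : (0 : ℝ) ≤ n := Nat.cast_nonneg n
        nlinarith [mul_nonneg hC₂ hs, mul_nonneg hn hs, mul_nonneg hn this]

end CoeffFamily

end Coeff

/-! ### Sobolev-type estimates -/

/-- The fundamental theorem of calculus as an inequality for extended norms. -/
lemma enorm_sub_le_lintegral_of_hasDerivAt {f : ℝ → ℂ} {b : ℝ → ℝ} {r t : ℝ} (ht : |t| ≤ r)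
    (hb : ContinuousOn b (Icc (-r) r))
    (hf : ∀ s ∈ Icc (-r) r, ∃ f', HasDerivAt f f' s ∧ ‖f'‖ ≤ b s) :
    ‖f t - f 0‖ₑ ≤ ∫⁻ s in Icc (-r) r, ENNReal.ofReal (b s) := by
  have hr : 0 ≤ r := (abs_nonneg t).trans ht
  have hsub : uIcc 0 t ⊆ Icc (-r) r := by
    exact uIcc_subset_Icc ⟨by linarith, hr⟩ (abs_le.1 ht)
  have hd : ∀ s ∈ Icc (-r) r, HasDerivAt f (deriv f s) s ∧ ‖deriv f s‖ ≤ b s := by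
    intro s hs
    obtain ⟨f', h1, h2⟩ := hf s hs
    rw [h1.deriv]; exact ⟨h1, h2⟩
  have hint : IntegrableOn (deriv f) (uIcc 0 t) := by
    have h1 : IntegrableOn b (uIcc 0 t) := (hb.mono hsub).integrableOn_compact isCompact_uIcc
    refine Integrable.mono' h1 (measurable_deriv f).aestronglyMeasurable ?_
    refine (ae_restrict_iff' measurableSet_uIcc).2 (Eventually.of_forall fun s hs => ?_)
    exact (hd s (hsub hs)).2
  have hint' : IntervalIntegrable (deriv f) volume 0 t :=
    (intervalIntegrable_iff').2 hint
  rw [← intervalIntegral.integral_eq_sub_of_hasDerivAt (fun s hs => (hd s (hsub hs)).1) hint',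
    ← ofReal_norm, intervalIntegral.norm_intervalIntegral_eq, ofReal_norm]
  refine (enorm_integral_le_lintegral_enorm _).trans ?_
  refine (lintegral_mono_set (uIoc_subset_uIcc.trans hsub)).trans ?_
  refine setLIntegral_mono' measurableSet_Icc fun s hs => ?_
  rw [← ofReal_norm]
  exact ENNReal.ofReal_le_ofReal (hd s hs).2

section Coeff

variable {n : ℕ} {G : Type*} [TopologicalSpace G]
  [ChartedSpace (EuclideanSpace ℝ (Fin n)) G] [Group G] [MeasurableSpace G]

variable (n G) in
open Classical in
/-- The inverse of the chart at the identity on a ball, extended by a constant. -/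
noncomputable def chartPt (R : ℝ) : EuclideanSpace ℝ (Fin n) → G :=
  (Metric.closedBall (extChartAt (𝓡 n) (1 : G) 1) R).piecewise (extChartAt (𝓡 n) (1 : G)).symm
    fun _ => 1

lemma chartPt_of_mem {R : ℝ} {p : EuclideanSpace ℝ (Fin n)}
    (hp : p ∈ Metric.closedBall (extChartAt (𝓡 n) (1 : G) 1) R) :
    chartPt n G R p = (extChartAt (𝓡 n) (1 : G)).symm p := by
  simp only [chartPt, hp, piecewise_eq_of_mem]

lemma measurable_chartPt [BorelSpace G] {R : ℝ}
    (hR : Metric.closedBall (extChartAt (𝓡 n) (1 : G) 1) R ⊆ (extChartAt (𝓡 n) (1 : G)).target) :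
    Measurable (chartPt n G R) := by
  classical
  exact ContinuousOn.measurable_piecewise ((continuousOn_extChartAt_symm (I := 𝓡 n) (1 : G)).mono hR)
    continuousOn_const Metric.isClosed_closedBall.measurableSet

variable (n) in
/-- The measure dominating oscillations along the coordinate directions in a list: each step adds
the fundamental theorem of calculus in one more coordinate. -/
noncomputable def oscMeasure (C r : ℝ) : List (Fin n) → Measure (EuclideanSpace ℝ (Fin n))
  | [] => 0
  | i :: is => oscMeasure C r is +
      ENNReal.ofReal C • (((volume.restrict (Icc (-r) r)).prod (oscMeasure C r is)).map
        fun x => x.1 • EuclideanSpace.single i (1 : ℝ) + x.2) +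
      ENNReal.ofReal C • ((volume.restrict (Icc (-r) r)).map
        fun s => s • EuclideanSpace.single i (1 : ℝ))

lemma measurable_smul_single_add (i : Fin n) : Measurable
    (fun x : ℝ × EuclideanSpace ℝ (Fin n) => x.1 • EuclideanSpace.single i (1 : ℝ) + x.2) := by
  fun_prop

instance isFiniteMeasure_oscMeasure (C r : ℝ) (is : List (Fin n)) :
    IsFiniteMeasure (oscMeasure n C r is) := by
  induction is with
  | nil => exact inferInstanceAs (IsFiniteMeasure (0 : Measure _))
  | cons i is ih =>
    have : ∀ (c : ℝ) (ν : Measure (EuclideanSpace ℝ (Fin n))) [IsFiniteMeasure ν],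
        IsFiniteMeasure (ENNReal.ofReal c • ν) := fun c ν _ =>
      ν.smul_finite ENNReal.ofReal_ne_top
    unfold oscMeasure
    infer_instance

lemma oscMeasure_univ {C r : ℝ} (hC : 0 ≤ C) (hr : 0 ≤ r) (is : List (Fin n)) :
    oscMeasure n C r is univ ≤ ENNReal.ofReal ((1 + 2 * r * C) ^ is.length - 1) := by
  induction is with
  | nil => simp [oscMeasure]
  | cons i is ih =>
    have h1 : (1 : ℝ) ≤ (1 + 2 * r * C) ^ is.length := one_le_pow₀ (by nlinarith)
    simp only [oscMeasure, Measure.add_apply, Measure.smul_apply, smul_eq_mul]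
    rw [Measure.map_apply (measurable_smul_single_add i) MeasurableSet.univ,
      Measure.map_apply (by fun_prop) MeasurableSet.univ, preimage_univ, preimage_univ,
      Measure.restrict_apply_univ, Real.volume_Icc, ← univ_prod_univ, Measure.prod_prod,
      Measure.restrict_apply_univ, Real.volume_Icc]
    calc _ ≤ ENNReal.ofReal ((1 + 2 * r * C) ^ is.length - 1) + ENNReal.ofReal C *
          (ENNReal.ofReal (r - -r) * ENNReal.ofReal ((1 + 2 * r * C) ^ is.length - 1)) +
          ENNReal.ofReal C * ENNReal.ofReal (r - -r) := by gcongr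
      _ = _ := by
        have h2 : 0 ≤ (1 + 2 * r * C) ^ is.length - 1 := by linarith
        have h3 : 0 ≤ r - -r := by linarith
        rw [← ENNReal.ofReal_mul h3, ← ENNReal.ofReal_mul hC, ← ENNReal.ofReal_mul hC,
          ← ENNReal.ofReal_add h2 (by positivity), ← ENNReal.ofReal_add (by positivity)
          (by positivity)]
        congr 1
        rw [List.length_cons, pow_succ]
        ring

lemma norm_smul_single_le (i : Fin n) {s r : ℝ} (hs : s ∈ Icc (-r) r) :
    ‖s • EuclideanSpace.single i (1 : ℝ)‖ ≤ r := by
  rw [norm_smul, PiLp.norm_single, norm_one, mul_one]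
  exact abs_le.2 hs

lemma oscMeasure_ae_norm_le {C r : ℝ} (hr : 0 ≤ r) (is : List (Fin n)) :
    ∀ᵐ q ∂(oscMeasure n C r is), ‖q‖ ≤ is.length * r := by
  induction is with
  | nil => simp [oscMeasure]
  | cons i is ih =>
    have hm : MeasurableSet {q : EuclideanSpace ℝ (Fin n) | ‖q‖ ≤ ((i :: is).length : ℕ) * r} :=
      measurableSet_le measurable_norm measurable_const
    have hI : ∀ᵐ s ∂(volume.restrict (Icc (-r) r)), s ∈ Icc (-r) r :=
      ae_restrict_mem measurableSet_Icc
    have hlen : (((i :: is).length : ℕ) : ℝ) * r = is.length * r + r := by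
      push_cast [List.length_cons]; ring
    have hnn : 0 ≤ (is.length : ℝ) * r := by positivity
    simp only [oscMeasure]
    rw [ae_add_measure_iff, ae_add_measure_iff]
    refine ⟨⟨?_, ?_⟩, ?_⟩
    · filter_upwards [ih] with q hq
      rw [hlen]; linarith
    · refine Measure.ae_smul_measure ?_ _
      rw [ae_map_iff (measurable_smul_single_add i).aemeasurable hm]
      have h1 := (Measure.quasiMeasurePreserving_fst (ν := oscMeasure n C r is)).ae hI
      have h2 := (Measure.quasiMeasurePreserving_snd (μ := volume.restrict (Icc (-r) r))).ae ih
      filter_upwards [h1, h2] with x hx1 hx2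
      refine (norm_add_le _ _).trans ?_
      rw [hlen]
      linarith [norm_smul_single_le i hx1]
    · refine Measure.ae_smul_measure ?_ _
      rw [ae_map_iff (by fun_prop) hm]
      filter_upwards [hI] with s hs
      rw [hlen]
      linarith [norm_smul_single_le i hs]

lemma lintegral_oscMeasure_cons {C r : ℝ} (i : Fin n) (is : List (Fin n))
    {F : EuclideanSpace ℝ (Fin n) → ℝ≥0∞} (hF : Measurable F) :
    ∫⁻ q, F q ∂(oscMeasure n C r (i :: is)) = ∫⁻ q, F q ∂(oscMeasure n C r is) +
      ENNReal.ofReal C * (∫⁻ q, (∫⁻ s : ℝ in Icc (-r) r,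
        F (s • EuclideanSpace.single i (1 : ℝ) + q)) ∂(oscMeasure n C r is)) +
      ENNReal.ofReal C * ∫⁻ s in Icc (-r) r, F (s • EuclideanSpace.single i (1 : ℝ)) := by
  have h1 : Measurable fun x : ℝ × EuclideanSpace ℝ (Fin n) =>
      F (x.1 • EuclideanSpace.single i (1 : ℝ) + x.2) := hF.comp (measurable_smul_single_add i)
  simp only [oscMeasure]
  rw [lintegral_add_measure, lintegral_add_measure, lintegral_smul_measure, lintegral_smul_measure,
    lintegral_map hF (measurable_smul_single_add i), lintegral_map hF (by fun_prop),
    lintegral_prod_symm' _ h1]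
  simp only [smul_eq_mul]

namespace CoeffFamily

variable {Λ V : Type*} (𝓗 : CoeffFamily n G Λ V) [LieGroup (𝓡 n) ∞ G] [T2Space G]
  [IsTopologicalGroup G]

/-- A point of the model space displaced from `b` along coordinate directions. -/
noncomputable def displ (t : Fin n → ℝ) (is : List (Fin n)) : EuclideanSpace ℝ (Fin n) :=
  (is.map fun i => t i • EuclideanSpace.single i (1 : ℝ)).sum

/-- The oscillation of a coefficient over a coordinate box is dominated by the integral of all
coefficients of derivatives against a measure whose mass is small with the box. -/
lemma exists_oscMeasure_bound [BorelSpace G]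
    (X : Module.Basis (Fin n) ℝ (GroupLieAlgebra (𝓡 n) G)) (der : Fin n → V → V) :
    ∃ R : ℝ, 0 < R ∧ ∃ C : ℝ, 0 ≤ C ∧
      Metric.closedBall (extChartAt (𝓡 n) (1 : G) 1) R ⊆ (extChartAt (𝓡 n) (1 : G)).target ∧
      ∀ (is : List (Fin n)) (r : ℝ), 0 ≤ r → ∀ b : EuclideanSpace ℝ (Fin n),
        dist b (extChartAt (𝓡 n) (1 : G) 1) + is.length * r ≤ R →
        ∀ (t : Fin n → ℝ), (∀ i, |t i| ≤ r) → ∀ v ℓ, 𝓗.Dif X der is.length v →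
        ‖𝓗.H ℓ v (chartPt n G R (b + displ t is)) - 𝓗.H ℓ v (chartPt n G R b)‖ₑ ≤
          ∫⁻ q, 𝓗.maj der is.length v ℓ (chartPt n G R (b + q)) ∂(oscMeasure n C r is) := by
  obtain ⟨R, hR, C, hC, htarget, hdiff⟩ := 𝓗.exists_chart_ball X
  refine ⟨R, hR, C, hC, htarget, fun is => ?_⟩
  have hmeas := measurable_chartPt (n := n) (G := G) htarget
  set κ := extChartAt (𝓡 n) (1 : G) with hκ
  -- one coordinate direction
  have one : ∀ (r : ℝ) (b : EuclideanSpace ℝ (Fin n)) (i : Fin n), dist b (κ 1) + r ≤ R →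
      ∀ t : ℝ, |t| ≤ r → ∀ v ℓ, (∀ i, 𝓗.HasDir (X i) v (der i v)) →
      ‖𝓗.H ℓ v (chartPt n G R (b + t • EuclideanSpace.single i (1 : ℝ))) -
        𝓗.H ℓ v (chartPt n G R b)‖ₑ ≤ ENNReal.ofReal C *
        ∫⁻ s in Icc (-r) r, 𝓗.maj der 1 v ℓ
          (chartPt n G R (b + s • EuclideanSpace.single i (1 : ℝ))) := by
    intro r b i hb t ht v ℓ hv
    have hmem : ∀ s ∈ Icc (-r) r, b + s • EuclideanSpace.single i (1 : ℝ) ∈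
        Metric.closedBall (κ 1) R := by
      intro s hs
      rw [Metric.mem_closedBall]
      refine le_trans ?_ hb
      refine (dist_triangle _ b _).trans ?_
      have := norm_smul_single_le i hs
      rw [dist_eq_norm (b + _) b, add_sub_cancel_left]
      linarith
    have hline : ∀ s, HasDerivAt (fun s : ℝ => b + s • EuclideanSpace.single i (1 : ℝ))
        (EuclideanSpace.single i (1 : ℝ)) s := fun s => by
      simpa using ((hasDerivAt_id s).smul_const (EuclideanSpace.single i (1 : ℝ))).const_add b
    have hc : ∀ w, ContinuousOn (fun s : ℝ => 𝓗.H ℓ w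
        (κ.symm (b + s • EuclideanSpace.single i (1 : ℝ)))) (Icc (-r) r) := fun w s hs =>
      (ContinuousAt.comp (f := fun s : ℝ => b + s • EuclideanSpace.single i (1 : ℝ))
        (hdiff _ (hmem s hs) ℓ w).1 (hline s).continuousAt).continuousWithinAt
    have h0mem : (0 : ℝ) ∈ Icc (-r) r := by
      have := (abs_nonneg t).trans ht
      exact ⟨by linarith, this⟩
    have key := enorm_sub_le_lintegral_of_hasDerivAt
      (f := fun s => 𝓗.H ℓ v (κ.symm (b + s • EuclideanSpace.single i (1 : ℝ))))
      (b := fun s => C * (‖𝓗.H ℓ v (κ.symm (b + s • EuclideanSpace.single i (1 : ℝ)))‖ +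
        ∑ k, ‖𝓗.H ℓ (der k v) (κ.symm (b + s • EuclideanSpace.single i (1 : ℝ)))‖)) ht
      (continuousOn_const.mul ((hc v).norm.add
        (continuousOn_finsetSum _ fun k _ => (hc (der k v)).norm)))
      (fun s hs => by
        obtain ⟨f', hf', hle⟩ := (hdiff _ (hmem s hs) ℓ v).2 (fun k => der k v) hv
        refine ⟨_, HasFDerivAt.comp_hasDerivAt (l := fun p => 𝓗.H ℓ v (κ.symm p)) s hf'
          (hline s), ?_⟩
        refine (f'.le_opNorm _).trans ?_
        rw [PiLp.norm_single, norm_one, mul_one]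
        exact hle)
    have h0 := hmem 0 h0mem
    simp only [zero_smul, add_zero] at key h0
    rw [chartPt_of_mem (hmem t (abs_le.1 ht)), chartPt_of_mem h0]
    refine key.trans ?_
    rw [← lintegral_const_mul' _ _ ENNReal.ofReal_ne_top]
    refine setLIntegral_mono' measurableSet_Icc fun s hs => ?_
    rw [chartPt_of_mem (hmem s hs), ENNReal.ofReal_mul hC, ENNReal.ofReal_add (norm_nonneg _)
      (Finset.sum_nonneg fun _ _ => norm_nonneg _),
      ENNReal.ofReal_sum_of_nonneg fun _ _ => norm_nonneg _]
    simp only [maj, ofReal_norm]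
    exact le_rfl
  -- the majorants inherit the estimate
  have step : ∀ k v, 𝓗.Dif X der (k + 1) v → ∀ (r : ℝ) (b : EuclideanSpace ℝ (Fin n)) (i : Fin n),
      dist b (κ 1) + r ≤ R → ∀ t : ℝ, |t| ≤ r → ∀ ℓ,
      𝓗.maj der k v ℓ (chartPt n G R (b + t • EuclideanSpace.single i (1 : ℝ))) ≤
        𝓗.maj der k v ℓ (chartPt n G R b) + ENNReal.ofReal C *
        ∫⁻ s in Icc (-r) r, 𝓗.maj der (k + 1) v ℓ
          (chartPt n G R (b + s • EuclideanSpace.single i (1 : ℝ))) := by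
    intro k
    induction k with
    | zero =>
      intro v hv r b i hb t ht ℓ
      refine le_trans ?_ (add_le_add_right (one r b i hb t ht v ℓ hv.1) _)
      simp only [maj]
      refine le_trans ?_ (enorm_add_le _ _)
      simp
    | succ k ih =>
      intro v hv r b i hb t ht ℓ
      have hme : ∀ m w, Measurable fun s : ℝ => 𝓗.maj der m w ℓ
          (chartPt n G R (b + s • EuclideanSpace.single i (1 : ℝ))) := fun m w =>
        (𝓗.measurable_maj der m w ℓ).comp (hmeas.comp (by fun_prop))
      simp only [maj.eq_2 (n := n) (k := k)]
      refine (add_le_add (ih v hv.2.1 r b i hb t ht ℓ) (Finset.sum_le_sum fun j _ =>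
        ih (der j v) (hv.2.2 j) r b i hb t ht ℓ)).trans (le_of_eq ?_)
      simp only [maj.eq_2 (n := n) (k := k + 1)]
      rw [lintegral_add_left (hme _ _), lintegral_finsetSum _ fun j _ => hme _ _,
        Finset.sum_add_distrib, mul_add, Finset.mul_sum]
      ring
  induction is with
  | nil => intro r hr b hb t ht v ℓ hv; simp [displ]
  | cons i is ih =>
    intro r hr b hb t ht v ℓ hv
    set e : EuclideanSpace ℝ (Fin n) := EuclideanSpace.single i (1 : ℝ) with he
    have hlen : (((i :: is).length : ℕ) : ℝ) * r = is.length * r + r := by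
      push_cast [List.length_cons]; ring
    rw [hlen] at hb
    have hnn : 0 ≤ (is.length : ℝ) * r := by positivity
    have hdisp : b + displ t (i :: is) = (b + t i • e) + displ t is := by
      simp [displ, add_assoc, he]
    have hte : ‖t i • e‖ ≤ r := norm_smul_single_le i (abs_le.1 (ht i))
    have hdist : ∀ q : EuclideanSpace ℝ (Fin n), dist (b + q) (κ 1) ≤ dist b (κ 1) + ‖q‖ := by
      intro q
      refine (dist_triangle _ b _).trans ?_
      rw [dist_eq_norm (b + q) b, add_sub_cancel_left]; linarith
    -- move along the first coordinate, then along the others from the displaced base point; `step`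
    -- moves the majorants at displaced points back to `b`
    have h1 := ih r hr (b + t i • e) (by linarith [hdist (t i • e)]) t ht v ℓ hv.2.1
    have h2 := one r b i (by linarith) (t i) (ht i) v ℓ hv.1
    have hme : ∀ m, Measurable fun q => 𝓗.maj der m v ℓ (chartPt n G R (b + q)) := fun m =>
      (𝓗.measurable_maj der m v ℓ).comp (hmeas.comp (by fun_prop))
    have h3 : ∫⁻ q, 𝓗.maj der is.length v ℓ (chartPt n G R (b + t i • e + q))
        ∂(oscMeasure n C r is) ≤
        ∫⁻ q, (𝓗.maj der (i :: is).length v ℓ (chartPt n G R (b + q)) + ENNReal.ofReal C *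
          ∫⁻ s in Icc (-r) r, 𝓗.maj der (i :: is).length v ℓ (chartPt n G R (b + (s • e + q))))
          ∂(oscMeasure n C r is) := by
      refine lintegral_mono_ae ?_
      filter_upwards [oscMeasure_ae_norm_le hr is] with q hq
      have h4 := step is.length v hv r (b + q) i (by linarith [hdist q]) (t i) (ht i) ℓ
      have h5 : ∀ s : ℝ, b + q + s • e = b + (s • e + q) := fun s => by abel
      have h6 : b + t i • e + q = b + q + t i • e := by abel
      rw [h6]
      refine h4.trans (add_le_add (𝓗.maj_mono der (Nat.le_succ _) _ _ _) ?_)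
      simp only [← he, h5]
      exact le_rfl
    have h7 : ∫⁻ s in Icc (-r) r, 𝓗.maj der 1 v ℓ (chartPt n G R (b + s • e)) ≤
        ∫⁻ s in Icc (-r) r, 𝓗.maj der (i :: is).length v ℓ (chartPt n G R (b + s • e)) :=
      lintegral_mono fun s => 𝓗.maj_mono der (by simp) _ _ _
    rw [hdisp, lintegral_oscMeasure_cons i is (hme _)]
    have hme2 : Measurable fun q => 𝓗.maj der (i :: is).length v ℓ (chartPt n G R (b + q)) := hme _
    rw [lintegral_add_left hme2, lintegral_const_mul' _ _ ENNReal.ofReal_ne_top] at h3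
    have htri : ‖𝓗.H ℓ v (chartPt n G R (b + t i • e + displ t is)) -
        𝓗.H ℓ v (chartPt n G R b)‖ₑ ≤
        ‖𝓗.H ℓ v (chartPt n G R (b + t i • e + displ t is)) -
          𝓗.H ℓ v (chartPt n G R (b + t i • e))‖ₑ +
        ‖𝓗.H ℓ v (chartPt n G R (b + t i • e)) - 𝓗.H ℓ v (chartPt n G R b)‖ₑ := by
      refine le_trans (le_of_eq ?_) (enorm_add_le _ _)
      congr 1; ring
    refine htri.trans (add_le_add (h1.trans h3) (h2.trans ?_))
    gcongr

/-- **Small oscillation.** Near the identity the coefficients of an `n` times differentiable vector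
oscillate by no more than an average of coefficients of derivatives of order at most `n`, with
respect to a measure of arbitrarily small mass supported in a fixed compact set. -/
theorem exists_osc_measure [BorelSpace G]
    (X : Module.Basis (Fin n) ℝ (GroupLieAlgebra (𝓡 n) G)) (der : Fin n → V → V) :
    ∃ K : Set G, IsCompact K ∧ ∀ δ : ℝ, 0 < δ → ∃ U ∈ 𝓝 (1 : G), ∃ θ : Measure G,
      IsFiniteMeasure θ ∧ θ Kᶜ = 0 ∧ θ univ ≤ ENNReal.ofReal δ ∧
      ∀ v ℓ, 𝓗.Dif X der n v → ∀ τ ∈ U,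
        ‖𝓗.H ℓ v τ - 𝓗.H ℓ v 1‖ₑ ≤ ∫⁻ w, 𝓗.maj der n v ℓ w ∂θ := by
  obtain ⟨R, hR, C, hC, htarget, hbound⟩ := 𝓗.exists_oscMeasure_bound X der
  have hmeas := measurable_chartPt (n := n) (G := G) htarget
  set κ := extChartAt (𝓡 n) (1 : G) with hκ
  refine ⟨κ.symm '' Metric.closedBall (κ 1) R, (isCompact_closedBall _ _).image_of_continuousOn
    ((continuousOn_extChartAt_symm (I := 𝓡 n) (1 : G)).mono htarget), fun δ hδ => ?_⟩
  set is := List.finRange n with his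
  have hislen : is.length = n := List.length_finRange
  -- choose a small box
  obtain ⟨r, hr, hrR, hrδ⟩ : ∃ r : ℝ, 0 < r ∧ n * r ≤ R ∧ (1 + 2 * r * C) ^ n - 1 ≤ δ := by
    have h1 : Tendsto (fun r : ℝ => n * r) (𝓝[>] 0) (𝓝 0) := by
      have : Continuous fun r : ℝ => n * r := by fun_prop
      exact tendsto_nhdsWithin_of_tendsto_nhds (by simpa using this.tendsto 0)
    have h2 : Tendsto (fun r : ℝ => (1 + 2 * r * C) ^ n - 1) (𝓝[>] 0) (𝓝 0) := by
      have : Continuous fun r : ℝ => (1 + 2 * r * C) ^ n - 1 := by fun_prop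
      exact tendsto_nhdsWithin_of_tendsto_nhds (by simpa using this.tendsto 0)
    have h3 : ∀ᶠ r : ℝ in 𝓝[>] 0, 0 < r := eventually_mem_nhdsWithin
    obtain ⟨r, hr⟩ := (h3.and ((h1.eventually (ge_mem_nhds hR)).and
      (h2.eventually (ge_mem_nhds hδ)))).exists
    exact ⟨r, hr.1, hr.2.1, hr.2.2⟩
  have hadd : Measurable fun q : EuclideanSpace ℝ (Fin n) => chartPt n G R (κ 1 + q) :=
    hmeas.comp (by fun_prop)
  have hbox : ∀ᶠ p in 𝓝 (κ 1), ∀ i, |(p - κ 1) i| ≤ r := by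
    refine eventually_all.2 fun i => ?_
    have h1 : Continuous fun p : EuclideanSpace ℝ (Fin n) => |(p - κ 1) i| := by fun_prop
    have h2 := h1.tendsto (κ 1)
    simp only [sub_self, PiLp.zero_apply, abs_zero] at h2
    exact h2.eventually (ge_mem_nhds hr)
  have hκ1 : Tendsto κ (𝓝 (1 : G)) (𝓝 (κ 1)) := continuousAt_extChartAt (I := 𝓡 n) (1 : G)
  have hU : ∀ᶠ τ in 𝓝 (1 : G), κ.symm (κ τ) = τ ∧ κ τ ∈ Metric.closedBall (κ 1) R ∧
      ∀ i, |(κ τ - κ 1) i| ≤ r :=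
    (eventually_chart_symm_chart (n := n) (G := G)).and
      ((hκ1.eventually (Metric.closedBall_mem_nhds _ hR)).and (hκ1.eventually hbox))
  refine ⟨_, hU, (oscMeasure n C r is).map fun q => chartPt n G R (κ 1 + q), inferInstance, ?_, ?_,
    ?_⟩
  · have hcl : MeasurableSet (κ.symm '' Metric.closedBall (κ 1) R) :=
      ((isCompact_closedBall _ _).image_of_continuousOn
        ((continuousOn_extChartAt_symm (I := 𝓡 n) (1 : G)).mono htarget)).measurableSet
    rw [Measure.map_apply hadd hcl.compl]
    refine measure_mono_null (fun q hq => ?_) (ae_iff.1 (oscMeasure_ae_norm_le (C := C) hr.le is))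
    intro hq'
    refine hq ?_
    rw [hislen] at hq'
    have hmem : κ 1 + q ∈ Metric.closedBall (κ 1) R := by
      rw [Metric.mem_closedBall, dist_eq_norm, add_sub_cancel_left]
      exact hq'.trans hrR
    show chartPt n G R (κ 1 + q) ∈ _
    rw [chartPt_of_mem hmem]
    exact mem_image_of_mem _ hmem
  · rw [Measure.map_apply hadd MeasurableSet.univ, preimage_univ]
    refine (oscMeasure_univ hC hr.le is).trans (ENNReal.ofReal_le_ofReal ?_)
    rwa [hislen]
  · rintro v ℓ hv τ ⟨h1, h2, h3⟩
    rw [lintegral_map (𝓗.measurable_maj der n v ℓ) hadd]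
    have h4 := hbound is r hr.le (κ 1) (by rw [dist_self, zero_add, hislen]; exact hrR)
      (fun i => (κ τ - κ 1) i) h3 v ℓ (by rwa [hislen])
    have h5 : κ 1 + displ (fun i => (κ τ - κ 1) i) is = κ τ := by
      have : displ (fun i => (κ τ - κ 1) i) is = κ τ - κ 1 := by
        rw [displ, his, ← Fin.sum_univ_def]
        ext j
        simp [Finset.sum_apply, Pi.single_apply]
      rw [this, add_sub_cancel]
    rw [h5, chartPt_of_mem h2, h1, chartPt_of_mem (Metric.mem_closedBall_self hR.le),
      chart_symm_apply_one, hislen] at h4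
    exact h4

/-- **Local boundedness.** Over a compact set the coefficients of an `n` times differentiable vector
are dominated by an average of coefficients of derivatives of order at most `n`. -/
theorem exists_max_measure [BorelSpace G]
    (X : Module.Basis (Fin n) ℝ (GroupLieAlgebra (𝓡 n) G)) (der : Fin n → V → V)
    {K : Set G} (hK : IsCompact K) :
    ∃ L : Set G, IsCompact L ∧ ∃ θ : Measure G, IsFiniteMeasure θ ∧ θ Lᶜ = 0 ∧
      ∀ v ℓ, 𝓗.Dif X der n v → ∀ τ ∈ K, ‖𝓗.H ℓ v τ‖ₑ ≤ ∫⁻ w, 𝓗.maj der n v ℓ w ∂θ := by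
  obtain ⟨K₁, hK₁, hosc⟩ := 𝓗.exists_osc_measure X der
  obtain ⟨U, hU, θ, hθ, hθK, -, hle⟩ := hosc 1 one_pos
  set θ₁ : Measure G := Measure.dirac 1 + θ with hθ₁
  have hbase : ∀ v ℓ, 𝓗.Dif X der n v → ∀ τ ∈ U,
      ‖𝓗.H ℓ v τ‖ₑ ≤ ∫⁻ w, 𝓗.maj der n v ℓ w ∂θ₁ := by
    intro v ℓ hv τ hτ
    rw [hθ₁, lintegral_add_measure, lintegral_dirac' _ (𝓗.measurable_maj der n v ℓ)]
    have h1 : ‖𝓗.H ℓ v 1‖ₑ ≤ 𝓗.maj der n v ℓ 1 := 𝓗.maj_mono der (Nat.zero_le n) v ℓ 1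
    refine le_trans ?_ (add_le_add h1 (hle v ℓ hv τ hτ))
    refine le_trans (le_of_eq ?_) (enorm_add_le _ _)
    simp
  -- finitely many translates of `U` cover `K`
  obtain ⟨s, -, hs⟩ := hK.elim_nhds_subcover (fun g => (fun h => g * h) '' U) fun g _ => by
    have := (Homeomorph.mulLeft g).isOpenMap.image_mem_nhds hU
    simpa using this
  have hgm : ∀ g : G, Measurable fun h : G => g * h := fun g => (continuous_const_mul g).measurable
  refine ⟨⋃ g ∈ s, (fun h => g * h) '' (insert 1 K₁), s.isCompact_biUnion fun g _ =>
    (hK₁.insert 1).image (continuous_const_mul g), ∑ g ∈ s, θ₁.map (fun h => g * h), ?_, ?_, ?_⟩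
  · infer_instance
  · rw [Measure.finsetSum_apply]
    refine Finset.sum_eq_zero fun g hg => ?_
    rw [Measure.map_apply (hgm g) (s.isCompact_biUnion fun g _ =>
      (hK₁.insert 1).image (continuous_const_mul g)).measurableSet.compl]
    have hsub : (fun h => g * h) ⁻¹' (⋃ g ∈ s, (fun h => g * h) '' (insert 1 K₁))ᶜ ⊆
        (insert 1 K₁)ᶜ := by
      intro h hh hh'
      exact hh (mem_biUnion hg (mem_image_of_mem _ hh'))
    refine measure_mono_null hsub ?_
    rw [hθ₁, Measure.add_apply, Measure.dirac_apply' _ (hK₁.insert 1).measurableSet.compl]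
    have : θ (insert 1 K₁)ᶜ = 0 := measure_mono_null (compl_subset_compl.2 (subset_insert _ _)) hθK
    simp [this]
  · intro v ℓ hv τ hτ
    obtain ⟨g, hg, h, hh, rfl⟩ : ∃ g ∈ s, ∃ h ∈ U, g * h = τ := by
      obtain ⟨g, hg, h, hh, h'⟩ := mem_iUnion₂.1 (hs hτ)
      exact ⟨g, hg, h, hh, h'⟩
    rw [lintegral_finsetSum_measure]
    refine le_trans ?_ (Finset.single_le_sum (f := fun g => ∫⁻ w, 𝓗.maj der n v ℓ w
      ∂(θ₁.map fun h => g * h)) (fun _ _ => zero_le) hg)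
    rw [lintegral_map (𝓗.measurable_maj der n v ℓ) (hgm g)]
    simp only [← maj_act]
    rw [← ofReal_norm, ← 𝓗.norm_H_act, ofReal_norm]
    exact hbase v (𝓗.act ℓ g) hv h hh

end CoeffFamily

end Coeff

/-! ### Solid BF-spaces -/

section Solid

variable {G : Type*} [TopologicalSpace G] [Group G] [MeasurableSpace G]
  {μ : Measure G} {B : Type*} [NormedAddCommGroup B] [NormedSpace ℂ B] {𝓑 : BFSpace μ B}

namespace BFSpace

lemma rep_self (𝓑 : BFSpace μ B) (f : B) : 𝓑.Rep f (𝓑.toAE f) := ae_eq_refl _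

lemma Rep.congr {f : B} {g h : G → ℂ} (hf : 𝓑.Rep f g) (hgh : g =ᵐ[μ] h) : 𝓑.Rep f h :=
  EventuallyEq.trans hf hgh

lemma Rep.unique {f f' : B} {g : G → ℂ} (hf : 𝓑.Rep f g) (hf' : 𝓑.Rep f' g) : f = f' :=
  𝓑.injective (AEEqFun.ext (EventuallyEq.trans hf (EventuallyEq.symm hf')))

lemma Rep.add {f f' : B} {g g' : G → ℂ} (hf : 𝓑.Rep f g) (hf' : 𝓑.Rep f' g') :
    𝓑.Rep (f + f') (fun x => g x + g' x) := by
  have h0 : (𝓑.toAE (f + f') : G → ℂ) =ᵐ[μ] 𝓑.toAE f + 𝓑.toAE f' := by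
    rw [map_add]; exact AEEqFun.coeFn_add _ _
  exact h0.trans (EventuallyEq.add hf hf')

lemma Rep.smul {f : B} {g : G → ℂ} (c : ℂ) (hf : 𝓑.Rep f g) :
    𝓑.Rep (c • f) (fun x => c * g x) := by
  have h0 : (𝓑.toAE (c • f) : G → ℂ) =ᵐ[μ] c • ⇑(𝓑.toAE f) := by
    rw [map_smul]; exact AEEqFun.coeFn_smul _ _
  refine h0.trans ?_
  filter_upwards [hf] with x hx
  simp [hx]

lemma Rep.zero : 𝓑.Rep 0 (fun _ => 0) := by
  have h0 : (𝓑.toAE 0 : G → ℂ) =ᵐ[μ] 0 := by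
    rw [map_zero]; exact AEEqFun.coeFn_zero
  exact h0

lemma Rep.neg {f : B} {g : G → ℂ} (hf : 𝓑.Rep f g) : 𝓑.Rep (-f) (fun x => -g x) := by
  have := hf.smul (-1)
  simpa using this

lemma Rep.sub {f f' : B} {g g' : G → ℂ} (hf : 𝓑.Rep f g) (hf' : 𝓑.Rep f' g') :
    𝓑.Rep (f - f') (fun x => g x - g' x) := by
  have := hf.add hf'.neg
  simpa [sub_eq_add_neg] using this

lemma Rep.aestronglyMeasurable {f : B} {g : G → ℂ} (hf : 𝓑.Rep f g) :
    AEStronglyMeasurable g μ :=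
  (𝓑.toAE f).aestronglyMeasurable.congr hf

/-- Two convergent sequences in a BF-space converge almost everywhere on a compact set along a
common subsequence. -/
lemma exists_seq_tendsto_ae₂ (𝓑 : BFSpace μ B) {u w : ℕ → B} {x y : B}
    (hu : Tendsto u atTop (𝓝 x)) (hw : Tendsto w atTop (𝓝 y)) {K : Set G} (hK : IsCompact K) :
    ∃ ns : ℕ → ℕ, StrictMono ns ∧ ∀ᵐ z ∂(μ.restrict K),
      Tendsto (fun k => 𝓑.toAE (u (ns k)) z) atTop (𝓝 (𝓑.toAE x z)) ∧
      Tendsto (fun k => 𝓑.toAE (w (ns k)) z) atTop (𝓝 (𝓑.toAE y z)) := by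
  have key : ∀ (u : ℕ → B) (x : B), Tendsto u atTop (𝓝 x) → ∃ ns : ℕ → ℕ, StrictMono ns ∧
      ∀ᵐ z ∂(μ.restrict K), Tendsto (fun k => 𝓑.toAE (u (ns k)) z) atTop (𝓝 (𝓑.toAE x z)) := by
    intro u x hu
    have h1 : Tendsto (fun k => u k - x) atTop (𝓝 0) := by
      simpa using hu.sub (tendsto_const_nhds (x := x))
    obtain ⟨ns, hns, hae⟩ := (𝓑.tendsto_measure _ h1 K hK).exists_seq_tendsto_ae
    refine ⟨ns, hns, ?_⟩
    have h2 : ∀ᵐ z ∂(μ.restrict K), ∀ k,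
        𝓑.toAE (u (ns k) - x) z = 𝓑.toAE (u (ns k)) z - 𝓑.toAE x z :=
      ae_all_iff.2 fun k => ae_restrict_of_ae ((𝓑.rep_self (u (ns k))).sub (𝓑.rep_self x))
    filter_upwards [hae, h2] with z hz hz2
    simp only [hz2] at hz
    simpa using hz.add (tendsto_const_nhds (x := 𝓑.toAE x z))
  obtain ⟨ns, hns, h1⟩ := key u x hu
  obtain ⟨ms, hms, h2⟩ := key (w ∘ ns) y (hw.comp hns.tendsto_atTop)
  refine ⟨ns ∘ ms, hns.comp hms, ?_⟩
  filter_upwards [h1, h2] with z hz1 hz2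
  exact ⟨hz1.comp hms.tendsto_atTop, hz2⟩

lemma ae_of_forall_isCompact [SigmaCompactSpace G] {p : G → Prop}
    (h : ∀ K : Set G, IsCompact K → ∀ᵐ z ∂(μ.restrict K), p z) : ∀ᵐ z ∂μ, p z := by
  rw [← Measure.restrict_univ (μ := μ), ← iUnion_compactCovering G, ae_restrict_iUnion_iff]
  exact fun k => h _ (isCompact_compactCovering G k)

lemma ae_norm_le_norm_Lp_top (m : Lp ℂ ∞ μ) : ∀ᵐ x ∂μ, ‖m x‖ ≤ ‖m‖ := by
  filter_upwards [ae_le_eLpNormEssSup (f := m) (μ := μ)] with x hx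
  rw [Lp.norm_def, eLpNorm_exponent_top, ← toReal_enorm]
  refine ENNReal.toReal_mono ?_ hx
  have := Lp.eLpNorm_ne_top m
  rwa [eLpNorm_exponent_top] at this

/-- Solidity bounds pointwise multiplication by bounded functions: by the closed graph theorem it
is separately continuous, and the uniform boundedness principle makes it uniformly so. -/
theorem exists_solid_const [CompleteSpace B] [SigmaCompactSpace G] (hs : 𝓑.Solid) :
    ∃ C : ℝ, 0 < C ∧ ∀ f g : B, (∀ᵐ x ∂μ, ‖𝓑.toAE f x‖ ≤ ‖𝓑.toAE g x‖) → ‖f‖ ≤ C * ‖g‖ := by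
  have hmul : ∀ (m : Lp ℂ ∞ μ) (f : B), ∃ f' : B, 𝓑.Rep f' (fun x => m x * 𝓑.toAE f x) := by
    intro m f
    refine hs ((‖m‖ : ℂ) • f) _ ((Lp.aestronglyMeasurable m).mul
      (𝓑.toAE f).aestronglyMeasurable) ?_
    filter_upwards [(𝓑.rep_self f).smul (‖m‖ : ℂ), ae_norm_le_norm_Lp_top m] with x hx hm
    rw [hx, norm_mul, norm_mul, Complex.norm_real, norm_norm]
    gcongr
  choose op hop using hmul
  have hadd : ∀ m f f', op m (f + f') = op m f + op m f' := fun m f f' => by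
    refine (hop m (f + f')).unique (((hop m f).add (hop m f')).congr ?_)
    filter_upwards [(𝓑.rep_self f).add (𝓑.rep_self f')] with x hx
    rw [hx]; ring
  have hsmul : ∀ m (c : ℂ) f, op m (c • f) = c • op m f := fun m c f => by
    refine (hop m (c • f)).unique (((hop m f).smul c).congr ?_)
    filter_upwards [(𝓑.rep_self f).smul c] with x hx
    rw [hx]; ring
  have hadd' : ∀ m m' f, op (m + m') f = op m f + op m' f := fun m m' f => by
    refine (hop (m + m') f).unique (((hop m f).add (hop m' f)).congr ?_)
    filter_upwards [Lp.coeFn_add m m'] with x hx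
    rw [hx, Pi.add_apply]; ring
  have hsmul' : ∀ (c : ℂ) m f, op (c • m) f = c • op m f := fun c m f => by
    refine (hop (c • m) f).unique (((hop m f).smul c).congr ?_)
    filter_upwards [Lp.coeFn_smul c m] with x hx
    rw [hx, Pi.smul_apply, smul_eq_mul]; ring
  let M : Lp ℂ ∞ μ → B →ₗ[ℂ] B := fun m =>
    { toFun := op m, map_add' := hadd m, map_smul' := hsmul m }
  let N : B → Lp ℂ ∞ μ →ₗ[ℂ] B := fun f =>
    { toFun := fun m => op m f, map_add' := fun m m' => hadd' m m' f,
      map_smul' := fun c m => hsmul' c m f }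
  -- closed graph theorem for `f ↦ m f` with `m` fixed
  have hM : ∀ m, Continuous (M m) := fun m => by
    refine LinearMap.continuous_of_seq_closed_graph _ fun u x y hu hw => ?_
    refine (hop m x).unique ?_ |>.symm
    refine ae_of_forall_isCompact fun K hK => ?_
    obtain ⟨ns, -, hns⟩ := 𝓑.exists_seq_tendsto_ae₂ hu hw hK
    have h1 : ∀ᵐ z ∂(μ.restrict K), ∀ k, 𝓑.toAE (op m (u (ns k))) z = m z * 𝓑.toAE (u (ns k)) z :=
      ae_all_iff.2 fun k => ae_restrict_of_ae (hop m _)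
    filter_upwards [hns, h1] with z hz hz1
    refine tendsto_nhds_unique hz.2 ?_
    refine (hz.1.const_mul (m z)).congr fun k => ?_
    exact (hz1 k).symm
  -- closed graph theorem for `m ↦ m f` with `f` fixed
  have hN : ∀ f, Continuous (N f) := fun f => by
    refine LinearMap.continuous_of_seq_closed_graph _ fun u x y hu hw => ?_
    refine (hop x f).unique ?_ |>.symm
    refine ae_of_forall_isCompact fun K hK => ?_
    obtain ⟨ns, hmono, hns⟩ := 𝓑.exists_seq_tendsto_ae₂ hw hw hK
    have h1 : ∀ᵐ z ∂(μ.restrict K), ∀ k, 𝓑.toAE (op (u k) f) z = u k z * 𝓑.toAE f z :=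
      ae_all_iff.2 fun k => ae_restrict_of_ae (hop _ f)
    have h2 : ∀ᵐ z ∂(μ.restrict K), ∀ k, ‖(u k - x : Lp ℂ ∞ μ) z‖ ≤ ‖u k - x‖ :=
      ae_all_iff.2 fun k => ae_restrict_of_ae (ae_norm_le_norm_Lp_top _)
    have h3 : ∀ᵐ z ∂(μ.restrict K), ∀ k, (u k - x : Lp ℂ ∞ μ) z = u k z - x z :=
      ae_all_iff.2 fun k => ae_restrict_of_ae (Lp.coeFn_sub _ _)
    filter_upwards [hns, h1, h2, h3] with z hz hz1 hz2 hz3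
    refine tendsto_nhds_unique hz.2 ?_
    have h4 : Tendsto (fun k => u k z) atTop (𝓝 (x z)) := by
      rw [tendsto_iff_norm_sub_tendsto_zero]
      refine squeeze_zero (fun _ => norm_nonneg _) (fun k => ?_)
        (tendsto_iff_norm_sub_tendsto_zero.1 hu)
      rw [← hz3]; exact hz2 k
    refine ((h4.comp hmono.tendsto_atTop).mul_const (𝓑.toAE f z)).congr fun k => ?_
    exact (hz1 (ns k)).symm
  obtain ⟨C, hC⟩ := banach_steinhaus
    (g := fun m : {m : Lp ℂ ∞ μ // ‖m‖ ≤ 1} => (⟨M m.1, hM m.1⟩ : B →L[ℂ] B)) (fun f => by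
      refine ⟨‖(⟨N f, hN f⟩ : Lp ℂ ∞ μ →L[ℂ] B)‖, fun m => ?_⟩
      have := (⟨N f, hN f⟩ : Lp ℂ ∞ μ →L[ℂ] B).le_opNorm m.1
      refine this.trans (mul_le_of_le_one_right (norm_nonneg _) m.2))
  refine ⟨max C 1, by positivity, fun f g hfg => ?_⟩
  -- `f = q g` with `|q| ≤ 1`; where `g` vanishes so does `f`, and the quotient is `0`
  set q : G → ℂ := fun x => 𝓑.toAE f x / 𝓑.toAE g x with hq
  have hqm : AEStronglyMeasurable q μ :=
    ((𝓑.toAE f).aestronglyMeasurable.aemeasurable.div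
      (𝓑.toAE g).aestronglyMeasurable.aemeasurable).aestronglyMeasurable
  have hq1 : ∀ᵐ x ∂μ, ‖q x‖ ≤ 1 := by
    filter_upwards [hfg] with x hx
    rw [hq, norm_div]
    exact div_le_one_of_le₀ hx (norm_nonneg _)
  have hqL : MemLp q ∞ μ := memLp_top_of_bound hqm 1 hq1
  have hqn : ‖hqL.toLp q‖ ≤ 1 := by
    rw [Lp.norm_toLp]
    refine ENNReal.toReal_le_of_le_ofReal zero_le_one ?_
    exact eLpNorm_le_of_ae_bound hq1 |>.trans (by simp)
  have h1 : f = op (hqL.toLp q) g := by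
    refine (𝓑.rep_self f).unique ((hop _ g).congr ?_)
    filter_upwards [hqL.coeFn_toLp, hfg] with x hx hx'
    rw [hx, hq]
    by_cases h0 : 𝓑.toAE g x = 0
    · rw [h0, norm_zero] at hx'
      simp [h0, norm_le_zero_iff.1 hx']
    · simp [h0]
  have h2 := (⟨M (hqL.toLp q), hM _⟩ : B →L[ℂ] B).le_of_opNorm_le (hC ⟨_, hqn⟩) g
  calc ‖f‖ = ‖op (hqL.toLp q) g‖ := by rw [← h1]
    _ ≤ C * ‖g‖ := h2
    _ ≤ _ := by gcongr; exact le_max_left _ _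

end BFSpace
end Solid

/-! ### Projective representations and their coefficients -/

lemma norm_circle_mul (z : Circle) (w : ℂ) : ‖(z : ℂ) * w‖ = ‖w‖ := by
  rw [norm_mul, Circle.norm_coe, one_mul]

lemma conj_circle_mul_self (z : Circle) : conj (z : ℂ) * (z : ℂ) = 1 := by
  rw [← Circle.coe_inv_eq_conj, ← Circle.coe_mul, inv_mul_cancel, Circle.coe_one]

lemma circle_mul_conj_self (z : Circle) : (z : ℂ) * conj (z : ℂ) = 1 := by
  rw [mul_comm, conj_circle_mul_self]

section Rep

variable {G S : Type*} [Group G] [MeasurableSpace G]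
  [AddCommGroup S] [Module ℂ S] [TopologicalSpace S] (ρ : ProjRep G S)

namespace ProjRep

lemma σ_one_right [Nontrivial S] (x : G) : (ρ.σ x 1 : ℂ) = 1 := by
  obtain ⟨v, hv⟩ := exists_ne (0 : S)
  have h := ρ.map_mul x 1 v
  rw [mul_one, ρ.map_one] at h
  have h1 : (1 - (ρ.σ x 1 : ℂ)) • ρ.toFun x v = 0 := by
    rw [sub_smul, one_smul, sub_eq_zero]; exact h
  rcases smul_eq_zero.1 h1 with h2 | h2
  · exact (sub_eq_zero.1 h2).symm
  · exact absurd ((ρ.toFun x).map_eq_zero_iff.1 h2) hv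

lemma symm_apply (x : G) (w : S) :
    (ρ.toFun x).symm w = (ρ.σ x x⁻¹ : ℂ) • ρ.toFun x⁻¹ w := by
  have h := ρ.map_mul x x⁻¹ w
  rw [mul_inv_cancel, ρ.map_one] at h
  rw [ContinuousLinearEquiv.symm_apply_eq, map_smul]
  exact h

lemma symm_apply_apply (y x : G) (v : S) :
    (ρ.toFun y).symm (ρ.toFun x v) = (ρ.σ y (y⁻¹ * x) : ℂ) • ρ.toFun (y⁻¹ * x) v := by
  have h := ρ.map_mul y (y⁻¹ * x) v
  rw [mul_inv_cancel_left] at h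
  rw [h, map_smul, ContinuousLinearEquiv.symm_apply_apply]

lemma dual_apply (x : G) (l : S →L⋆[ℂ] ℂ) (v : S) : ρ.dual x l v = l ((ρ.toFun x).symm v) := rfl

lemma dual_one (l : S →L⋆[ℂ] ℂ) : ρ.dual 1 l = l := by
  ext v; rw [dual_apply, ρ.map_one]; rfl

/-- Twisted left translation of a wavelet transform is the transform of the translated
functional. -/
lemma twL_wav (y x : G) (v : S) (l : S →L⋆[ℂ] ℂ) :
    twL ρ.σ y (ρ.wav v l) x = ρ.dual y l (ρ.toFun x v) := by
  rw [dual_apply, symm_apply_apply, map_smulₛₗ]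
  rfl

lemma norm_dual_apply (y x : G) (v : S) (l : S →L⋆[ℂ] ℂ) :
    ‖ρ.dual y l (ρ.toFun x v)‖ = ‖ρ.wav v l (y⁻¹ * x)‖ := by
  rw [← twL_wav, twL, norm_mul, RCLike.norm_conj, Circle.norm_coe, one_mul]

lemma enorm_dual_apply (y x : G) (v : S) (l : S →L⋆[ℂ] ℂ) :
    ‖ρ.dual y l (ρ.toFun x v)‖ₑ = ‖ρ.wav v l (y⁻¹ * x)‖ₑ := by
  rw [← ofReal_norm, norm_dual_apply, ofReal_norm]

lemma dual_mul (x y : G) (l : S →L⋆[ℂ] ℂ) (w : S) :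
    ρ.dual (x * y) l w = (ρ.σ x y : ℂ) * ρ.dual y l ((ρ.toFun x).symm w) := by
  rw [dual_apply, dual_apply]
  set z := (ρ.toFun (x * y)).symm w with hz
  have h1 : w = ρ.toFun (x * y) z := by rw [hz, ContinuousLinearEquiv.apply_symm_apply]
  rw [h1, ρ.map_mul, map_smul, map_smul, ContinuousLinearEquiv.symm_apply_apply,
    ContinuousLinearEquiv.symm_apply_apply, map_smulₛₗ, smul_eq_mul, ← mul_assoc,
    circle_mul_conj_self, one_mul]

lemma apply_mul (x y : G) (v : S) (l : S →L⋆[ℂ] ℂ) :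
    l (ρ.toFun (x * y) v) = conj (ρ.σ x y : ℂ) * l (ρ.toFun x (ρ.toFun y v)) := by
  rw [ρ.map_mul, map_smulₛₗ]; rfl

variable [TopologicalSpace G] [IsTopologicalGroup G] [BorelSpace G] [SecondCountableTopology G]

lemma measurable_wav (v : S) (l : S →L⋆[ℂ] ℂ) : Measurable (ρ.wav v l) := ρ.measurable_coeff v l

lemma measurable_dual (l : S →L⋆[ℂ] ℂ) (v : S) : Measurable fun y => ρ.dual y l v := by
  simp only [dual_apply, symm_apply, map_smulₛₗ, smul_eq_mul]
  have h1 : Measurable fun y : G => (ρ.σ y y⁻¹ : ℂ) :=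
    ρ.measurable_σ.comp (measurable_id.prodMk measurable_inv)
  exact (Complex.continuous_conj.measurable.comp h1).mul
    ((ρ.measurable_coeff v l).comp measurable_inv)

lemma measurable_dual_prod (l : S →L⋆[ℂ] ℂ) (v : S) :
    Measurable fun p : G × G => ρ.dual p.1 l (ρ.toFun p.2 v) := by
  simp only [← twL_wav]
  have h0 : Measurable fun p : G × G => p.1⁻¹ * p.2 := measurable_fst.inv.mul measurable_snd
  have h1 : Measurable fun p : G × G => (ρ.σ p.1 (p.1⁻¹ * p.2) : ℂ) :=
    ρ.measurable_σ.comp (measurable_fst.prodMk h0)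
  exact (Complex.continuous_conj.measurable.comp h1).mul ((ρ.measurable_coeff v l).comp h0)

end ProjRep

section Families

variable {n : ℕ} [TopologicalSpace G] [ChartedSpace (EuclideanSpace ℝ (Fin n)) G]

lemma SmoothNear.contMDiffAt {σ : G → G → Circle} {A : Set (G × G)}
    (h : SmoothNear (n := n) σ A) {p : G × G} (hp : p ∈ A) :
    ContMDiffAt ((𝓡 n).prod (𝓡 n)) 𝓘(ℝ, ℂ) ∞ (fun p : G × G => (σ p.1 p.2 : ℂ)) p := by
  obtain ⟨O, hO, hA, h⟩ := h
  exact h.contMDiffAt (hO.mem_nhds (hA hp))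

variable [IsTopologicalGroup G] [BorelSpace G] [SecondCountableTopology G] [Nontrivial S]

namespace ProjRep

/-- The coefficients `⟨l, ρ(g) v⟩` of a projective representation. -/
noncomputable def rightFamily (hρ : ρ.WeaklyContinuousNearOne)
    (hσ : SmoothNear (n := n) ρ.σ {((1 : G), (1 : G))}) :
    CoeffFamily n G (S →L⋆[ℂ] ℂ) S where
  H l v g := l (ρ.toFun g v)
  act l g := l.comp (ρ.toFun g : S →L[ℂ] S)
  c g h := conj (ρ.σ g h : ℂ)
  norm_c g h := by rw [RCLike.norm_conj, Circle.norm_coe]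
  c_one g := by rw [ρ.σ_one_right, _root_.map_one]
  H_mul l v g h := ρ.apply_mul g h v l
  measurable_H l v := ρ.measurable_coeff v l
  continuousAt_one l v := by
    obtain ⟨U, hU, h⟩ := hρ l v
    exact h.continuousAt hU
  smooth := by
    have h := hσ.contMDiffAt (mem_singleton _)
    exact ContMDiffAt.comp (1, 1) (Complex.conjCLE.contDiff.contMDiff.contMDiffAt) h

/-- The coefficients `⟨ρ*(g) m, w⟩` of the dual representation. -/
noncomputable def leftFamily (hρ : ρ.WeaklyContinuousNearOne)
    (hσ : SmoothNear (n := n) ρ.σ {((1 : G), (1 : G))}) :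
    CoeffFamily n G S (S →L⋆[ℂ] ℂ) where
  H w m g := ρ.dual g m w
  act w g := (ρ.toFun g).symm w
  c g h := (ρ.σ g h : ℂ)
  norm_c g h := Circle.norm_coe _
  c_one g := ρ.σ_one_right g
  H_mul w m g h := ρ.dual_mul g h m w
  measurable_H w m := ρ.measurable_dual m w
  continuousAt_one w m := by
    obtain ⟨U, hU, h⟩ := hρ m w
    have hm : ContinuousAt (fun g => m (ρ.toFun g w)) 1 := h.continuousAt hU
    have hs := (hσ.contMDiffAt (mem_singleton _)).continuousAt
    simp only [dual_apply, symm_apply, map_smulₛₗ, smul_eq_mul]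
    have h1 : ContinuousAt (fun g : G => (ρ.σ g g⁻¹ : ℂ)) 1 :=
      ContinuousAt.comp_of_eq (f := fun g : G => (g, g⁻¹)) hs
        (continuousAt_id.prodMk continuous_inv.continuousAt) (by simp)
    have h2 : ContinuousAt (fun g : G => m (ρ.toFun g⁻¹ w)) 1 :=
      ContinuousAt.comp_of_eq (f := fun g : G => g⁻¹) hm continuous_inv.continuousAt (by simp)
    exact (Complex.continuous_conj.continuousAt.comp h1).mul h2
  smooth := hσ.contMDiffAt (mem_singleton _)

/-- The modulus of every wavelet transform is continuous. -/
lemma continuous_norm_wav (hρ : ρ.WeaklyContinuousNearOne) (v : S) (l : S →L⋆[ℂ] ℂ) :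
    Continuous fun x => ‖ρ.wav v l x‖ := by
  rw [continuous_iff_continuousAt]
  intro x
  obtain ⟨U, hU, h⟩ := hρ (l.comp (ρ.toFun x : S →L[ℂ] S)) v
  have h1 : ContinuousAt (fun g => l (ρ.toFun x (ρ.toFun g v))) 1 := h.continuousAt hU
  have hT : Tendsto (fun g => x⁻¹ * g) (𝓝 x) (𝓝 1) := by
    simpa using (tendsto_const_nhds (x := x⁻¹)).mul (tendsto_id (x := 𝓝 x))
  have h2 := (h1.norm.tendsto).comp hT
  have h3 : ∀ g, ‖ρ.wav v l g‖ = ‖l (ρ.toFun x (ρ.toFun (x⁻¹ * g) v))‖ := by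
    intro g
    have := ρ.apply_mul x (x⁻¹ * g) v l
    rw [mul_inv_cancel_left] at this
    rw [wav, this, norm_mul, RCLike.norm_conj, Circle.norm_coe, one_mul]
  refine Tendsto.congr (fun g => (h3 g).symm) (h2.trans (le_of_eq ?_))
  show 𝓝 _ = 𝓝 ‖ρ.wav v l x‖
  rw [h3 x, inv_mul_cancel]

end ProjRep
end Families

end Rep

/-! ### The pairing of a BF-space with vectors -/

section Pairing

variable {G S : Type*} [TopologicalSpace G] [Group G] [MeasurableSpace G]
  [AddCommGroup S] [Module ℂ S] [TopologicalSpace S]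
  {μ : Measure G} {B : Type*} [NormedAddCommGroup B] [NormedSpace ℂ B]
  {ρ : ProjRep G S} {j : S →ₗ[ℂ] (S →L⋆[ℂ] ℂ)} {𝓑 : BFSpace μ B} {u : S}

lemma twL_wav_one (y : G) (v : S) (l : S →L⋆[ℂ] ℂ) :
    twL ρ.σ y (ρ.wav v l) 1 = ρ.dual y l v := by
  rw [ρ.twL_wav, ρ.map_one]; rfl

namespace CoorbitAssumption

lemma integrable_pairing (hc : CoorbitAssumption ρ j 𝓑 u) (f : B) (v : S) :
    Integrable (fun y => 𝓑.toAE f y * ρ.dual y (j u) v) μ := by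
  have := hc.exists_pairing f v
  simpa only [TwConvExists, twL_wav_one] using this

lemma integrable_pairing_rep (hc : CoorbitAssumption ρ j 𝓑 u) {f : B} {f₀ : G → ℂ}
    (hf : 𝓑.Rep f f₀) (v : S) : Integrable (fun y => f₀ y * ρ.dual y (j u) v) μ := by
  refine (hc.integrable_pairing f v).congr ?_
  filter_upwards [hf] with y hy
  rw [hy]

lemma continuous_integral (hc : CoorbitAssumption ρ j 𝓑 u) :
    Continuous fun p : B × S => ∫ y, 𝓑.toAE p.1 y * ρ.dual y (j u) p.2 ∂μ := by
  have := hc.continuous_pairing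
  simpa only [twConv, twL_wav_one] using this

/-- The functional `∫ f(y) ρ*(y)u dy` on `S` defined by an element `f` of the BF-space. -/
noncomputable def synth (hc : CoorbitAssumption ρ j 𝓑 u) (f : B) : S →L⋆[ℂ] ℂ where
  toFun v := ∫ y, 𝓑.toAE f y * ρ.dual y (j u) v ∂μ
  map_add' v w := by
    rw [← integral_add (hc.integrable_pairing f v) (hc.integrable_pairing f w)]
    simp only [map_add, mul_add]
  map_smul' c v := by
    rw [smul_eq_mul, ← integral_const_mul]
    congr 1 with y
    rw [map_smulₛₗ, smul_eq_mul]; ring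
  cont := hc.continuous_integral.comp (Continuous.prodMk_right f)

lemma synth_apply (hc : CoorbitAssumption ρ j 𝓑 u) {f : B} {f₀ : G → ℂ} (hf : 𝓑.Rep f f₀)
    (v : S) : hc.synth f v = ∫ y, f₀ y * ρ.dual y (j u) v ∂μ := by
  refine integral_congr_ae ?_
  filter_upwards [hf] with y hy
  rw [hy]

lemma synth_add (hc : CoorbitAssumption ρ j 𝓑 u) (f g : B) :
    hc.synth (f + g) = hc.synth f + hc.synth g := by
  ext v
  rw [hc.synth_apply ((𝓑.rep_self f).add (𝓑.rep_self g)), add_apply,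
    hc.synth_apply (𝓑.rep_self f), hc.synth_apply (𝓑.rep_self g),
    ← integral_add (hc.integrable_pairing f v) (hc.integrable_pairing g v)]
  simp only [add_mul]

lemma synth_smul (hc : CoorbitAssumption ρ j 𝓑 u) (c : ℂ) (f : B) :
    hc.synth (c • f) = c • hc.synth f := by
  ext v
  rw [hc.synth_apply ((𝓑.rep_self f).smul c), smul_apply,
    hc.synth_apply (𝓑.rep_self f), smul_eq_mul, ← integral_const_mul]
  simp only [mul_assoc]

/-- Each vector pairs continuously with the BF-space. -/
lemma exists_synth_bound (hc : CoorbitAssumption ρ j 𝓑 u) (v : S) :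
    ∃ C : ℝ, 0 ≤ C ∧ ∀ f, ‖hc.synth f v‖ ≤ C * ‖f‖ := by
  let L : B →L[ℂ] ℂ :=
    { toFun := fun f => hc.synth f v
      map_add' := fun f g => by rw [hc.synth_add]; rfl
      map_smul' := fun c f => by rw [hc.synth_smul]; rfl
      cont := hc.continuous_integral.comp (Continuous.prodMk_left v) }
  exact ⟨‖L‖, norm_nonneg _, fun f => L.le_opNorm f⟩

/-- The twisted convolution with `W_u(u)` is the wavelet transform of the synthesized
functional. -/
lemma twConv_eq_wav_synth (hc : CoorbitAssumption ρ j 𝓑 u) {f : B} {f₀ : G → ℂ}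
    (hf : 𝓑.Rep f f₀) (v : S) (x : G) :
    twConv μ ρ.σ f₀ (ρ.wav v (j u)) x = ρ.wav v (hc.synth f) x := by
  rw [ProjRep.wav, hc.synth_apply hf, twConv]
  simp only [ρ.twL_wav]

lemma twConvExists (hc : CoorbitAssumption ρ j 𝓑 u) {f : B} {f₀ : G → ℂ}
    (hf : 𝓑.Rep f f₀) (v : S) (x : G) : TwConvExists μ ρ.σ f₀ (ρ.wav v (j u)) x := by
  have := hc.integrable_pairing_rep hf (ρ.toFun x v)
  simpa only [TwConvExists, ρ.twL_wav] using this

lemma ev_eq (hc : CoorbitAssumption ρ j 𝓑 u) (f : B) (x : G) :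
    𝓑.ev ρ.σ (ρ.wav u (j u)) f x = ρ.wav u (hc.synth f) x :=
  hc.twConv_eq_wav_synth (𝓑.rep_self f) u x

end CoorbitAssumption
end Pairing

/-! ### Domination by elements of a solid BF-space -/

section Dominated

variable {G : Type*} [TopologicalSpace G] [Group G] [MeasurableSpace G]
  {μ : Measure G} {B : Type*} [NormedAddCommGroup B] [NormedSpace ℂ B] {𝓑 : BFSpace μ B}

namespace BFSpace

/-- The function `Φ` is dominated almost everywhere by a nonnegative element of the BF-space of norm
at most `M`. Estimates of functions with values in `[0, ∞]` that are not known beforehand to be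
finite or measurable are expressed in this way. -/
def Dom (𝓑 : BFSpace μ B) (Φ : G → ℝ≥0∞) (M : ℝ) : Prop :=
  ∃ g : B, ‖g‖ ≤ M ∧ ∃ g₀ : G → ℝ≥0, Measurable g₀ ∧ 𝓑.Rep g (fun y => ((g₀ y : ℝ) : ℂ)) ∧
    ∀ᵐ y ∂μ, Φ y ≤ g₀ y

/-- Convolution by `m` preserves domination, with a bound for the norms. -/
def DomConv (𝓑 : BFSpace μ B) (m : G → ℝ≥0∞) : Prop :=
  ∃ C : ℝ, 0 ≤ C ∧ ∀ Φ M, 𝓑.Dom Φ M → 𝓑.Dom (fun z => ∫⁻ y, Φ y * m (y⁻¹ * z) ∂μ) (C * M)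

lemma Dom.nonneg {Φ : G → ℝ≥0∞} {M : ℝ} (h : 𝓑.Dom Φ M) : 0 ≤ M := by
  obtain ⟨g, hg, -⟩ := h
  exact (norm_nonneg g).trans hg

lemma Dom.mono_ae {Φ Ψ : G → ℝ≥0∞} {M N : ℝ} (h : 𝓑.Dom Φ M) (hΨ : ∀ᵐ y ∂μ, Ψ y ≤ Φ y)
    (hN : M ≤ N) : 𝓑.Dom Ψ N := by
  obtain ⟨g, hg, g₀, hm, hr, hle⟩ := h
  refine ⟨g, hg.trans hN, g₀, hm, hr, ?_⟩
  filter_upwards [hle, hΨ] with y h1 h2 using h2.trans h1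

lemma Dom.mono {Φ Ψ : G → ℝ≥0∞} {M N : ℝ} (h : 𝓑.Dom Φ M) (hΨ : ∀ y, Ψ y ≤ Φ y)
    (hN : M ≤ N) : 𝓑.Dom Ψ N := h.mono_ae (Eventually.of_forall hΨ) hN

lemma Dom.zero : 𝓑.Dom (fun _ => 0) 0 :=
  ⟨0, by simp, fun _ => 0, measurable_const, by simpa using Rep.zero, by simp⟩

lemma Dom.add {Φ Ψ : G → ℝ≥0∞} {M N : ℝ} (h : 𝓑.Dom Φ M) (h' : 𝓑.Dom Ψ N) :
    𝓑.Dom (fun y => Φ y + Ψ y) (M + N) := by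
  obtain ⟨g, hg, g₀, hm, hr, hle⟩ := h
  obtain ⟨g', hg', g₀', hm', hr', hle'⟩ := h'
  refine ⟨g + g', (norm_add_le _ _).trans (add_le_add hg hg'), fun y => g₀ y + g₀' y, hm.add hm',
    ?_, ?_⟩
  · simpa using hr.add hr'
  · filter_upwards [hle, hle'] with y h1 h2
    rw [ENNReal.coe_add]
    exact add_le_add h1 h2

lemma Dom.const_mul {Φ : G → ℝ≥0∞} {M : ℝ} (c : ℝ≥0) (h : 𝓑.Dom Φ M) :
    𝓑.Dom (fun y => c * Φ y) (c * M) := by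
  obtain ⟨g, hg, g₀, hm, hr, hle⟩ := h
  refine ⟨((c : ℝ) : ℂ) • g, ?_, fun y => c * g₀ y, hm.const_mul c, ?_, ?_⟩
  · rw [norm_smul, Complex.norm_real, NNReal.norm_eq]
    exact mul_le_mul_of_nonneg_left hg c.2
  · simpa using hr.smul ((c : ℝ) : ℂ)
  · filter_upwards [hle] with y h1
    rw [ENNReal.coe_mul]
    exact mul_le_mul_right h1 _

variable [CompleteSpace B] [SigmaCompactSpace G]

/-- A constant comparing the norms of functions with comparable absolute values. -/
noncomputable def Solid.const (hs : 𝓑.Solid) : ℝ := (exists_solid_const hs).choose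

lemma Solid.const_pos (hs : 𝓑.Solid) : 0 < hs.const := (exists_solid_const hs).choose_spec.1

lemma Solid.norm_le (hs : 𝓑.Solid) {f g : B} {f₀ g₀ : G → ℂ} (hf : 𝓑.Rep f f₀)
    (hg : 𝓑.Rep g g₀) (h : ∀ᵐ x ∂μ, ‖f₀ x‖ ≤ ‖g₀ x‖) : ‖f‖ ≤ hs.const * ‖g‖ := by
  refine (exists_solid_const hs).choose_spec.2 f g ?_
  filter_upwards [hf, hg, h] with x h1 h2 h3
  rwa [h1, h2]

lemma Solid.exists_rep (hs : 𝓑.Solid) {g : B} {f₀ g₀ : G → ℂ} (hg : 𝓑.Rep g g₀)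
    (hf : AEStronglyMeasurable f₀ μ) (h : ∀ᵐ x ∂μ, ‖f₀ x‖ ≤ ‖g₀ x‖) :
    ∃ f : B, 𝓑.Rep f f₀ ∧ ‖f‖ ≤ hs.const * ‖g‖ := by
  obtain ⟨f, hfr⟩ := hs g f₀ hf (by
    filter_upwards [hg, h] with x h1 h2
    rwa [h1])
  exact ⟨f, hfr, hs.norm_le hfr hg h⟩

lemma Solid.dom (hs : 𝓑.Solid) {f : B} {f₀ : G → ℂ} (hf : 𝓑.Rep f f₀) :
    𝓑.Dom (fun y => ‖f₀ y‖ₑ) (hs.const * ‖f‖) := by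
  have hm := (𝓑.toAE f).aestronglyMeasurable
  obtain ⟨g, hg, hgn⟩ := hs.exists_rep (𝓑.rep_self f)
    (f₀ := fun y => ((‖hm.mk _ y‖₊ : ℝ) : ℂ))
    (Complex.continuous_ofReal.comp_aestronglyMeasurable
      (hm.stronglyMeasurable_mk.norm.aestronglyMeasurable)) (by
      filter_upwards [hm.ae_eq_mk] with y hy
      simp [← hy])
  refine ⟨g, hgn, fun y => ‖hm.mk _ y‖₊, hm.stronglyMeasurable_mk.measurable.nnnorm, hg, ?_⟩
  filter_upwards [hm.ae_eq_mk, hf] with y h1 h2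
  rw [← h2, h1]; exact le_rfl

lemma Dom.exists_rep (hs : 𝓑.Solid) {Φ : G → ℝ≥0∞} {M : ℝ} (h : 𝓑.Dom Φ M) {f₀ : G → ℂ}
    (hf : AEStronglyMeasurable f₀ μ) (hle : ∀ᵐ y ∂μ, ‖f₀ y‖ₑ ≤ Φ y) :
    ∃ f : B, 𝓑.Rep f f₀ ∧ ‖f‖ ≤ hs.const * M := by
  obtain ⟨g, hg, g₀, hm, hr, hle'⟩ := h
  obtain ⟨f, h1, h2⟩ := hs.exists_rep hr hf (by
    filter_upwards [hle, hle'] with y h1 h2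
    have := h1.trans h2
    rw [Complex.norm_real, NNReal.norm_eq]
    rw [enorm_eq_nnnorm] at this
    exact_mod_cast this)
  exact ⟨f, h1, h2.trans (mul_le_mul_of_nonneg_left hg hs.const_pos.le)⟩

/-- The elements of the BF-space are locally integrable, with bounds by the norm. -/
def LocInt (𝓑 : BFSpace μ B) : Prop :=
  ∀ K : Set G, IsCompact K → ∃ C : ℝ, 0 ≤ C ∧ ∀ f : B,
    ∫⁻ y in K, ‖𝓑.toAE f y‖ₑ ∂μ ≤ ENNReal.ofReal (C * ‖f‖)

lemma LocInt.integrableOn (h : 𝓑.LocInt) {A K : Set G} (hK : IsCompact K) (hA : A ⊆ K) (f : B) :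
    IntegrableOn (𝓑.toAE f) A μ := by
  obtain ⟨C, -, hC⟩ := h K hK
  refine IntegrableOn.mono_set ⟨(𝓑.toAE f).aestronglyMeasurable.restrict, ?_⟩ hA
  exact (hC f).trans_lt ENNReal.ofReal_lt_top

/-- Integration over a relatively compact set as a continuous functional. -/
lemma LocInt.exists_functional (h : 𝓑.LocInt) {A K : Set G} (hK : IsCompact K) (hA : A ⊆ K) :
    ∃ L : B →L[ℂ] ℂ, ∀ f, L f = ∫ y in A, 𝓑.toAE f y ∂μ := by
  obtain ⟨C, hC0, hC⟩ := h K hK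
  let L : B →ₗ[ℂ] ℂ :=
    { toFun := fun f => ∫ y in A, 𝓑.toAE f y ∂μ
      map_add' := fun f g => by
        rw [← integral_add (h.integrableOn hK hA f) (h.integrableOn hK hA g)]
        exact integral_congr_ae (ae_restrict_of_ae ((𝓑.rep_self f).add (𝓑.rep_self g)))
      map_smul' := fun c f => by
        rw [RingHom.id_apply, smul_eq_mul, ← integral_const_mul]
        exact integral_congr_ae (ae_restrict_of_ae ((𝓑.rep_self f).smul c)) }
  refine ⟨L.mkContinuous C fun f => ?_, fun f => rfl⟩
  refine (norm_integral_le_lintegral_norm _).trans ?_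
  refine ENNReal.toReal_le_of_le_ofReal (by positivity) ?_
  simp only [ofReal_norm]
  exact (lintegral_mono_set hA).trans (hC f)

end BFSpace
end Dominated

section Convolution

variable {G : Type*} [TopologicalSpace G] [Group G] [IsTopologicalGroup G] [T2Space G]
  [LocallyCompactSpace G] [SecondCountableTopology G] [MeasurableSpace G] [BorelSpace G]
  {μ : Measure G} [μ.IsHaarMeasure]
  {B : Type*} [NormedAddCommGroup B] [NormedSpace ℂ B] [CompleteSpace B] {𝓑 : BFSpace μ B}

lemma trivCocycle_twR (y : G) (f : G → ℂ) (x : G) : twR trivCocycle y f x = f (x * y) := by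
  simp [twR, trivCocycle]

lemma ae_mul_right {p : G → Prop} (h : ∀ᵐ y ∂μ, p y) (w : G) : ∀ᵐ y ∂μ, p (y * w) :=
  (quasiMeasurePreserving_mul_right μ w).ae h

/-- A property that holds almost everywhere holds at almost every point after almost every right
translation. -/
lemma ae_ae_mul_right {p : G → Prop} (h : ∀ᵐ y ∂μ, p y) (θ : Measure G) [SFinite θ] :
    ∀ᵐ y ∂μ, ∀ᵐ w ∂θ, p (y * w) := by
  obtain ⟨N, hN, hNm, hN0⟩ := exists_measurable_superset_of_null (show μ {y | ¬ p y} = 0 from h)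
  have hm : MeasurableSet {q : G × G | q.1 * q.2 ∉ N} :=
    (measurable_fst.mul measurable_snd) hNm.compl
  have h1 : ∀ᵐ w ∂θ, ∀ᵐ y ∂μ, y * w ∉ N := Eventually.of_forall fun w =>
    ae_mul_right (p := fun y => y ∉ N) (measure_eq_zero_iff_ae_notMem.1 hN0) w
  have h2 := (Measure.ae_ae_comm (μ := θ) (ν := μ) (p := fun w y => y * w ∉ N)
    (hm.preimage measurable_swap)).1 h1
  filter_upwards [h2] with y hy
  filter_upwards [hy] with w hw
  by_contra hp
  exact hw (hN hp)

namespace BFSpace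

lemma exists_translate (hs : 𝓑.Solid) {σ : G → G → Circle} (hR : 𝓑.BddTransl (twR σ))
    (hcR : 𝓑.ContTransl (twR trivCocycle)) {K : Set G} (hK : IsCompact K) :
    ∃ C : ℝ, 0 ≤ C ∧ ∀ f : B, ∃ L : G → B, Continuous L ∧
      (∀ w, 𝓑.Rep (L w) (fun y => 𝓑.toAE f (y * w))) ∧ ∀ w ∈ K, ‖L w‖ ≤ C * ‖f‖ := by
  obtain ⟨hR1, hR2⟩ := hR
  obtain ⟨C, hC⟩ := hR2 K hK
  refine ⟨hs.const * max C 0, mul_nonneg hs.const_pos.le (le_max_right _ _), fun f => ?_⟩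
  obtain ⟨L, hL, hLc⟩ := hcR f
  have hL' : ∀ w, 𝓑.Rep (L w) (fun y => 𝓑.toAE f (y * w)) := fun w =>
    (hL w).congr (Eventually.of_forall fun y => trivCocycle_twR w _ y)
  refine ⟨L, hLc, hL', fun w hw => ?_⟩
  obtain ⟨g, hg⟩ := hR1 w f
  refine (hs.norm_le (hL' w) hg (Eventually.of_forall fun y => ?_)).trans ?_
  · rw [twR, norm_circle_mul]
  · rw [mul_assoc]
    refine mul_le_mul_of_nonneg_left ?_ hs.const_pos.le
    refine (hC w hw f g hg).trans ?_
    gcongr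
    exact le_max_left _ _

/-- Domination is preserved by right averages over a compact set. The average is a Bochner integral
of translates, identified by testing with integrals over relatively compact sets. -/
theorem exists_dom_average (hs : 𝓑.Solid) (hI : 𝓑.LocInt) {σ : G → G → Circle}
    (hR : 𝓑.BddTransl (twR σ)) (hcR : 𝓑.ContTransl (twR trivCocycle)) {K : Set G}
    (hK : IsCompact K) : ∃ C : ℝ, 0 ≤ C ∧ ∀ (θ : Measure G) [IsFiniteMeasure θ], θ Kᶜ = 0 →
      ∀ Φ M, 𝓑.Dom Φ M →
        𝓑.Dom (fun y => ∫⁻ w, Φ (y * w) ∂θ) (C * (θ univ).toReal * M) := by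
  obtain ⟨C, hC0, hC⟩ := exists_translate hs hR hcR hK
  refine ⟨hs.const * C, mul_nonneg hs.const_pos.le hC0, fun θ _ hθ Φ M hΦ => ?_⟩
  obtain ⟨g, hg, g₀, hm, hr, hle⟩ := hΦ
  obtain ⟨L, hLc, hL, hLK⟩ := hC g
  have hL' : ∀ w, 𝓑.Rep (L w) (fun y => ((g₀ (y * w) : ℝ) : ℂ)) := fun w => by
    refine (hL w).congr ?_
    filter_upwards [ae_mul_right hr w] with y hy using hy
  have hLi : Integrable L θ := by
    refine Integrable.of_bound hLc.aestronglyMeasurable (C * ‖g‖) ?_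
    filter_upwards [mem_ae_iff.2 hθ] with w hw using hLK w hw
  set b : B := ∫ w, L w ∂θ with hb
  have hbn : ‖b‖ ≤ C * (θ univ).toReal * M := by
    refine (norm_integral_le_of_norm_le_const (C := C * ‖g‖) ?_).trans ?_
    · filter_upwards [mem_ae_iff.2 hθ] with w hw using hLK w hw
    · rw [Measure.real]
      calc C * ‖g‖ * (θ univ).toReal = C * (θ univ).toReal * ‖g‖ := by ring
        _ ≤ _ := mul_le_mul_of_nonneg_left hg (by positivity)
  have hgm : Measurable fun q : G × G => (g₀ (q.1 * q.2) : ℝ≥0∞) :=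
    (hm.comp (measurable_fst.mul measurable_snd)).coe_nnreal_ennreal
  have hΨm : Measurable fun y => ∫⁻ w, (g₀ (y * w) : ℝ≥0∞) ∂θ := hgm.lintegral_prod_right'
  -- the Bochner integral `b` dominates the pointwise average: integration over a relatively compact
  -- set is a continuous functional, so it commutes with the Bochner integral
  have key : ∀ᵐ y ∂μ, ∫⁻ w, (g₀ (y * w) : ℝ≥0∞) ∂θ ≤ ‖𝓑.toAE b y‖ₑ := by
    refine ae_of_forall_isCompact fun Q hQ => ?_
    have : IsFiniteMeasure (μ.restrict Q) := ⟨by simpa using hQ.measure_lt_top⟩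
    refine ae_le_of_forall_setLIntegral_le_of_sigmaFinite hΨm fun A hA _ => ?_
    rw [Measure.restrict_restrict hA]
    obtain ⟨ℓ, hℓ⟩ := hI.exists_functional hQ (inter_subset_right (s := A))
    have h1 : ∀ w, ∫⁻ y in A ∩ Q, (g₀ (y * w) : ℝ≥0∞) ∂μ = ENNReal.ofReal (ℓ (L w)).re ∧
        0 ≤ (ℓ (L w)).re := fun w => by
      have hint : IntegrableOn (fun y => ((g₀ (y * w) : ℝ) : ℂ)) (A ∩ Q) μ :=
        (hI.integrableOn hQ inter_subset_right (L w)).congr (ae_restrict_of_ae (hL' w))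
      have h2 : ℓ (L w) = ((∫ y in A ∩ Q, (g₀ (y * w) : ℝ) ∂μ : ℝ) : ℂ) := by
        rw [hℓ, integral_congr_ae (ae_restrict_of_ae (hL' w))]
        exact integral_ofReal
      have hint' : Integrable (fun y => (g₀ (y * w) : ℝ)) (μ.restrict (A ∩ Q)) := hint.re
      rw [h2, Complex.ofReal_re, ofReal_integral_eq_lintegral_ofReal hint'
        (Eventually.of_forall fun y => (g₀ (y * w)).2)]
      refine ⟨by simp, integral_nonneg fun y => (g₀ (y * w)).2⟩
    have h3 : ℓ b = ∫ w, ℓ (L w) ∂θ := (ℓ.integral_comp_comm hLi).symm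
    have h4 : (ℓ b).re = ∫ w, (ℓ (L w)).re ∂θ := by
      rw [h3]; exact (integral_re (ℓ.integrable_comp hLi)).symm
    calc ∫⁻ y in A ∩ Q, ∫⁻ w, (g₀ (y * w) : ℝ≥0∞) ∂θ ∂μ
        = ∫⁻ w, ∫⁻ y in A ∩ Q, (g₀ (y * w) : ℝ≥0∞) ∂μ ∂θ :=
          lintegral_lintegral_swap hgm.aemeasurable
      _ = ∫⁻ w, ENNReal.ofReal (ℓ (L w)).re ∂θ := lintegral_congr fun w => (h1 w).1
      _ = ENNReal.ofReal (ℓ b).re := by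
          have hre : Integrable (fun w => (ℓ (L w)).re) θ := (ℓ.integrable_comp hLi).re
          rw [h4, ofReal_integral_eq_lintegral_ofReal hre
            (Eventually.of_forall fun w => (h1 w).2)]
      _ ≤ ENNReal.ofReal ‖ℓ b‖ := ENNReal.ofReal_le_ofReal (Complex.re_le_norm _)
      _ ≤ ∫⁻ y in A ∩ Q, ‖𝓑.toAE b y‖ₑ ∂μ := by
          rw [ofReal_norm, hℓ]
          exact enorm_integral_le_lintegral_enorm _
  refine (hs.dom (𝓑.rep_self b)).mono_ae ?_ ?_
  · filter_upwards [key, ae_ae_mul_right hle θ] with y h1 h2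
    exact (lintegral_mono_ae h2).trans h1
  · calc hs.const * ‖b‖ ≤ hs.const * (C * (θ univ).toReal * M) :=
          mul_le_mul_of_nonneg_left hbn hs.const_pos.le
      _ = _ := by ring

lemma BddAbsConv.domConv (hs : 𝓑.Solid) {k : G → ℂ} (h : 𝓑.BddAbsConv k) :
    𝓑.DomConv (fun x => ‖k x‖ₑ) := by
  obtain ⟨C, hC⟩ := h
  refine ⟨hs.const * max C 0, mul_nonneg hs.const_pos.le (le_max_right _ _), fun Φ M hΦ => ?_⟩
  obtain ⟨g, hg, g₀, hm, hr, hle⟩ := hΦ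
  obtain ⟨hex, b, hb, hbn⟩ := hC g
  have hbn' : hs.const * ‖b‖ ≤ hs.const * max C 0 * M := by
    rw [mul_assoc]
    refine mul_le_mul_of_nonneg_left (hbn.trans ?_) hs.const_pos.le
    exact mul_le_mul (le_max_left _ _) hg (norm_nonneg _) (le_max_right _ _)
  refine (hs.dom hb).mono_ae ?_ hbn'
  filter_upwards [hex] with z hz
  have h1 : (fun y => 𝓑.toAE g y * twL trivCocycle y (fun z => (‖k z‖ : ℂ)) z) =ᵐ[μ]
      fun y => (((g₀ y : ℝ) * ‖k (y⁻¹ * z)‖ : ℝ) : ℂ) := by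
    filter_upwards [hr] with y hy
    rw [hy]; simp [twL, trivCocycle]
  have hi : Integrable (fun y => (g₀ y : ℝ) * ‖k (y⁻¹ * z)‖) μ := by
    have : Integrable (fun y => (((g₀ y : ℝ) * ‖k (y⁻¹ * z)‖ : ℝ) : ℂ)) μ := hz.congr h1
    exact this.re
  rw [twConv, integral_congr_ae h1]
  have h2 : ∫ y, (((g₀ y : ℝ) * ‖k (y⁻¹ * z)‖ : ℝ) : ℂ) ∂μ =
    ((∫ y, (g₀ y : ℝ) * ‖k (y⁻¹ * z)‖ ∂μ : ℝ) : ℂ) := integral_ofReal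
  have h0 : 0 ≤ ∫ y, (g₀ y : ℝ) * ‖k (y⁻¹ * z)‖ ∂μ :=
    integral_nonneg fun y => mul_nonneg (g₀ y).2 (norm_nonneg _)
  rw [h2, ← ofReal_norm, Complex.norm_real, Real.norm_of_nonneg h0,
    ofReal_integral_eq_lintegral_ofReal hi (Eventually.of_forall fun y =>
      mul_nonneg (g₀ y).2 (norm_nonneg _))]
  refine lintegral_mono_ae ?_
  filter_upwards [hle] with y hy
  rw [ENNReal.ofReal_mul (NNReal.coe_nonneg _), ofReal_norm, ENNReal.ofReal_coe_nnreal]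
  exact mul_le_mul_left hy _

lemma DomConv.mono {m m' : G → ℝ≥0∞} (h : 𝓑.DomConv m) (hm : ∀ x, m' x ≤ m x) :
    𝓑.DomConv m' := by
  obtain ⟨C, hC0, hC⟩ := h
  exact ⟨C, hC0, fun Φ M hΦ => (hC Φ M hΦ).mono
    (fun z => lintegral_mono fun y => mul_le_mul_right (hm _) _) le_rfl⟩

lemma DomConv.zero : 𝓑.DomConv (fun _ => 0) :=
  ⟨0, le_rfl, fun Φ M _ => by simpa using Dom.zero⟩

lemma DomConv.add {m m' : G → ℝ≥0∞} (h : 𝓑.DomConv m) (h' : 𝓑.DomConv m')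
    (hm : Measurable m) : 𝓑.DomConv (fun x => m x + m' x) := by
  obtain ⟨C, hC0, hC⟩ := h
  obtain ⟨C', hC0', hC'⟩ := h'
  refine ⟨C + C', add_nonneg hC0 hC0', fun Φ M hΦ => ?_⟩
  obtain ⟨g, hg, g₀, hgm, hr, hle⟩ := hΦ
  have hg' : 𝓑.Dom (fun y => (g₀ y : ℝ≥0∞)) M :=
    ⟨g, hg, g₀, hgm, hr, Eventually.of_forall fun _ => le_rfl⟩
  refine ((hC _ M hg').add (hC' _ M hg')).mono (fun z => ?_) (by rw [add_mul])
  have hmeas : Measurable fun y => (g₀ y : ℝ≥0∞) * m (y⁻¹ * z) :=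
    hgm.coe_nnreal_ennreal.mul (hm.comp (measurable_inv.mul_const z))
  rw [← lintegral_add_left hmeas]
  refine lintegral_mono_ae ?_
  filter_upwards [hle] with y hy
  rw [← mul_add]
  exact mul_le_mul_left hy _

lemma DomConv.sum {ι : Type*} (s : Finset ι) {m : ι → G → ℝ≥0∞}
    (h : ∀ i ∈ s, 𝓑.DomConv (m i)) (hm : ∀ i ∈ s, Measurable (m i)) :
    𝓑.DomConv (fun x => ∑ i ∈ s, m i x) := by
  classical
  induction s using Finset.induction_on with
  | empty => simpa using DomConv.zero
  | insert i s hi ih =>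
    have := (h i (Finset.mem_insert_self i s)).add
      (ih (fun j hj => h j (Finset.mem_insert_of_mem hj))
        fun j hj => hm j (Finset.mem_insert_of_mem hj)) (hm i (Finset.mem_insert_self i s))
    simpa [Finset.sum_insert hi] using this

end BFSpace

/-- Right translations multiply Haar measure by a factor that is measurable and locally bounded. -/
lemma exists_right_modulus (μ : Measure G) [μ.IsHaarMeasure] :
    ∃ c : G → ℝ≥0, Measurable c ∧ (∀ K, IsCompact K → ∃ D : ℝ≥0, ∀ g ∈ K, c g ≤ D) ∧
      ∀ (g : G) (F : G → ℝ≥0∞), Measurable F → ∫⁻ y, F (y * g) ∂μ = c g * ∫⁻ y, F y ∂μ := by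
  set c : G → ℝ≥0 := fun g => Measure.haarScalarFactor (μ.map (· * g)) μ with hc
  have hmap : ∀ g, μ.map (· * g) = c g • μ := fun g => Measure.isMulLeftInvariant_eq_smul _ _
  obtain ⟨W, hW, hWn⟩ := exists_compact_mem_nhds (1 : G)
  have hW0 : μ W ≠ 0 := (Measure.measure_pos_of_mem_nhds μ hWn).ne'
  have hWt : μ W ≠ ⊤ := hW.measure_lt_top.ne
  have hval : ∀ g, (c g : ℝ≥0∞) * μ W = μ ((· * g) ⁻¹' W) := fun g => by
    rw [← Measure.map_apply (measurable_mul_const g) hW.measurableSet, hmap g]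
    rfl
  have hval' : ∀ g, (c g : ℝ≥0∞) = μ ((· * g) ⁻¹' W) / μ W := fun g => by
    rw [← hval, ENNReal.mul_div_cancel_right hW0 hWt]
  refine ⟨c, ?_, fun K hK => ?_, fun g F hF => ?_⟩
  · rw [← measurable_coe_nnreal_ennreal_iff]
    simp only [hval']
    refine Measurable.div_const ?_ _
    have hS : MeasurableSet {q : G × G | q.2 * q.1 ∈ W} :=
      (measurable_snd.mul measurable_fst) hW.measurableSet
    exact measurable_measure_prodMk_left hS
  · refine ⟨(μ (W * K⁻¹) / μ W).toNNReal, fun g hg => ?_⟩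
    have hfin : μ (W * K⁻¹) / μ W ≠ ⊤ :=
      ENNReal.div_ne_top (hW.mul hK.inv).measure_lt_top.ne hW0
    rw [← ENNReal.coe_le_coe, ENNReal.coe_toNNReal hfin, hval']
    gcongr
    intro y hy
    exact ⟨y * g, hy, g⁻¹, by simpa using hg, by simp⟩
  · rw [← lintegral_map hF (measurable_mul_const g), hmap g]
    exact lintegral_smul_measure _ _

namespace BFSpace

/-- Domination is preserved by convolution with a left average of `m` over a compact set: moving the
average to the other factor makes it a right average. -/
theorem DomConv.exists_left_average (hs : 𝓑.Solid) (hI : 𝓑.LocInt) {σ : G → G → Circle}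
    (hR : 𝓑.BddTransl (twR σ)) (hcR : 𝓑.ContTransl (twR trivCocycle)) {m : G → ℝ≥0∞}
    (hm : 𝓑.DomConv m) (hmm : Measurable m) {K : Set G} (hK : IsCompact K) :
    ∃ C : ℝ, 0 ≤ C ∧ ∀ (θ : Measure G) [IsFiniteMeasure θ], θ Kᶜ = 0 → ∀ Φ M, 𝓑.Dom Φ M →
      𝓑.Dom (fun z => ∫⁻ y, Φ y * ∫⁻ g, m (g⁻¹ * (y⁻¹ * z)) ∂θ ∂μ)
        (C * (θ univ).toReal * M) := by
  obtain ⟨c, hcm, hcK, hc⟩ := exists_right_modulus μ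
  obtain ⟨D, hD⟩ := hcK K hK
  obtain ⟨C₁, hC₁0, hC₁⟩ := exists_dom_average hs hI hR hcR hK.inv
  obtain ⟨C₂, hC₂0, hC₂⟩ := hm
  refine ⟨C₂ * (C₁ * D), by positivity, fun θ _ hθ Φ M hΦ => ?_⟩
  obtain ⟨g, hg, g₀, hgm, hr, hle⟩ := hΦ
  have hg' : 𝓑.Dom (fun y => (g₀ y : ℝ≥0∞)) M :=
    ⟨g, hg, g₀, hgm, hr, Eventually.of_forall fun _ => le_rfl⟩
  have hM := hg'.nonneg
  -- the substitution `y ↦ yg⁻¹` produces the modulus `c g`, absorbed into `θ₁`, and a right average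
  -- with respect to the image `θ₂` of `θ₁` under inversion
  set θ₁ : Measure G := (θ.withDensity fun g => (c g : ℝ≥0∞)) with hθ₁
  have hθ₁le : θ₁ univ ≤ D * θ univ := by
    rw [hθ₁, withDensity_apply _ MeasurableSet.univ, Measure.restrict_univ, ← lintegral_const]
    refine lintegral_mono_ae ?_
    filter_upwards [mem_ae_iff.2 hθ] with g hg
    exact_mod_cast hD g hg
  have hθ₁fin : IsFiniteMeasure θ₁ :=
    ⟨hθ₁le.trans_lt (ENNReal.mul_lt_top ENNReal.coe_lt_top (measure_lt_top θ _))⟩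
  set θ₂ : Measure G := θ₁.map (·⁻¹) with hθ₂
  have hθ₂0 : θ₂ (K⁻¹)ᶜ = 0 := by
    rw [hθ₂, Measure.map_apply measurable_inv hK.inv.measurableSet.compl]
    refine withDensity_absolutelyContinuous θ _ (measure_mono_null ?_ hθ)
    intro g hg; simpa using hg
  have hθ₂u : (θ₂ univ).toReal ≤ D * (θ univ).toReal := by
    rw [hθ₂, Measure.map_apply measurable_inv MeasurableSet.univ, preimage_univ]
    refine (ENNReal.toReal_mono ?_ hθ₁le).trans (by rw [ENNReal.toReal_mul]; simp)
    exact (ENNReal.mul_lt_top ENNReal.coe_lt_top (measure_lt_top θ _)).ne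
  have key := hC₂ _ _ (hC₁ θ₂ hθ₂0 _ M hg')
  refine key.mono (fun z => ?_) ?_
  · calc ∫⁻ y, Φ y * ∫⁻ g, m (g⁻¹ * (y⁻¹ * z)) ∂θ ∂μ
        ≤ ∫⁻ y, ∫⁻ g, g₀ y * m (g⁻¹ * (y⁻¹ * z)) ∂θ ∂μ := by
          refine lintegral_mono_ae ?_
          filter_upwards [hle] with y hy
          have hmeas : Measurable fun g => m (g⁻¹ * (y⁻¹ * z)) :=
            hmm.comp (measurable_inv.mul_const _)
          rw [lintegral_const_mul _ hmeas]
          exact mul_le_mul_left hy _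
      _ = ∫⁻ g, ∫⁻ y, g₀ y * m (g⁻¹ * (y⁻¹ * z)) ∂μ ∂θ := by
          refine lintegral_lintegral_swap (Measurable.aemeasurable ?_)
          exact (hgm.comp measurable_fst).coe_nnreal_ennreal.mul
            (hmm.comp (measurable_snd.inv.mul (measurable_fst.inv.mul_const z)))
      _ = ∫⁻ g, c g * ∫⁻ y, g₀ (y * g⁻¹) * m (y⁻¹ * z) ∂μ ∂θ := by
          refine lintegral_congr fun g => ?_
          have hmeas : Measurable fun y => (g₀ (y * g⁻¹) : ℝ≥0∞) * m (y⁻¹ * z) :=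
            (hgm.comp (measurable_mul_const _)).coe_nnreal_ennreal.mul
              (hmm.comp (measurable_inv.mul_const z))
          rw [← hc g _ hmeas]
          simp [mul_assoc]
      _ = ∫⁻ g, ∫⁻ y, g₀ (y * g⁻¹) * m (y⁻¹ * z) ∂μ ∂θ₁ := by
          rw [hθ₁, lintegral_withDensity_eq_lintegral_mul _ hcm.coe_nnreal_ennreal]
          · rfl
          · refine Measurable.lintegral_prod_right' (f := fun q : G × G =>
              (g₀ (q.2 * q.1⁻¹) : ℝ≥0∞) * m (q.2⁻¹ * z)) ?_
            exact (hgm.comp (measurable_snd.mul measurable_fst.inv)).coe_nnreal_ennreal.mul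
              (hmm.comp (measurable_snd.inv.mul_const z))
      _ = ∫⁻ y, ∫⁻ g, g₀ (y * g⁻¹) * m (y⁻¹ * z) ∂θ₁ ∂μ := by
          refine lintegral_lintegral_swap (Measurable.aemeasurable ?_)
          exact (hgm.comp (measurable_snd.mul measurable_fst.inv)).coe_nnreal_ennreal.mul
            (hmm.comp (measurable_snd.inv.mul_const z))
      _ ≤ ∫⁻ y, (∫⁻ w, g₀ (y * w) ∂θ₂) * m (y⁻¹ * z) ∂μ := by
          refine lintegral_mono fun y => ?_
          have hm₁ : Measurable fun w => (g₀ (y * w) : ℝ≥0∞) :=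
            (hgm.comp (measurable_const_mul y)).coe_nnreal_ennreal
          have hm₂ : Measurable fun g => (g₀ (y * g⁻¹) : ℝ≥0∞) :=
            (hgm.comp (measurable_inv.const_mul y)).coe_nnreal_ennreal
          rw [hθ₂, lintegral_map hm₁ measurable_inv, lintegral_mul_const _ hm₂]
  · calc C₂ * (C₁ * (θ₂ univ).toReal * M) ≤ C₂ * (C₁ * (D * (θ univ).toReal) * M) := by gcongr
      _ = _ := by ring

/-- A nonzero solid translation-invariant BF-space contains the indicator functions of compact
sets. -/
lemma exists_dom_indicator [Nontrivial B] (hs : 𝓑.Solid) (hI : 𝓑.LocInt)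
    {σ : G → G → Circle} (hR : 𝓑.BddTransl (twR σ)) (hcR : 𝓑.ContTransl (twR trivCocycle))
    {K : Set G} (hK : IsCompact K) : ∃ M, 𝓑.Dom (K.indicator fun _ => 1) M := by
  obtain ⟨f, hf⟩ := exists_ne (0 : B)
  obtain ⟨g, hg, g₀, hgm, hr, hle⟩ := hs.dom (𝓑.rep_self f)
  have hg' : 𝓑.Dom (fun y => (g₀ y : ℝ≥0∞)) (hs.const * ‖f‖) :=
    ⟨g, hg, g₀, hgm, hr, Eventually.of_forall fun _ => le_rfl⟩
  -- a compact set on which `f` is not almost everywhere zero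
  obtain ⟨Q, hQ, hQ0⟩ : ∃ Q, IsCompact Q ∧ ∫⁻ y in Q, (g₀ y : ℝ≥0∞) ∂μ ≠ 0 := by
    by_contra! hcon
    refine hf ((𝓑.rep_self f).unique (Rep.zero.congr ?_))
    refine ae_of_forall_isCompact fun Q hQ => ?_
    have h0 := (lintegral_eq_zero_iff hgm.coe_nnreal_ennreal).1 (hcon Q hQ)
    filter_upwards [h0, ae_restrict_of_ae hle] with y h1 h2
    have h3 : ‖𝓑.toAE f y‖ₑ = 0 := le_antisymm (h2.trans h1.le) zero_le
    exact (enorm_eq_zero.1 h3).symm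
  obtain ⟨C, hC0, hC⟩ := exists_dom_average hs hI hR hcR (hK.inv.mul hQ)
  have : IsFiniteMeasure (μ.restrict (K⁻¹ * Q)) :=
    ⟨by simpa using (hK.inv.mul hQ).measure_lt_top⟩
  have h1 := hC (μ.restrict (K⁻¹ * Q)) (by
    rw [Measure.restrict_apply (hK.inv.mul hQ).measurableSet.compl]; simp) _ _ hg'
  -- the average of `g₀` over translations in `K⁻¹Q` is at least its integral over `Q`, on all of `K`
  set I := ∫⁻ y in Q, (g₀ y : ℝ≥0∞) ∂μ with hIdef
  have hIle : ∀ y ∈ K, I ≤ ∫⁻ w, (g₀ (y * w) : ℝ≥0∞) ∂(μ.restrict (K⁻¹ * Q)) := by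
    intro y hy
    rw [hIdef, ← lintegral_indicator hQ.measurableSet,
      ← lintegral_mul_left_eq_self _ y,
      ← lintegral_indicator (hK.inv.mul hQ).measurableSet]
    refine lintegral_mono fun w => ?_
    by_cases hw : y * w ∈ Q
    · have : w ∈ K⁻¹ * Q := ⟨y⁻¹, by simpa using hy, y * w, hw, by simp⟩
      rw [indicator_of_mem hw, indicator_of_mem this]
    · rw [indicator_of_notMem hw]; exact zero_le
  -- the minimum with `1` is a positive finite lower bound even if `I` is infinite
  have hIm : min I 1 ≠ 0 := by
    rcases min_choice I 1 with h | h <;> rw [h]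
    exacts [hQ0, one_ne_zero]
  have hIt : min I 1 ≠ ⊤ := ((min_le_right I 1).trans_lt ENNReal.one_lt_top).ne
  refine ⟨_, (h1.const_mul (min I 1)⁻¹.toNNReal).mono (fun y => ?_) le_rfl⟩
  by_cases hy : y ∈ K
  · rw [indicator_of_mem hy, ENNReal.coe_toNNReal (ENNReal.inv_ne_top.2 hIm)]
    calc (1 : ℝ≥0∞) = (min I 1)⁻¹ * min I 1 := (ENNReal.inv_mul_cancel hIm hIt).symm
      _ ≤ _ := mul_le_mul_right ((min_le_left _ _).trans (hIle y hy)) _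
  · rw [indicator_of_notMem hy]; exact zero_le

end BFSpace
end Convolution

/-! ### Local integrability from the pairing -/

section PairingBound

variable {G S : Type*} [TopologicalSpace G] [Group G] [IsTopologicalGroup G] [T2Space G]
  [LocallyCompactSpace G] [SecondCountableTopology G] [MeasurableSpace G] [BorelSpace G]
  [AddCommGroup S] [Module ℂ S] [TopologicalSpace S]
  {μ : Measure G} {B : Type*} [NormedAddCommGroup B] [NormedSpace ℂ B] [CompleteSpace B]
  {ρ : ProjRep G S} {j : S →ₗ[ℂ] (S →L⋆[ℂ] ℂ)} {𝓑 : BFSpace μ B} {u : S}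

namespace CoorbitAssumption

/-- The pairing with a vector converges absolutely with a bound by the norm: solidity allows the
phase of `f` to be changed. -/
lemma exists_lintegral_pairing_le (hc : CoorbitAssumption ρ j 𝓑 u) (hs : 𝓑.Solid) (v : S) :
    ∃ C : ℝ, 0 ≤ C ∧ ∀ f : B,
      ∫⁻ y, ‖𝓑.toAE f y‖ₑ * ‖ρ.dual y (j u) v‖ₑ ∂μ ≤ ENNReal.ofReal (C * ‖f‖) := by
  obtain ⟨C, hC0, hC⟩ := hc.exists_synth_bound v
  refine ⟨C * hs.const, mul_nonneg hC0 hs.const_pos.le, fun f => ?_⟩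
  set h : G → ℂ := fun y => 𝓑.toAE f y * ρ.dual y (j u) v with hh
  have hi : Integrable h μ := hc.integrable_pairing f v
  -- the phase of the integrand is absorbed into `f`
  set s : G → ℂ := fun y => conj (h y) / (‖h y‖ : ℂ) with hsdef
  have hs1 : ∀ y, ‖s y‖ ≤ 1 := fun y => by
    rw [hsdef, norm_div, RCLike.norm_conj, Complex.norm_real, norm_norm]
    exact div_self_le_one _
  have hsh : ∀ y, s y * h y = ((‖h y‖ : ℝ) : ℂ) := fun y => by
    by_cases h0 : h y = 0
    · simp [h0]
    · have h1 : (‖h y‖ : ℂ) ≠ 0 := by simpa using h0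
      rw [hsdef, div_mul_eq_mul_div, div_eq_iff h1, mul_comm, Complex.mul_conj, ← sq,
        Complex.normSq_eq_norm_sq]
      push_cast; ring
  have hsm : AEStronglyMeasurable s μ :=
    ((Complex.continuous_conj.measurable.comp_aemeasurable hi.1.aemeasurable).div
      (Complex.continuous_ofReal.measurable.comp_aemeasurable
        hi.1.aemeasurable.norm)).aestronglyMeasurable
  obtain ⟨f', hf', hfn⟩ := hs.exists_rep (𝓑.rep_self f)
    (hsm.mul (𝓑.toAE f).aestronglyMeasurable) (Eventually.of_forall fun y => by
      rw [Pi.mul_apply, norm_mul]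
      exact mul_le_of_le_one_left (norm_nonneg _) (hs1 y))
  have h2 : hc.synth f' v = ((∫ y, ‖h y‖ ∂μ : ℝ) : ℂ) := by
    rw [hc.synth_apply hf']
    refine Eq.trans (integral_congr_ae (Eventually.of_forall fun y => ?_)) integral_ofReal
    simp only [Pi.mul_apply]
    rw [mul_assoc]
    exact hsh y
  calc ∫⁻ y, ‖𝓑.toAE f y‖ₑ * ‖ρ.dual y (j u) v‖ₑ ∂μ = ∫⁻ y, ‖h y‖ₑ ∂μ :=
        lintegral_congr fun y => (enorm_mul _ _).symm
    _ = ENNReal.ofReal (∫ y, ‖h y‖ ∂μ) := (ofReal_integral_norm_eq_lintegral_enorm hi).symm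
    _ ≤ ENNReal.ofReal (C * hs.const * ‖f‖) := by
        refine ENNReal.ofReal_le_ofReal ?_
        have h3 := hC f'
        rw [h2, Complex.norm_real, Real.norm_of_nonneg (integral_nonneg fun _ => norm_nonneg _)]
          at h3
        rw [mul_assoc]
        exact h3.trans (mul_le_mul_of_nonneg_left hfn hC0)

lemma exists_lintegral_dom_le (hc : CoorbitAssumption ρ j 𝓑 u) (hs : 𝓑.Solid) (v : S) :
    ∃ C : ℝ, 0 ≤ C ∧ ∀ Φ M, 𝓑.Dom Φ M →
      ∫⁻ y, Φ y * ‖ρ.dual y (j u) v‖ₑ ∂μ ≤ ENNReal.ofReal (C * M) := by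
  obtain ⟨C, hC0, hC⟩ := hc.exists_lintegral_pairing_le hs v
  refine ⟨C, hC0, fun Φ M hΦ => ?_⟩
  obtain ⟨g, hg, g₀, -, hr, hle⟩ := hΦ
  refine (lintegral_mono_ae ?_).trans ((hC g).trans
    (ENNReal.ofReal_le_ofReal (mul_le_mul_of_nonneg_left hg hC0)))
  filter_upwards [hr, hle] with y h1 h2
  refine mul_le_mul_left (h2.trans ?_) _
  rw [h1, enorm_eq_nnnorm]
  simp

lemma exists_wav_ne_zero (hc : CoorbitAssumption ρ j 𝓑 u) (hj : Function.Injective j) :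
    ∃ x, ρ.wav u (j u) x ≠ 0 := by
  by_contra! h
  have hd : Dense (Submodule.span ℂ (range fun x => ρ.toFun x u) : Set S) := hc.analyzing.1
  have h1 : (j u : S → ℂ) = (0 : S →L⋆[ℂ] ℂ) := by
    refine Continuous.ext_on hd (j u).continuous continuous_const fun w hw => ?_
    induction hw using Submodule.span_induction with
    | mem w hw => obtain ⟨x, rfl⟩ := hw; exact h x
    | zero => simp
    | add a b _ _ ha hb => rw [map_add, ha, hb]; simp
    | smul c a _ ha => rw [map_smulₛₗ, ha]; simp
  have h2 : j u = 0 := DFunLike.coe_injective h1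
  exact hc.ne_zero (hj (by rw [h2, map_zero]))

/-- The elements of the BF-space are locally integrable: near any point some vector `ρ(x)u` pairs
with `ρ*(y)u` to an absolute value bounded from below. -/
theorem locInt (hc : CoorbitAssumption ρ j 𝓑 u) (hs : 𝓑.Solid) (hj : Function.Injective j)
    [Nontrivial S] (hρ : ρ.WeaklyContinuousNearOne) : 𝓑.LocInt := by
  obtain ⟨x₀, hx₀⟩ := hc.exists_wav_ne_zero hj
  set c : ℝ := ‖ρ.wav u (j u) x₀‖ / 2 with hcdef
  have hc0 : 0 < c := by have := norm_pos_iff.2 hx₀; positivity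
  intro K hK
  refine hK.induction_on (p := fun s => ∃ C : ℝ, 0 ≤ C ∧ ∀ f : B,
    ∫⁻ y in s, ‖𝓑.toAE f y‖ₑ ∂μ ≤ ENNReal.ofReal (C * ‖f‖)) ⟨0, le_rfl, fun f => by simp⟩ ?_ ?_ ?_
  · rintro s t hst ⟨C, hC0, hC⟩
    exact ⟨C, hC0, fun f => (lintegral_mono_set hst).trans (hC f)⟩
  · rintro s t ⟨C, hC0, hC⟩ ⟨C', hC0', hC'⟩
    refine ⟨C + C', add_nonneg hC0 hC0', fun f => ?_⟩
    rw [add_mul, ENNReal.ofReal_add (by positivity) (by positivity)]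
    exact (lintegral_union_le _ _ _).trans (add_le_add (hC f) (hC' f))
  · intro y₀ _
    obtain ⟨C, hC0, hC⟩ := hc.exists_lintegral_pairing_le hs (ρ.toFun (y₀ * x₀) u)
    have hcont : Continuous fun y => ‖ρ.wav u (j u) (y⁻¹ * (y₀ * x₀))‖ :=
      (ρ.continuous_norm_wav hρ u (j u)).comp (by fun_prop)
    have hmem : {y | c < ‖ρ.wav u (j u) (y⁻¹ * (y₀ * x₀))‖} ∈ 𝓝 y₀ := by
      refine (isOpen_lt continuous_const hcont).mem_nhds ?_
      have := norm_pos_iff.2 hx₀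
      rw [mem_ofPred_eq, inv_mul_cancel_left, hcdef]
      linarith
    refine ⟨_, mem_nhdsWithin_of_mem_nhds hmem, C / c, by positivity, fun f => ?_⟩
    have hcE : ENNReal.ofReal c ≠ 0 := by simpa using hc0
    rw [div_mul_eq_mul_div, ENNReal.ofReal_div_of_pos hc0,
      ENNReal.le_div_iff_mul_le (Or.inl hcE) (Or.inl ENNReal.ofReal_ne_top),
      ← lintegral_mul_const' _ _ ENNReal.ofReal_ne_top]
    refine le_trans ?_ (hC f)
    refine le_trans ?_ (setLIntegral_le_lintegral
      {y | c < ‖ρ.wav u (j u) (y⁻¹ * (y₀ * x₀))‖} _)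
    refine setLIntegral_mono' (isOpen_lt continuous_const hcont).measurableSet fun y hy => ?_
    refine mul_le_mul_right ?_ _
    rw [ρ.enorm_dual_apply, ← ofReal_norm]
    exact ENNReal.ofReal_le_ofReal (le_of_lt hy)

end CoorbitAssumption
end PairingBound

/-! ### Maximal functions and oscillations of wavelet transforms -/

section Sampling

variable {n : ℕ} {G S : Type*} [TopologicalSpace G] [ChartedSpace (EuclideanSpace ℝ (Fin n)) G]
  [Group G] [LieGroup (𝓡 n) ∞ G] [IsTopologicalGroup G] [T2Space G]
  [LocallyCompactSpace G] [SecondCountableTopology G] [MeasurableSpace G] [BorelSpace G]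
  [AddCommGroup S] [Module ℂ S] [TopologicalSpace S] [Nontrivial S]
  {μ : Measure G} [μ.IsHaarMeasure]
  {B : Type*} [NormedAddCommGroup B] [NormedSpace ℂ B] [CompleteSpace B]
  {ρ : ProjRep G S} {j : S →ₗ[ℂ] (S →L⋆[ℂ] ℂ)} {𝓑 : BFSpace μ B} {u : S}

variable (n) in
/-- The assumptions on the representation, the BF-space and the analyzing vector under which
sampling is studied. -/
structure SamplingAssumption (ρ : ProjRep G S) (j : S →ₗ[ℂ] (S →L⋆[ℂ] ℂ)) (𝓑 : BFSpace μ B)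
    (u : S) : Prop extends AtomicAssumption (n := n) ρ j 𝓑 u where
  weakCont : ρ.WeaklyContinuousNearOne
  smooth : SmoothNear (n := n) ρ.σ {((1 : G), (1 : G))}
  injective : Function.Injective j

namespace ProjRep

lemma hasWeakDeriv_weakDeriv {X : GroupLieAlgebra (𝓡 n) G} {v : S}
    (h : ∃ w, ρ.HasWeakDeriv X v w) : ρ.HasWeakDeriv X v (ρ.weakDeriv X v) := by
  rw [weakDeriv, dif_pos h]
  exact h.choose_spec

lemma hasDualWeakDeriv_dualWeakDeriv {X : GroupLieAlgebra (𝓡 n) G} {l : S →L⋆[ℂ] ℂ}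
    (h : ∃ m, ρ.HasDualWeakDeriv X l m) : ρ.HasDualWeakDeriv X l (ρ.dualWeakDeriv X l) := by
  rw [dualWeakDeriv, dif_pos h]
  exact h.choose_spec

lemma WeaklyDiff.dif (hρ : ρ.WeaklyContinuousNearOne)
    (hσ : SmoothNear (n := n) ρ.σ {((1 : G), (1 : G))})
    (X : Fin n → GroupLieAlgebra (𝓡 n) G) {k : ℕ} {v : S} (h : ρ.WeaklyDiff (n := n) k v) :
    (ρ.rightFamily hρ hσ).Dif X (fun i => ρ.weakDeriv (X i)) k v := by
  induction k generalizing v with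
  | zero => trivial
  | succ k ih =>
    refine ⟨fun i l => ?_, ih fun Ys hYs => h Ys (hYs.trans k.lt_succ_self), fun i => ih ?_⟩
    · have h1 := hasWeakDeriv_weakDeriv (h [] (by simp) (X i)) l
      have h2 : (ρ.rightFamily hρ hσ).H l (ρ.weakDeriv (X i) v) 1 = l (ρ.weakDeriv (X i) v) := by
        show l (ρ.toFun 1 _) = _
        rw [ρ.map_one]; rfl
      rw [h2]
      exact h1
    · intro Ys hYs Y
      have := h (Ys ++ [X i]) (by simpa using hYs) Y
      simpa [iterDeriv, List.foldr_append] using this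

lemma DualWeaklyDiff.dif (hρ : ρ.WeaklyContinuousNearOne)
    (hσ : SmoothNear (n := n) ρ.σ {((1 : G), (1 : G))})
    (X : Fin n → GroupLieAlgebra (𝓡 n) G) {k : ℕ} {l : S →L⋆[ℂ] ℂ}
    (h : ρ.DualWeaklyDiff (n := n) k l) :
    (ρ.leftFamily hρ hσ).Dif X (fun i => ρ.dualWeakDeriv (X i)) k l := by
  induction k generalizing l with
  | zero => trivial
  | succ k ih =>
    refine ⟨fun i w => ?_, ih fun Ys hYs => h Ys (hYs.trans k.lt_succ_self), fun i => ih ?_⟩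
    · have h1 := hasDualWeakDeriv_dualWeakDeriv (h [] (by simp) (X i)) w
      have h2 : (ρ.leftFamily hρ hσ).H w (ρ.dualWeakDeriv (X i) l) 1 =
          ρ.dualWeakDeriv (X i) l w := by
        show ρ.dual 1 _ w = _
        rw [ρ.dual_one]
      rw [h2]
      exact h1
    · intro Ys hYs Y
      have := h (Ys ++ [X i]) (by simpa using hYs) Y
      simpa [iterDualDeriv, List.foldr_append] using this

/-- The left majorant at `g` is a translate of the left majorant at the identity. -/
lemma maj_leftFamily (hρ : ρ.WeaklyContinuousNearOne)
    (hσ : SmoothNear (n := n) ρ.σ {((1 : G), (1 : G))})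
    (der : Fin n → (S →L⋆[ℂ] ℂ) → (S →L⋆[ℂ] ℂ)) (k : ℕ) (l : S →L⋆[ℂ] ℂ) (v : S) (x g : G) :
    (ρ.leftFamily hρ hσ).maj der k l (ρ.toFun x v) g =
      (ρ.leftFamily hρ hσ).maj der k l (ρ.toFun (g⁻¹ * x) v) 1 := by
  induction k generalizing l with
  | zero =>
    show ‖ρ.dual g l (ρ.toFun x v)‖ₑ = ‖ρ.dual 1 l (ρ.toFun (g⁻¹ * x) v)‖ₑ
    rw [ρ.enorm_dual_apply, ρ.dual_one]; rfl
  | succ k ih => simp only [CoeffFamily.maj, ih]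

lemma measurable_maj_leftFamily (hρ : ρ.WeaklyContinuousNearOne)
    (hσ : SmoothNear (n := n) ρ.σ {((1 : G), (1 : G))})
    (der : Fin n → (S →L⋆[ℂ] ℂ) → (S →L⋆[ℂ] ℂ)) (k : ℕ) (l : S →L⋆[ℂ] ℂ) (v : S) :
    Measurable fun x => (ρ.leftFamily hρ hσ).maj der k l (ρ.toFun x v) 1 := by
  induction k generalizing l with
  | zero =>
    show Measurable fun x => ‖ρ.dual 1 l (ρ.toFun x v)‖ₑ
    simp only [ρ.dual_one]
    exact (ρ.measurable_wav v l).enorm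
  | succ k ih => exact (ih l).add (Finset.measurable_fun_sum _ fun i _ => ih (der i l))

end ProjRep

namespace SamplingAssumption

lemma locInt (h : SamplingAssumption n ρ j 𝓑 u) : 𝓑.LocInt :=
  h.toCoorbitAssumption.locInt h.solid h.injective h.weakCont

lemma domConv_left (h : SamplingAssumption n ρ j 𝓑 u) (X : Fin n → GroupLieAlgebra (𝓡 n) G)
    (k : ℕ) (Ys : List (GroupLieAlgebra (𝓡 n) G)) (hk : Ys.length + k ≤ n) :
    𝓑.DomConv (fun x => (ρ.leftFamily h.weakCont h.smooth).maj (fun i => ρ.dualWeakDeriv (X i)) k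
      (ρ.iterDualDeriv Ys (j u)) (ρ.toFun x u) 1) := by
  induction k generalizing Ys with
  | zero =>
    refine ((h.bdd_dualDeriv Ys (by omega)).domConv h.solid).mono fun x => le_of_eq ?_
    show ‖ρ.dual 1 _ (ρ.toFun x u)‖ₑ = _
    rw [ρ.dual_one]; rfl
  | succ k ih =>
    refine (ih Ys (by omega)).add (BFSpace.DomConv.sum _ (fun i _ => ?_) fun i _ => ?_) ?_
    · exact ih (X i :: Ys) (by simp only [List.length_cons]; omega)
    · exact ρ.measurable_maj_leftFamily _ _ _ _ _ _
    · exact ρ.measurable_maj_leftFamily _ _ _ _ _ _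

lemma domConv_right (h : SamplingAssumption n ρ j 𝓑 u) (X : Fin n → GroupLieAlgebra (𝓡 n) G)
    (k : ℕ) (Ys : List (GroupLieAlgebra (𝓡 n) G)) (hk : Ys.length + k ≤ n) :
    𝓑.DomConv ((ρ.rightFamily h.weakCont h.smooth).maj (fun i => ρ.weakDeriv (X i)) k
      (ρ.iterDeriv Ys u) (j u)) := by
  induction k generalizing Ys with
  | zero => exact (h.bdd_deriv Ys (by omega)).domConv h.solid
  | succ k ih =>
    refine (ih Ys (by omega)).add (BFSpace.DomConv.sum _ (fun i _ => ?_) fun i _ => ?_) ?_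
    · exact ih (X i :: Ys) (by simp only [List.length_cons]; omega)
    · exact CoeffFamily.measurable_maj _ _ _ _ _
    · exact CoeffFamily.measurable_maj _ _ _ _ _

lemma enorm_wav_synth_le (h : SamplingAssumption n ρ j 𝓑 u) (f : B) (v : S) (y : G) :
    ‖ρ.wav v (h.synth f) y‖ₑ ≤ ∫⁻ x, ‖𝓑.toAE f x‖ₑ * ‖ρ.wav v (j u) (x⁻¹ * y)‖ₑ ∂μ := by
  rw [ProjRep.wav, h.synth_apply (𝓑.rep_self f)]
  refine (enorm_integral_le_lintegral_enorm _).trans (le_of_eq (lintegral_congr fun x => ?_))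
  rw [enorm_mul, ρ.enorm_dual_apply]

lemma maj_synth_le (h : SamplingAssumption n ρ j 𝓑 u) (der : Fin n → S → S) (k : ℕ) (v : S)
    (f : B) (y : G) : (ρ.rightFamily h.weakCont h.smooth).maj der k v (h.synth f) y ≤
      ∫⁻ x, ‖𝓑.toAE f x‖ₑ *
        (ρ.rightFamily h.weakCont h.smooth).maj der k v (j u) (x⁻¹ * y) ∂μ := by
  induction k generalizing v with
  | zero => exact h.enorm_wav_synth_le f v y
  | succ k ih =>
    have hm : ∀ w, AEMeasurable (fun x => ‖𝓑.toAE f x‖ₑ *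
        (ρ.rightFamily h.weakCont h.smooth).maj der k w (j u) (x⁻¹ * y)) μ := fun w =>
      (𝓑.toAE f).aestronglyMeasurable.enorm.mul
        ((CoeffFamily.measurable_maj _ _ _ _ _).comp (measurable_inv.mul_const y)).aemeasurable
    simp only [CoeffFamily.maj, mul_add, Finset.mul_sum]
    rw [lintegral_add_left' (hm v), lintegral_finsetSum' _ fun i _ => hm _]
    exact add_le_add (ih v) (Finset.sum_le_sum fun i _ => ih (der i v))

/-- The majorant of a synthesized functional is dominated by the BF-norm of its coefficient
function. -/
lemma exists_dom_maj (h : SamplingAssumption n ρ j 𝓑 u) (X : Fin n → GroupLieAlgebra (𝓡 n) G) :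
    ∃ C : ℝ, 0 ≤ C ∧ ∀ f : B,
      𝓑.Dom ((ρ.rightFamily h.weakCont h.smooth).maj (fun i => ρ.weakDeriv (X i)) n u
        (h.synth f)) (C * ‖f‖) := by
  obtain ⟨C, hC0, hC⟩ := h.domConv_right X n [] (by simp)
  refine ⟨C * h.solid.const, mul_nonneg hC0 h.solid.const_pos.le, fun f => ?_⟩
  exact (hC _ _ (h.solid.dom (𝓑.rep_self f))).mono (fun y => h.maj_synth_le _ n u f y)
    (by rw [mul_assoc])

variable (X : Module.Basis (Fin n) ℝ (GroupLieAlgebra (𝓡 n) G))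

include X in
/-- The local maximal function of a wavelet transform belongs to the BF-space. -/
theorem exists_right_max (h : SamplingAssumption n ρ j 𝓑 u) {K : Set G} (hK : IsCompact K) :
    ∃ C : ℝ, 0 ≤ C ∧ ∀ f : B,
      𝓑.Dom (fun y => ⨆ τ ∈ K, ‖ρ.wav u (h.synth f) (y * τ)‖ₑ) (C * ‖f‖) := by
  set 𝓗 := ρ.rightFamily h.weakCont h.smooth
  obtain ⟨L, hL, θ, hθ, hθL, hmax⟩ :=
    𝓗.exists_max_measure X (fun i => ρ.weakDeriv (X i)) hK
  obtain ⟨C₁, hC₁0, hC₁⟩ := h.exists_dom_maj X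
  obtain ⟨C₂, hC₂0, hC₂⟩ := BFSpace.exists_dom_average h.solid h.locInt h.bddTransl_right
    h.cont_right hL
  refine ⟨C₂ * (θ univ).toReal * C₁, by positivity, fun f => ?_⟩
  refine (hC₂ θ hθL _ _ (hC₁ f)).mono (fun y => iSup₂_le fun τ hτ => ?_) (le_of_eq (by ring))
  have := hmax u (𝓗.act (h.synth f) y) (h.weaklyDiff.dif h.weakCont h.smooth X) τ hτ
  simp only [𝓗.maj_act] at this
  refine le_trans (le_of_eq ?_) this
  rw [← ofReal_norm, ← ofReal_norm, 𝓗.norm_H_act]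
  rfl

include X in
/-- The local oscillation of a wavelet transform is small in the BF-space. -/
theorem exists_right_osc (h : SamplingAssumption n ρ j 𝓑 u) {δ : ℝ} (hδ : 0 < δ) :
    ∃ U ∈ 𝓝 (1 : G), ∀ f : B,
      𝓑.Dom (fun y => ⨆ τ ∈ U, ‖h.synth f (ρ.toFun y (ρ.toFun τ u)) -
        h.synth f (ρ.toFun y u)‖ₑ) (δ * ‖f‖) := by
  set 𝓗 := ρ.rightFamily h.weakCont h.smooth
  obtain ⟨K, hK, hosc⟩ := 𝓗.exists_osc_measure X (fun i => ρ.weakDeriv (X i))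
  obtain ⟨C₁, hC₁0, hC₁⟩ := h.exists_dom_maj X
  obtain ⟨C₂, hC₂0, hC₂⟩ := BFSpace.exists_dom_average h.solid h.locInt h.bddTransl_right
    h.cont_right hK
  obtain ⟨U, hU, θ, hθ, hθK, hθδ, hle⟩ := hosc (δ / (C₂ * C₁ + 1)) (by positivity)
  refine ⟨U, hU, fun f => ?_⟩
  refine (hC₂ θ hθK _ _ (hC₁ f)).mono (fun y => iSup₂_le fun τ hτ => ?_) ?_
  · have := hle u (𝓗.act (h.synth f) y) (h.weaklyDiff.dif h.weakCont h.smooth X) τ hτ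
    simp only [𝓗.maj_act] at this
    refine le_trans (le_of_eq ?_) this
    show _ = ‖h.synth f (ρ.toFun y (ρ.toFun τ u)) - h.synth f (ρ.toFun y (ρ.toFun 1 u))‖ₑ
    rw [ρ.map_one]; rfl
  · have h1 : (θ univ).toReal ≤ δ / (C₂ * C₁ + 1) :=
      ENNReal.toReal_le_of_le_ofReal (by positivity) hθδ
    calc C₂ * (θ univ).toReal * (C₁ * ‖f‖) = C₂ * C₁ * ‖f‖ * (θ univ).toReal := by ring
      _ ≤ C₂ * C₁ * ‖f‖ * (δ / (C₂ * C₁ + 1)) := by gcongr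
      _ = δ * ‖f‖ * (C₂ * C₁ / (C₂ * C₁ + 1)) := by ring
      _ ≤ δ * ‖f‖ * 1 := by
          gcongr
          exact div_le_one_of_le₀ (by linarith) (by positivity)
      _ = δ * ‖f‖ := mul_one _

include X in
/-- Convolution with a left local maximal function of the reproducing kernel preserves
domination. -/
theorem domConv_left_max (h : SamplingAssumption n ρ j 𝓑 u) {K : Set G} (hK : IsCompact K) :
    𝓑.DomConv (fun x => ⨆ τ ∈ K, ‖ρ.wav u (j u) (τ⁻¹ * x)‖ₑ) := by
  set 𝓗 := ρ.leftFamily h.weakCont h.smooth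
  obtain ⟨L, hL, θ, hθ, hθL, hmax⟩ :=
    𝓗.exists_max_measure X (fun i => ρ.dualWeakDeriv (X i)) hK
  obtain ⟨C, hC0, hC⟩ := BFSpace.DomConv.exists_left_average h.solid h.locInt h.bddTransl_right
    h.cont_right (h.domConv_left X n [] (by simp)) (ρ.measurable_maj_leftFamily _ _ _ _ _ _) hL
  refine ⟨C * (θ univ).toReal, by positivity, fun Φ M hΦ => ?_⟩
  refine (hC θ hθL Φ M hΦ).mono (fun z => lintegral_mono fun y => mul_le_mul_right ?_ _) le_rfl
  refine iSup₂_le fun τ hτ => ?_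
  have := hmax (j u) (ρ.toFun (y⁻¹ * z) u) (h.dualWeaklyDiff.dif h.weakCont h.smooth X) τ hτ
  refine le_trans (le_of_eq ?_)
    (this.trans (le_of_eq (lintegral_congr fun g => ρ.maj_leftFamily _ _ _ _ _ _ _ _)))
  exact (ρ.enorm_dual_apply τ (y⁻¹ * z) u (j u)).symm

include X in
/-- Convolution with the left local oscillation of the reproducing kernel is small. -/
theorem exists_left_osc (h : SamplingAssumption n ρ j 𝓑 u) {δ : ℝ} (hδ : 0 < δ) :
    ∃ U ∈ 𝓝 (1 : G), ∀ Φ M, 𝓑.Dom Φ M →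
      𝓑.Dom (fun z => ∫⁻ y, Φ y * ⨆ τ ∈ U, ‖ρ.dual τ (j u) (ρ.toFun (y⁻¹ * z) u) -
        j u (ρ.toFun (y⁻¹ * z) u)‖ₑ ∂μ) (δ * M) := by
  set 𝓗 := ρ.leftFamily h.weakCont h.smooth
  obtain ⟨K, hK, hosc⟩ := 𝓗.exists_osc_measure X (fun i => ρ.dualWeakDeriv (X i))
  obtain ⟨C, hC0, hC⟩ := BFSpace.DomConv.exists_left_average h.solid h.locInt h.bddTransl_right
    h.cont_right (h.domConv_left X n [] (by simp)) (ρ.measurable_maj_leftFamily _ _ _ _ _ _) hK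
  obtain ⟨U, hU, θ, hθ, hθK, hθδ, hle⟩ := hosc (δ / (C + 1)) (by positivity)
  refine ⟨U, hU, fun Φ M hΦ => ?_⟩
  have hM := hΦ.nonneg
  refine (hC θ hθK Φ M hΦ).mono (fun z => lintegral_mono fun y => mul_le_mul_right ?_ _) ?_
  · refine iSup₂_le fun τ hτ => ?_
    have := hle (j u) (ρ.toFun (y⁻¹ * z) u) (h.dualWeaklyDiff.dif h.weakCont h.smooth X) τ hτ
    refine le_trans (le_of_eq ?_)
      (this.trans (le_of_eq (lintegral_congr fun g => ρ.maj_leftFamily _ _ _ _ _ _ _ _)))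
    show _ = ‖ρ.dual τ (j u) (ρ.toFun (y⁻¹ * z) u) - ρ.dual 1 (j u) (ρ.toFun (y⁻¹ * z) u)‖ₑ
    rw [ρ.dual_one]
  · have h1 : (θ univ).toReal ≤ δ / (C + 1) :=
      ENNReal.toReal_le_of_le_ofReal (by positivity) hθδ
    calc C * (θ univ).toReal * M = C * M * (θ univ).toReal := by ring
      _ ≤ C * M * (δ / (C + 1)) := by gcongr
      _ = δ * M * (C / (C + 1)) := by ring
      _ ≤ δ * M * 1 := by
          gcongr
          exact div_le_one_of_le₀ (by linarith) (by positivity)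
      _ = δ * M := mul_one _

end SamplingAssumption
end Sampling

/-! ### The coorbit space and the reproducing kernel space -/

section Reproducing

variable {G S : Type*} [TopologicalSpace G] [Group G] [MeasurableSpace G]
  [AddCommGroup S] [Module ℂ S] [TopologicalSpace S]
  {μ : Measure G} {B : Type*} [NormedAddCommGroup B] [NormedSpace ℂ B]
  {ρ : ProjRep G S} {j : S →ₗ[ℂ] (S →L⋆[ℂ] ℂ)} {𝓑 : BFSpace μ B} {u : S}

lemma rep_coorbitW (γ : coorbit ρ 𝓑 u) : 𝓑.Rep (coorbitW ρ 𝓑 u γ) (ρ.wav u γ) := γ.2.choose_spec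

lemma ProjRep.Cyclic.ext {v : S} (hv : ρ.Cyclic v) {l m : S →L⋆[ℂ] ℂ}
    (h : ∀ x, ρ.wav v l x = ρ.wav v m x) : l = m := by
  have hd : Dense (Submodule.span ℂ (range fun x => ρ.toFun x v) : Set S) := hv
  refine DFunLike.coe_injective (Continuous.ext_on hd l.continuous m.continuous fun w hw => ?_)
  induction hw using Submodule.span_induction with
  | mem w hw => obtain ⟨x, rfl⟩ := hw; exact h x
  | zero => simp
  | add a b _ _ ha hb => rw [map_add, ha, hb, map_add]
  | smul c a _ ha => rw [map_smulₛₗ, ha, map_smulₛₗ]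

namespace CoorbitAssumption

/-- A functional with transform in the BF-space is synthesized from its transform: this is the
reproducing formula on the cyclic vectors `ρ(x)u`. -/
lemma synth_eq_of_rep (hc : CoorbitAssumption ρ j 𝓑 u) {f : B} {l : S →L⋆[ℂ] ℂ}
    (hf : 𝓑.Rep f (ρ.wav u l)) : hc.synth f = l := by
  refine hc.analyzing.1.ext fun x => ?_
  rw [← hc.twConv_eq_wav_synth hf u x, (hc.analyzing.2 l x).2]

lemma ev_of_rep (hc : CoorbitAssumption ρ j 𝓑 u) {f : B} {l : S →L⋆[ℂ] ℂ}
    (hf : 𝓑.Rep f (ρ.wav u l)) (x : G) : 𝓑.ev ρ.σ (ρ.wav u (j u)) f x = ρ.wav u l x := by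
  rw [hc.ev_eq, hc.synth_eq_of_rep hf]

lemma rep_of_mem_repro (hc : CoorbitAssumption ρ j 𝓑 u) {f : B}
    (hf : f ∈ 𝓑.repro ρ.σ (ρ.wav u (j u))) : 𝓑.Rep f (ρ.wav u (hc.synth f)) :=
  hf.2.congr (Eventually.of_forall fun x => hc.ev_eq f x)

lemma mem_repro_of_rep (hc : CoorbitAssumption ρ j 𝓑 u) {f : B} {l : S →L⋆[ℂ] ℂ}
    (hf : 𝓑.Rep f (ρ.wav u l)) : f ∈ 𝓑.repro ρ.σ (ρ.wav u (j u)) :=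
  ⟨fun x => hc.twConvExists (𝓑.rep_self f) u x,
    hf.congr (Eventually.of_forall fun x => (hc.ev_of_rep hf x).symm)⟩

/-- The wavelet transform as a linear bijection from the coorbit space onto the reproducing kernel
space. -/
noncomputable def waveletEquiv (hc : CoorbitAssumption ρ j 𝓑 u) :
    coorbit ρ 𝓑 u ≃ₗ[ℂ] 𝓑.repro ρ.σ (ρ.wav u (j u)) where
  toFun γ := ⟨coorbitW ρ 𝓑 u γ, hc.mem_repro_of_rep (rep_coorbitW γ)⟩
  map_add' γ γ' := Subtype.ext ((rep_coorbitW _).unique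
    (((rep_coorbitW γ).add (rep_coorbitW γ')).congr
      (Eventually.of_forall fun x => by simp [ProjRep.wav])))
  map_smul' c γ := Subtype.ext ((rep_coorbitW _).unique
    (((rep_coorbitW γ).smul c).congr (Eventually.of_forall fun x => by simp [ProjRep.wav])))
  invFun f := ⟨hc.synth f, f, hc.rep_of_mem_repro f.2⟩
  left_inv γ := Subtype.ext (hc.synth_eq_of_rep (rep_coorbitW γ))
  right_inv f := Subtype.ext ((rep_coorbitW _).unique (hc.rep_of_mem_repro f.2))

lemma coe_waveletEquiv (hc : CoorbitAssumption ρ j 𝓑 u) (γ : coorbit ρ 𝓑 u) :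
    (hc.waveletEquiv γ : B) = coorbitW ρ 𝓑 u γ := rfl

lemma rep_waveletEquiv (hc : CoorbitAssumption ρ j 𝓑 u) (γ : coorbit ρ 𝓑 u) :
    𝓑.Rep (hc.waveletEquiv γ) (ρ.wav u γ) := rep_coorbitW γ

lemma norm_waveletEquiv (hc : CoorbitAssumption ρ j 𝓑 u) (γ : coorbit ρ 𝓑 u) :
    ‖hc.waveletEquiv γ‖ = coNorm ρ 𝓑 u γ := rfl

lemma ev_waveletEquiv (hc : CoorbitAssumption ρ j 𝓑 u) (γ : coorbit ρ 𝓑 u) (x : G) :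
    𝓑.ev ρ.σ (ρ.wav u (j u)) (hc.waveletEquiv γ : B) x = ρ.wav u γ x :=
  hc.ev_of_rep (rep_coorbitW γ) x

end CoorbitAssumption
end Reproducing

section Complete

variable {n : ℕ} {G S : Type*} [TopologicalSpace G] [ChartedSpace (EuclideanSpace ℝ (Fin n)) G]
  [Group G] [LieGroup (𝓡 n) ∞ G] [IsTopologicalGroup G] [T2Space G]
  [LocallyCompactSpace G] [SecondCountableTopology G] [MeasurableSpace G] [BorelSpace G]
  [AddCommGroup S] [Module ℂ S] [TopologicalSpace S] [Nontrivial S]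
  {μ : Measure G} [μ.IsHaarMeasure]
  {B : Type*} [NormedAddCommGroup B] [NormedSpace ℂ B] [CompleteSpace B]
  {ρ : ProjRep G S} {j : S →ₗ[ℂ] (S →L⋆[ℂ] ℂ)} {𝓑 : BFSpace μ B} {u : S}

namespace SamplingAssumption

lemma exists_rep_of_dom (h : SamplingAssumption n ρ j 𝓑 u) {l : S →L⋆[ℂ] ℂ} {Φ : G → ℝ≥0∞}
    {M : ℝ} (hΦ : 𝓑.Dom Φ M) (hle : ∀ x, ‖ρ.wav u l x‖ₑ ≤ Φ x) :
    ∃ f : 𝓑.repro ρ.σ (ρ.wav u (j u)), 𝓑.Rep f (ρ.wav u l) ∧ ‖f‖ ≤ h.solid.const * M := by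
  obtain ⟨f, hf, hfn⟩ := hΦ.exists_rep h.solid (ρ.measurable_wav u l).aestronglyMeasurable
    (Eventually.of_forall hle)
  exact ⟨⟨f, h.mem_repro_of_rep hf⟩, hf, hfn⟩

lemma exists_dom_wav_synth (h : SamplingAssumption n ρ j 𝓑 u) :
    ∃ C : ℝ, 0 ≤ C ∧ ∀ f : B, 𝓑.Dom (fun y => ‖ρ.wav u (h.synth f) y‖ₑ) (C * ‖f‖) := by
  obtain ⟨C, hC0, hC⟩ := (h.bdd_deriv [] (by simp)).domConv h.solid
  refine ⟨C * h.solid.const, mul_nonneg hC0 h.solid.const_pos.le, fun f => ?_⟩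
  exact (hC _ _ (h.solid.dom (𝓑.rep_self f))).mono (fun y => h.enorm_wav_synth_le f u y)
    (by rw [mul_assoc])

/-- The projection `f ↦ f # W_u(u)` of the BF-space onto the reproducing kernel space. -/
lemma exists_proj (h : SamplingAssumption n ρ j 𝓑 u) :
    ∃ P : B →L[ℂ] 𝓑.repro ρ.σ (ρ.wav u (j u)),
      ∀ f, 𝓑.Rep (P f : B) (ρ.wav u (h.synth f)) := by
  obtain ⟨C, hC0, hC⟩ := h.exists_dom_wav_synth
  choose P hP hPn using fun f => h.exists_rep_of_dom (hC f) fun x => le_rfl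
  let L : B →ₗ[ℂ] 𝓑.repro ρ.σ (ρ.wav u (j u)) :=
    { toFun := P
      map_add' := fun f g => Subtype.ext ((hP _).unique (((hP f).add (hP g)).congr
        (Eventually.of_forall fun x => by rw [h.synth_add]; rfl)))
      map_smul' := fun c f => Subtype.ext ((hP _).unique (((hP f).smul c).congr
        (Eventually.of_forall fun x => by rw [h.synth_smul]; rfl))) }
  exact ⟨L.mkContinuous (h.solid.const * C) fun f => by rw [mul_assoc]; exact hPn f, hP⟩

/-- The reproducing kernel space is the range of a bounded projection, hence complete. -/
lemma completeSpace_repro (h : SamplingAssumption n ρ j 𝓑 u) :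
    CompleteSpace (𝓑.repro ρ.σ (ρ.wav u (j u))) := by
  obtain ⟨P, hP⟩ := h.exists_proj
  have hset : (𝓑.repro ρ.σ (ρ.wav u (j u)) : Set B) = {f | (P f : B) = f} := by
    ext f
    refine ⟨fun hf => (hP f).unique (h.rep_of_mem_repro hf), fun hf => ?_⟩
    have hf' : (P f : B) = f := hf
    rw [SetLike.mem_coe, ← hf']
    exact (P f).2
  have hcl : IsClosed (𝓑.repro ρ.σ (ρ.wav u (j u)) : Set B) := by
    rw [hset]
    exact isClosed_eq (continuous_subtype_val.comp P.continuous) continuous_id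
  exact hcl.completeSpace_coe

/-- A linear family of functionals with dominated transforms gives a bounded operator on the
reproducing kernel space. -/
lemma exists_operator (h : SamplingAssumption n ρ j 𝓑 u)
    (τ : 𝓑.repro ρ.σ (ρ.wav u (j u)) → (S →L⋆[ℂ] ℂ)) (hadd : ∀ f g, τ (f + g) = τ f + τ g)
    (hsmul : ∀ (c : ℂ) f, τ (c • f) = c • τ f) {C : ℝ}
    (hC : ∀ f, 𝓑.Dom (fun y => ‖ρ.wav u (τ f) y‖ₑ) (C * ‖f‖)) :
    ∃ T : 𝓑.repro ρ.σ (ρ.wav u (j u)) →L[ℂ] 𝓑.repro ρ.σ (ρ.wav u (j u)),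
      ∀ f, 𝓑.Rep (T f : B) (ρ.wav u (τ f)) := by
  choose P hP hPn using fun f => h.exists_rep_of_dom (hC f) fun x => le_rfl
  let L : 𝓑.repro ρ.σ (ρ.wav u (j u)) →ₗ[ℂ] 𝓑.repro ρ.σ (ρ.wav u (j u)) :=
    { toFun := P
      map_add' := fun f g => Subtype.ext ((hP _).unique (((hP f).add (hP g)).congr
        (Eventually.of_forall fun x => by rw [hadd]; rfl)))
      map_smul' := fun c f => Subtype.ext ((hP _).unique (((hP f).smul c).congr
        (Eventually.of_forall fun x => by rw [hsmul]; rfl))) }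
  exact ⟨L.mkContinuous (h.solid.const * C) fun f => by rw [mul_assoc]; exact hPn f, hP⟩

end SamplingAssumption

/-- An operator at distance less than one from the identity of a Banach space is invertible. -/
lemma exists_continuousLinearEquiv {E : Type*} [NormedAddCommGroup E] [NormedSpace ℂ E]
    [CompleteSpace E] (T : E →L[ℂ] E) {δ : ℝ} (hδ0 : 0 ≤ δ) (hδ : δ < 1)
    (h : ∀ f, ‖f - T f‖ ≤ δ * ‖f‖) : ∃ T' : E ≃L[ℂ] E, ∀ f, T' f = T f := by
  have h1 : ‖(1 : E →L[ℂ] E) - T‖ < 1 :=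
    (ContinuousLinearMap.opNorm_le_bound _ hδ0 h).trans_lt hδ
  refine ⟨ContinuousLinearEquiv.ofUnit (Units.oneSub _ h1), fun f => ?_⟩
  show ((1 : E →L[ℂ] E) - (1 - T)) f = T f
  rw [sub_sub_cancel]

end Complete

/-! ### Well-spread families and sequence spaces -/

section Box

variable {n : ℕ} {G : Type*} [TopologicalSpace G] [ChartedSpace (EuclideanSpace ℝ (Fin n)) G]
  [Group G] [LieGroup (𝓡 n) ∞ G] [IsTopologicalGroup G] [T2Space G]
  (X : Module.Basis (Fin n) ℝ (GroupLieAlgebra (𝓡 n) G))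

lemma boxNhd_eq_image (ε : ℝ) :
    boxNhd X ε = expProd X (List.finRange n) '' (Set.univ.pi fun _ => Icc (-ε) ε) := by
  ext g
  simp only [boxNhd, expProd, ← List.ofFn_eq_map, mem_image, mem_univ_pi, mem_Icc]
  constructor
  · rintro ⟨t, ht, rfl⟩; exact ⟨t, ht, rfl⟩
  · rintro ⟨t, ht, rfl⟩; exact ⟨t, ht, rfl⟩

lemma isCompact_boxNhd (ε : ℝ) : IsCompact (boxNhd X ε) := by
  rw [boxNhd_eq_image]
  exact (isCompact_univ_pi fun _ => isCompact_Icc).image (continuous_expProd X _)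

lemma exists_boxNhd_subset {U : Set G} (hU : U ∈ 𝓝 (1 : G)) :
    ∃ ε₀ : ℝ, 0 < ε₀ ∧ ∀ ε ≤ ε₀, boxNhd X ε ⊆ U := by
  have h1 : expProd X (List.finRange n) ⁻¹' U ∈ 𝓝 (0 : Fin n → ℝ) := by
    refine (continuous_expProd X _).continuousAt.preimage_mem_nhds ?_
    rwa [expProd_zero]
  obtain ⟨r, hr, hball⟩ := Metric.mem_nhds_iff.1 h1
  refine ⟨r / 2, half_pos hr, fun ε hε => ?_⟩
  rw [boxNhd_eq_image, image_subset_iff]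
  intro t ht
  refine hball ?_
  rw [mem_ball_zero_iff, pi_norm_lt_iff hr]
  intro k
  have := mem_univ_pi.1 ht k
  rw [Real.norm_eq_abs]
  exact (abs_le.2 ⟨this.1, this.2⟩).trans_lt (by linarith)

end Box

section Sequences

variable {G : Type*} [TopologicalSpace G] [Group G] [IsTopologicalGroup G] [T2Space G]
  [LocallyCompactSpace G] [SecondCountableTopology G] [MeasurableSpace G] [BorelSpace G]
  {ι : Type} {x : ι → G}

/-- A well-spread family meets the translates of a compact set in boundedly many points. -/
lemma WellSpread.exists_encard_le (hx : WellSpread x) {Q : Set G} (hQ : IsCompact Q) :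
    ∃ N : ℕ, ∀ y, {i | (x i)⁻¹ * y ∈ Q}.encard ≤ N := by
  obtain ⟨V, hV, N, c, hc⟩ := hx
  obtain ⟨s, -, hs⟩ := hQ.inv.elim_nhds_subcover (fun t => (fun g => t * g) '' V⁻¹) fun t _ => by
    have := (Homeomorph.mulLeft t).isOpenMap.image_mem_nhds (inv_mem_nhds_one G hV)
    simpa using this
  refine ⟨s.card * N, fun y => ?_⟩
  have hex : ∀ i ∈ {i | (x i)⁻¹ * y ∈ Q}, ∃ t ∈ s, ∃ w ∈ V, y⁻¹ * x i = t * w⁻¹ := by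
    intro i hi
    have hi' : y⁻¹ * x i ∈ Q⁻¹ := by
      have : ((x i)⁻¹ * y)⁻¹ ∈ Q⁻¹ := inv_mem_inv.2 hi
      simpa using this
    obtain ⟨t, ht, w, hw, hw'⟩ := mem_iUnion₂.1 (hs hi')
    exact ⟨t, ht, w⁻¹, hw, by simpa using hw'.symm⟩
  choose! t hts ht using hex
  -- two indices of one colour and one covering point have overlapping neighbourhoods `xᵢV`
  have hinj : InjOn (fun i => (t i, c i)) {i | (x i)⁻¹ * y ∈ Q} := by
    intro i hi k hk hik
    by_contra hne
    rw [Prod.mk.injEq] at hik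
    obtain ⟨w, hw, hiw⟩ := ht i hi
    obtain ⟨w', hw', hkw⟩ := ht k hk
    refine disjoint_left.1 (hc i k hne hik.2) ⟨w, hw, rfl⟩ ⟨w', hw', ?_⟩
    have h1 : x i = y * (t i * w⁻¹) := by rw [← hiw, mul_inv_cancel_left]
    have h2 : x k = y * (t k * w'⁻¹) := by rw [← hkw, mul_inv_cancel_left]
    simp only [h1, h2, ← hik.1, mul_assoc, inv_mul_cancel, mul_one]
  calc {i | (x i)⁻¹ * y ∈ Q}.encard
      = ((fun i => (t i, c i)) '' {i | (x i)⁻¹ * y ∈ Q}).encard := hinj.encard_image.symm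
    _ ≤ ((s ×ˢ Finset.univ : Finset (G × Fin N)) : Set (G × Fin N)).encard := by
        refine encard_le_encard ?_
        rintro _ ⟨i, hi, rfl⟩
        simpa using hts i hi
    _ = (s.card * N : ℕ) := by
        rw [encard_coe_eq_coe_finsetCard, Finset.card_product, Finset.card_univ, Fintype.card_fin]

lemma WellSpread.finite (hx : WellSpread x) {Q : Set G} (hQ : IsCompact Q) (y : G) :
    {i | (x i)⁻¹ * y ∈ Q}.Finite := by
  obtain ⟨N, hN⟩ := hx.exists_encard_le hQ
  exact finite_of_encard_le_coe (hN y)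

lemma tsum_le_of_encard_le {t : ι → ℝ≥0∞} {p : Set ι} {N : ℕ} (hp : p.encard ≤ N) {D : ℝ≥0∞}
    (h0 : ∀ i ∉ p, t i = 0) (hD : ∀ i ∈ p, t i ≤ D) : ∑' i, t i ≤ N * D := by
  have hf : p.Finite := finite_of_encard_le_coe hp
  rw [tsum_eq_sum (s := hf.toFinset) fun i hi => h0 i (by simpa using hi)]
  refine (Finset.sum_le_card_nsmul _ _ D fun i hi => hD i (by simpa using hi)).trans ?_
  rw [nsmul_eq_mul]
  refine mul_le_mul_left ?_ _
  rw [hf.encard_eq_coe_toFinset_card] at hp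
  exact_mod_cast hp

lemma measure_pos_of_uDense [Countable ι] {μ : Measure G} [μ.IsHaarMeasure] {U : Set G}
    (hx : UDense U x) : 0 < μ U := by
  rw [pos_iff_ne_zero]
  intro h0
  have h1 : (univ : Set G) = ⋃ i, (fun g => (x i)⁻¹ * g) ⁻¹' U := by
    refine (eq_univ_of_forall fun g => ?_).symm
    obtain ⟨i, hi⟩ := hx g
    exact mem_iUnion.2 ⟨i, hi⟩
  have h2 : μ (univ : Set G) = 0 := by
    rw [h1, measure_iUnion_null_iff]
    intro i
    rw [measure_preimage_mul, h0]
  exact (isOpen_univ.measure_pos μ univ_nonempty).ne' h2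

lemma enorm_stepFun {U : Set G} {y : G} (hfin : {i | (x i)⁻¹ * y ∈ U}.Finite) (c : ι → ℂ) :
    ‖stepFun U x c y‖ₑ = ∑' i, ‖c i‖ₑ * U.indicator (fun _ => 1) ((x i)⁻¹ * y) := by
  have h0 : ∀ i ∉ hfin.toFinset, U.indicator (fun _ => (1 : ℝ)) ((x i)⁻¹ * y) = 0 := fun i hi =>
    indicator_of_notMem (by simpa using hi) _
  have h0' : ∀ i ∉ hfin.toFinset, U.indicator (fun _ => (1 : ℝ≥0∞)) ((x i)⁻¹ * y) = 0 :=
    fun i hi => indicator_of_notMem (by simpa using hi) _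
  rw [stepFun, tsum_eq_sum (s := hfin.toFinset) fun i hi => by rw [h0 i hi, mul_zero],
    tsum_eq_sum (s := hfin.toFinset) fun i hi => by rw [h0' i hi, mul_zero]]
  have hnn : ∀ i, 0 ≤ U.indicator (fun _ => (1 : ℝ)) ((x i)⁻¹ * y) := fun i =>
    indicator_nonneg (fun _ _ => zero_le_one) _
  rw [← ofReal_norm, Complex.norm_real, Real.norm_of_nonneg (Finset.sum_nonneg fun i _ =>
    mul_nonneg (norm_nonneg _) (hnn i)), ENNReal.ofReal_sum_of_nonneg fun i _ =>
    mul_nonneg (norm_nonneg _) (hnn i)]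
  refine Finset.sum_congr rfl fun i _ => ?_
  rw [ENNReal.ofReal_mul (norm_nonneg _), ofReal_norm]
  by_cases hi : (x i)⁻¹ * y ∈ U <;> simp [hi]

lemma measurable_stepFun [Countable ι] (hx : WellSpread x) {U : Set G} (hU : IsCompact U)
    (c : ι → ℂ) : Measurable (stepFun U x c) := by
  have hm : Measurable fun y => ∑' i, ‖c i‖ₑ * U.indicator (fun _ => 1) ((x i)⁻¹ * y) :=
    Measurable.tsum fun i => ((measurable_const.indicator hU.measurableSet).comp
      (measurable_const_mul _)).const_mul _
  have hnn : ∀ y, 0 ≤ ∑' i, ‖c i‖ * U.indicator (fun _ => (1 : ℝ)) ((x i)⁻¹ * y) := fun y =>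
    tsum_nonneg fun i => mul_nonneg (norm_nonneg _) (indicator_nonneg (fun _ _ => zero_le_one) _)
  have h1 : stepFun U x c = fun y => ((‖stepFun U x c y‖ₑ.toReal : ℝ) : ℂ) := by
    ext y
    rw [toReal_enorm, stepFun, Complex.norm_real, Real.norm_of_nonneg (hnn y)]
  rw [h1]
  simp only [enorm_stepFun (hx.finite hU _)]
  exact Complex.measurable_ofReal.comp hm.ennreal_toReal

variable {μ : Measure G} {B : Type*} [NormedAddCommGroup B] [NormedSpace ℂ B] {𝓑 : BFSpace μ B}

lemma seqNorm_eq {U : Set G} {c : ι → ℂ} {f : B} (hf : 𝓑.Rep f (stepFun U x c)) :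
    seqNorm 𝓑 U x c = ‖f‖ := by
  have h : MemSeq 𝓑 U x c := ⟨f, hf⟩
  rw [seqNorm, dif_pos h, h.choose_spec.unique hf]

variable [CompleteSpace B]

lemma MemSeq.dom [Countable ι] (hs : 𝓑.Solid) (hx : WellSpread x) {U : Set G}
    (hU : IsCompact U) {c : ι → ℂ} (hc : MemSeq 𝓑 U x c) :
    𝓑.Dom (fun y => ∑' i, ‖c i‖ₑ * U.indicator (fun _ => 1) ((x i)⁻¹ * y))
      (hs.const * seqNorm 𝓑 U x c) := by
  obtain ⟨f, hf⟩ := hc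
  rw [seqNorm_eq hf]
  refine (hs.dom hf).mono (fun y => ?_) le_rfl
  rw [enorm_stepFun (hx.finite hU y)]

lemma BFSpace.Dom.memSeq [Countable ι] (hs : 𝓑.Solid) (hx : WellSpread x) {U : Set G}
    (hU : IsCompact U) {c : ι → ℂ} {M : ℝ}
    (hc : 𝓑.Dom (fun y => ∑' i, ‖c i‖ₑ * U.indicator (fun _ => 1) ((x i)⁻¹ * y)) M) :
    MemSeq 𝓑 U x c ∧ seqNorm 𝓑 U x c ≤ hs.const * M := by
  obtain ⟨f, hf, hfn⟩ := hc.exists_rep hs (measurable_stepFun hx hU c).aestronglyMeasurable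
    (Eventually.of_forall fun y => by rw [enorm_stepFun (hx.finite hU y)])
  exact ⟨⟨f, hf⟩, by rwa [seqNorm_eq hf]⟩

/-- If `C_c(G)` is dense in the BF-space, then the tails of a member of the sequence space tend to
zero. -/
lemma MemSeq.exists_tail_le [Countable ι] (hs : 𝓑.Solid) (hd : 𝓑.CcDense) (hx : WellSpread x)
    {U : Set G} (hU : IsCompact U) {c : ι → ℂ} (hc : MemSeq 𝓑 U x c) {δ : ℝ} (hδ : 0 < δ) :
    ∃ J₀ : Finset ι, ∀ J, J₀ ⊆ J → ∀ c' : ι → ℂ, (∀ i ∈ J, c' i = 0) → (∀ i, ‖c' i‖ ≤ ‖c i‖) →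
      𝓑.Dom (fun y => ∑' i, ‖c' i‖ₑ * U.indicator (fun _ => 1) ((x i)⁻¹ * y)) δ := by
  obtain ⟨f, hf⟩ := hc
  have hs0 := hs.const_pos
  obtain ⟨g, ⟨g₀, hgc, hgs, hg⟩, hfg⟩ := hd.exists_dist_lt f (ε := δ / hs.const) (by positivity)
  have hQ : IsCompact (U * (tsupport g₀)⁻¹) := hU.mul hgs.isCompact.inv
  refine ⟨(hx.finite hQ 1).toFinset, fun J hJ c' hJ0 hle => ?_⟩
  refine (hs.dom (hf.sub hg)).mono (fun y => ?_) ?_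
  · by_cases hy : y ∈ tsupport g₀
    · -- all the sets `xᵢU` containing `y` belong to indices in `J`
      refine le_trans (le_of_eq ?_) zero_le
      refine ENNReal.tsum_eq_zero.2 fun i => ?_
      by_cases hi : (x i)⁻¹ * y ∈ U
      · rw [hJ0 i (hJ ?_), enorm_zero, zero_mul]
        rw [Finite.mem_toFinset]
        exact ⟨_, hi, y⁻¹, inv_mem_inv.2 hy, by simp⟩
      · rw [indicator_of_notMem hi, mul_zero]
    · rw [image_eq_zero_of_notMem_tsupport hy, sub_zero, enorm_stepFun (hx.finite hU y)]
      refine ENNReal.tsum_le_tsum fun i => mul_le_mul_left ?_ _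
      rw [← ofReal_norm, ← ofReal_norm]
      exact ENNReal.ofReal_le_ofReal (hle i)
  · rw [dist_eq_norm] at hfg
    calc hs.const * ‖f - g‖ ≤ hs.const * (δ / hs.const) := by gcongr
      _ = δ := by field_simp

end Sequences

/-! ### Synthesis -/

section Synthesis

variable {n : ℕ} {G S : Type*} [TopologicalSpace G] [ChartedSpace (EuclideanSpace ℝ (Fin n)) G]
  [Group G] [LieGroup (𝓡 n) ∞ G] [IsTopologicalGroup G] [T2Space G]
  [LocallyCompactSpace G] [SecondCountableTopology G] [MeasurableSpace G] [BorelSpace G]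
  [AddCommGroup S] [Module ℂ S] [TopologicalSpace S] [Nontrivial S]
  {μ : Measure G} [μ.IsHaarMeasure]
  {B : Type*} [NormedAddCommGroup B] [NormedSpace ℂ B] [CompleteSpace B]
  {ρ : ProjRep G S} {j : S →ₗ[ℂ] (S →L⋆[ℂ] ℂ)} {𝓑 : BFSpace μ B} {u : S} {ι : Type}

lemma enorm_le_tsum_of_hasSum {t : ι → ℂ} {s : ℂ} (h : HasSum t s) : ‖s‖ₑ ≤ ∑' i, ‖t i‖ₑ := by
  refine le_of_tendsto (h.enorm) (Eventually.of_forall fun J => ?_)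
  exact (enorm_sum_le _ _).trans (ENNReal.sum_le_tsum J)

lemma enorm_tsum_le (t : ι → ℂ) : ‖∑' i, t i‖ₑ ≤ ∑' i, ‖t i‖ₑ := by
  by_cases h : Summable t
  · exact enorm_le_tsum_of_hasSum h.hasSum
  · rw [tsum_eq_zero_of_not_summable h, enorm_zero]; exact zero_le

/-- Sums of elements of the BF-space that are dominated absolutely may be synthesized termwise. -/
lemma CoorbitAssumption.exists_sum_of_dom [Countable ι] (hc : CoorbitAssumption ρ j 𝓑 u)
    (hs : 𝓑.Solid) {g : ι → B} {g₀ : ι → G → ℂ} (hg : ∀ i, 𝓑.Rep (g i) (g₀ i)) {M : ℝ}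
    (hM : 𝓑.Dom (fun y => ∑' i, ‖g₀ i y‖ₑ) M) :
    ∃ b : B, 𝓑.Rep b (fun y => ∑' i, g₀ i y) ∧ ‖b‖ ≤ hs.const * M ∧
      ∀ v, HasSum (fun i => hc.synth (g i) v) (hc.synth b v) := by
  have hm : ∀ i, AEStronglyMeasurable (g₀ i) μ := fun i => (hg i).aestronglyMeasurable
  obtain ⟨b, hb, hbn⟩ := hM.exists_rep hs (AEStronglyMeasurable.tsum hm)
    (Eventually.of_forall fun y => enorm_tsum_le _)
  refine ⟨b, hb, hbn, fun v => ?_⟩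
  obtain ⟨C, -, hC⟩ := hc.exists_lintegral_dom_le hs v
  have hi : ∀ i, Integrable (fun y => g₀ i y * ρ.dual y (j u) v) μ := fun i =>
    hc.integrable_pairing_rep (hg i) v
  have hfin : ∑' i, ∫⁻ y, ‖g₀ i y * ρ.dual y (j u) v‖ₑ ∂μ ≠ ⊤ := by
    rw [← lintegral_tsum fun i => (hi i).1.enorm]
    refine ((le_of_eq (lintegral_congr fun y => ?_)).trans (hC _ M hM)).trans_lt
      ENNReal.ofReal_lt_top |>.ne
    simp only [enorm_mul]
    rw [ENNReal.tsum_mul_right]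
  have hsum : Summable fun i => ∫ y, ‖g₀ i y * ρ.dual y (j u) v‖ ∂μ := by
    refine (ENNReal.summable_toReal hfin).congr fun i => ?_
    exact (integral_norm_eq_lintegral_enorm (hi i).1).symm
  have key := hasSum_integral_of_summable_integral_norm hi hsum
  rw [hc.synth_apply hb]
  simp only [hc.synth_apply (hg _)]
  simpa only [tsum_mul_right] using key

namespace SamplingAssumption

/-- The reproducing kernel space `{f ∈ B | f # W_u(u) = f}`. -/
noncomputable abbrev kernelSpace (_ : SamplingAssumption n ρ j 𝓑 u) : Submodule ℂ B :=
  𝓑.repro ρ.σ (ρ.wav u (j u))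

variable (X : Module.Basis (Fin n) ℝ (GroupLieAlgebra (𝓡 n) G))

include X in
/-- Sums of translates of the reproducing kernel are dominated if the coefficients are bounded by
integrals of functions concentrated near the sampling points. -/
theorem exists_dom_synthesis (h : SamplingAssumption n ρ j 𝓑 u) {K : Set G} (hK : IsCompact K) :
    ∃ C : ℝ, 0 ≤ C ∧ ∀ {ι : Type} [Countable ι] (x : ι → G) (c : ι → ℂ) (a : ι → G → ℝ≥0∞) (M : ℝ),
      (∀ i, AEMeasurable (a i) μ) → (∀ i, ‖c i‖ₑ ≤ ∫⁻ y, a i y ∂μ) →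
      (∀ i y, a i y ≠ 0 → y⁻¹ * x i ∈ K) → 𝓑.Dom (fun y => ∑' i, a i y) M →
      𝓑.Dom (fun z => ∑' i, ‖c i‖ₑ * ‖ρ.wav u (j u) ((x i)⁻¹ * z)‖ₑ) (C * M) := by
  obtain ⟨C, hC0, hC⟩ := h.domConv_left_max X hK
  refine ⟨C, hC0, fun {ι} _ x c a M ham hca hsupp hM => (hC _ M hM).mono (fun z => ?_) le_rfl⟩
  calc ∑' i, ‖c i‖ₑ * ‖ρ.wav u (j u) ((x i)⁻¹ * z)‖ₑ
      ≤ ∑' i, ∫⁻ y, a i y * ‖ρ.wav u (j u) ((x i)⁻¹ * z)‖ₑ ∂μ := by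
        refine ENNReal.tsum_le_tsum fun i => ?_
        rw [lintegral_mul_const' _ _ enorm_ne_top]
        exact mul_le_mul_left (hca i) _
    _ = ∫⁻ y, ∑' i, a i y * ‖ρ.wav u (j u) ((x i)⁻¹ * z)‖ₑ ∂μ :=
        (lintegral_tsum fun i => (ham i).mul_const _).symm
    _ ≤ _ := by
        refine lintegral_mono fun y => ?_
        rw [← ENNReal.tsum_mul_right]
        refine ENNReal.tsum_le_tsum fun i => ?_
        by_cases h0 : a i y = 0
        · simp [h0]
        · refine mul_le_mul_right ?_ _
          refine le_trans (le_of_eq ?_) (le_iSup₂ (f := fun τ _ =>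
            ‖ρ.wav u (j u) (τ⁻¹ * (y⁻¹ * z))‖ₑ) (y⁻¹ * x i) (hsupp i y h0))
          simp [mul_assoc]

lemma enorm_wav_dual (x z : G) :
    ‖ρ.wav u (ρ.dual x (j u)) z‖ₑ = ‖ρ.wav u (j u) (x⁻¹ * z)‖ₑ := ρ.enorm_dual_apply x z u (j u)

include X in
/-- The translates `ρ*(x)u` of the analyzing vector belong to the coorbit space. -/
lemma exists_rep_dual [Nontrivial B] (h : SamplingAssumption n ρ j 𝓑 u) (x : G) :
    ∃ f : h.kernelSpace, 𝓑.Rep (f : B) (ρ.wav u (ρ.dual x (j u))) := by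
  obtain ⟨W, hW, hWn⟩ := exists_compact_mem_nhds (1 : G)
  have hxW : IsCompact ((fun g => x * g) '' W) := hW.image (continuous_const_mul x)
  have hWm : μ ((fun g => x * g) '' W) ≠ 0 := by
    refine (Measure.measure_pos_of_mem_nhds μ (x := x) ?_).ne'
    simpa using (Homeomorph.mulLeft x).isOpenMap.image_mem_nhds hWn
  obtain ⟨C, -, hC⟩ := h.exists_dom_synthesis X hW.inv
  obtain ⟨M, hM⟩ := BFSpace.exists_dom_indicator h.solid h.locInt h.bddTransl_right h.cont_right
    hxW
  set d : ℝ≥0 := (μ ((fun g => x * g) '' W))⁻¹.toNNReal with hd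
  have hd' : (d : ℝ≥0∞) = (μ ((fun g => x * g) '' W))⁻¹ :=
    ENNReal.coe_toNNReal (ENNReal.inv_ne_top.2 hWm)
  have key := hC (ι := Unit) (fun _ => x) (fun _ => 1)
    (fun _ y => d * ((fun g => x * g) '' W).indicator (fun _ => 1) y) (d * M)
    (fun _ => ((measurable_const.indicator hxW.measurableSet).const_mul _).aemeasurable)
    (fun _ => by
      rw [lintegral_const_mul _ (measurable_const.indicator hxW.measurableSet),
        lintegral_indicator hxW.measurableSet, lintegral_one, Measure.restrict_apply_univ, hd',
        ENNReal.inv_mul_cancel hWm hxW.measure_lt_top.ne]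
      simp)
    (fun _ y hy => by
      obtain ⟨w, hw, rfl⟩ : y ∈ (fun g => x * g) '' W := by
        by_contra hy'
        rw [indicator_of_notMem hy', mul_zero] at hy
        exact hy rfl
      simpa using hw)
    (by simpa using hM.const_mul d)
  obtain ⟨f, hf, -⟩ := h.exists_rep_of_dom (l := ρ.dual x (j u)) key fun z => by
    rw [enorm_wav_dual]; simp
  exact ⟨f, hf⟩

include X in
/-- Dominated coefficient families define functionals by weakly unconditionally convergent series
of translates of the analyzing vector. -/
lemma exists_synthesis [Nontrivial B] [Countable ι] (h : SamplingAssumption n ρ j 𝓑 u)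
    {x : ι → G} {c : ι → ℂ} {M : ℝ}
    (hM : 𝓑.Dom (fun z => ∑' i, ‖c i‖ₑ * ‖ρ.wav u (j u) ((x i)⁻¹ * z)‖ₑ) M) :
    ∃ γ : S →L⋆[ℂ] ℂ, (∀ v, HasSum (fun i => c i * ρ.dual (x i) (j u) v) (γ v)) ∧
      𝓑.Dom (fun z => ‖ρ.wav u γ z‖ₑ) M := by
  choose a ha using h.exists_rep_dual X
  obtain ⟨b, -, -, hb⟩ := h.exists_sum_of_dom h.solid (g := fun i => c i • (a (x i) : B))
    (g₀ := fun i z => c i * ρ.wav u (ρ.dual (x i) (j u)) z) (fun i => (ha (x i)).smul (c i))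
    (M := M) (by simpa only [enorm_mul, enorm_wav_dual] using hM)
  have hsum : ∀ v, HasSum (fun i => c i * ρ.dual (x i) (j u) v) (h.synth b v) := fun v => by
    refine (hb v).congr_fun fun i => ?_
    rw [h.synth_smul, h.synth_eq_of_rep (ha (x i))]
    rfl
  refine ⟨h.synth b, hsum, hM.mono (fun z => ?_) le_rfl⟩
  refine (enorm_le_tsum_of_hasSum (hsum (ρ.toFun z u))).trans (le_of_eq (tsum_congr fun i => ?_))
  rw [enorm_mul, ρ.enorm_dual_apply]

/-- Bounded operators on the reproducing kernel space given by weakly convergent series. -/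
lemma exists_operator_of_hasSum (h : SamplingAssumption n ρ j 𝓑 u) (e : ι → S →L⋆[ℂ] ℂ)
    (Λ : h.kernelSpace → ι → ℂ) (hadd : ∀ f g i, Λ (f + g) i = Λ f i + Λ g i)
    (hsmul : ∀ (c : ℂ) f i, Λ (c • f) i = c * Λ f i) {C : ℝ}
    (hex : ∀ f, ∃ γ : S →L⋆[ℂ] ℂ, (∀ v, HasSum (fun i => Λ f i * e i v) (γ v)) ∧
      𝓑.Dom (fun z => ‖ρ.wav u γ z‖ₑ) (C * ‖f‖)) :
    ∃ T : h.kernelSpace →L[ℂ] h.kernelSpace,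
      ∀ f v, HasSum (fun i => Λ f i * e i v) (h.synth (T f : B) v) := by
  choose τ hτ hτd using hex
  obtain ⟨T, hT⟩ := h.exists_operator τ
    (fun f g => by
      ext v
      refine (hτ (f + g) v).unique ?_
      have := (hτ f v).add (hτ g v)
      simp only [hadd, add_mul]
      exact this)
    (fun c f => by
      ext v
      refine (hτ (c • f) v).unique ?_
      have := (hτ f v).mul_left c
      simp only [hsmul, mul_assoc]
      exact this) hτd
  refine ⟨T, fun f v => ?_⟩
  rw [h.synth_eq_of_rep (hT f)]
  exact hτ f v

end SamplingAssumption
end Synthesis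

/-! ### The sampling operators -/

lemma enorm_ofReal_eq {r : ℝ} (hr : 0 ≤ r) : ‖(r : ℂ)‖ₑ = ENNReal.ofReal r := by
  rw [← ofReal_norm, Complex.norm_real, Real.norm_of_nonneg hr]

lemma enorm_mul_circle (z : Circle) (w : ℂ) : ‖w * conj (z : ℂ)‖ₑ = ‖w‖ₑ := by
  rw [← ofReal_norm, norm_mul, RCLike.norm_conj, Circle.norm_coe, mul_one, ofReal_norm]

namespace IsBUPU

variable {G : Type*} [TopologicalSpace G] [Group G] [IsTopologicalGroup G] [T2Space G]
  [MeasurableSpace G] [BorelSpace G] {ι : Type} {U : Set G} {x : ι → G} {ψ : ι → G → ℝ}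

lemma mem_inv (hψ : IsBUPU U x ψ) {i : ι} {y : G} (h : ψ i y ≠ 0) : y⁻¹ * x i ∈ U⁻¹ := by
  have := hψ.supp i y h
  simpa using this

lemma tsum_ofReal (hψ : IsBUPU U x ψ) (y : G) : ∑' i, ENNReal.ofReal (ψ i y) = 1 := by
  rw [← ENNReal.ofReal_tsum_of_nonneg (fun i => hψ.nonneg i y) (hψ.sum_one y).summable,
    (hψ.sum_one y).tsum_eq, ENNReal.ofReal_one]

lemma tsum_mul_le (hψ : IsBUPU U x ψ) {y : G} {A : ι → ℝ≥0∞} {D : ℝ≥0∞}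
    (hA : ∀ i, y⁻¹ * x i ∈ U⁻¹ → A i ≤ D) : ∑' i, ENNReal.ofReal (ψ i y) * A i ≤ D := by
  calc ∑' i, ENNReal.ofReal (ψ i y) * A i ≤ ∑' i, ENNReal.ofReal (ψ i y) * D := by
        refine ENNReal.tsum_le_tsum fun i => ?_
        by_cases h0 : ψ i y = 0
        · simp [h0]
        · exact mul_le_mul_right (hA i (hψ.mem_inv h0)) _
    _ = D := by rw [ENNReal.tsum_mul_right, hψ.tsum_ofReal, one_mul]

lemma ofReal_le_indicator (hψ : IsBUPU U x ψ) (i : ι) (y : G) :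
    ENNReal.ofReal (ψ i y) ≤ U.indicator (fun _ => 1) ((x i)⁻¹ * y) := by
  by_cases h0 : ψ i y = 0
  · simp [h0]
  · rw [indicator_of_mem (hψ.supp i y h0)]
    exact ENNReal.ofReal_le_one.2 (hψ.le_one i y)

lemma lintegral_le (hψ : IsBUPU U x ψ) (hU : IsCompact U) (μ : Measure G) [μ.IsHaarMeasure]
    (i : ι) : ∫⁻ y, ENNReal.ofReal (ψ i y) ∂μ ≤ μ U := by
  calc ∫⁻ y, ENNReal.ofReal (ψ i y) ∂μ
      ≤ ∫⁻ y, U.indicator (fun _ => 1) ((x i)⁻¹ * y) ∂μ :=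
        lintegral_mono fun y => hψ.ofReal_le_indicator i y
    _ = μ U := by
        rw [lintegral_mul_left_eq_self (fun y => U.indicator (fun _ => (1 : ℝ≥0∞)) y),
          lintegral_indicator hU.measurableSet, lintegral_one, Measure.restrict_apply_univ]

lemma integrable (hψ : IsBUPU U x ψ) (hU : IsCompact U) (μ : Measure G) [μ.IsHaarMeasure]
    (i : ι) : Integrable (ψ i) μ := by
  refine ⟨(hψ.measurable i).aestronglyMeasurable, ?_⟩
  rw [hasFiniteIntegral_iff_ofReal (Eventually.of_forall fun y => hψ.nonneg i y)]
  exact (hψ.lintegral_le hU μ i).trans_lt hU.measure_lt_top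

lemma enorm_wt (hψ : IsBUPU U x ψ) (hU : IsCompact U) (μ : Measure G) [μ.IsHaarMeasure]
    (i : ι) : ‖wt μ ψ i‖ₑ = ∫⁻ y, ENNReal.ofReal (ψ i y) ∂μ := by
  rw [wt, enorm_ofReal_eq (integral_nonneg fun y => hψ.nonneg i y),
    ofReal_integral_eq_lintegral_ofReal (hψ.integrable hU μ i)
      (Eventually.of_forall fun y => hψ.nonneg i y)]

lemma enorm_twBump (hψ : IsBUPU U x ψ) (σ : G → G → Circle) (i : ι) (y : G) :
    ‖twBump σ x ψ i y‖ₑ = ENNReal.ofReal (ψ i y) := by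
  rw [twBump, ← ofReal_norm, norm_circle_mul, ofReal_norm, enorm_ofReal_eq (hψ.nonneg i y)]

end IsBUPU

section Twist

variable {G S : Type*} [TopologicalSpace G] [Group G] [IsTopologicalGroup G] [T2Space G]
  [LocallyCompactSpace G] [SecondCountableTopology G] [MeasurableSpace G] [BorelSpace G]
  [AddCommGroup S] [Module ℂ S] [TopologicalSpace S]
  {ι : Type} {U : Set G} {x : ι → G} {ψ : ι → G → ℝ}

lemma ProjRep.measurable_twist (ρ : ProjRep G S) (x : G) :
    Measurable fun y => (ρ.σ y (y⁻¹ * x) : ℂ) :=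
  ρ.measurable_σ.comp (measurable_id.prodMk (measurable_inv.mul_const x))

lemma ProjRep.twist_mul_apply (ρ : ProjRep G S) (l : S →L⋆[ℂ] ℂ) (v : S) (x y : G) :
    l (ρ.toFun x v) * (ρ.σ y (y⁻¹ * x) : ℂ) = l (ρ.toFun y (ρ.toFun (y⁻¹ * x) v)) := by
  have := ρ.apply_mul y (y⁻¹ * x) v l
  rw [mul_inv_cancel_left] at this
  rw [this, mul_right_comm, conj_circle_mul_self, one_mul]

lemma ProjRep.conj_twist_mul_dual (ρ : ProjRep G S) (l : S →L⋆[ℂ] ℂ) (w : S) (x y : G) :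
    conj (ρ.σ y (y⁻¹ * x) : ℂ) * ρ.dual x l w =
      ρ.dual (y⁻¹ * x) l ((ρ.toFun y).symm w) := by
  have := ρ.dual_mul y (y⁻¹ * x) l w
  rw [mul_inv_cancel_left] at this
  rw [this, ← mul_assoc, conj_circle_mul_self, one_mul]

lemma IsBUPU.measurable_twBump (ρ : ProjRep G S) (hψ : IsBUPU U x ψ) (i : ι) : Measurable (twBump ρ.σ x ψ i) :=
  (ρ.measurable_twist (x i)).mul (Complex.measurable_ofReal.comp (hψ.measurable i))

lemma IsBUPU.summable_mul_twBump (hψ : IsBUPU U x ψ) (hU : IsCompact U) (hx : WellSpread x)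
    (σ : G → G → Circle) (c : ι → ℂ) (y : G) : Summable fun i => c i * twBump σ x ψ i y := by
  refine summable_of_hasFiniteSupport ((hx.finite hU y).subset fun i hi => ?_)
  refine hψ.supp i y fun h0 => hi ?_
  simp [twBump, h0]

lemma le_sup_right {K : Set G} (F : G → ℂ) {x y : G} (h : y⁻¹ * x ∈ K) :
    ‖F x‖ₑ ≤ ⨆ τ ∈ K, ‖F (y * τ)‖ₑ := by
  refine le_trans (le_of_eq ?_) (le_iSup₂ (f := fun τ _ => ‖F (y * τ)‖ₑ) (y⁻¹ * x) h)
  rw [mul_inv_cancel_left]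

end Twist

section Operators

variable {n : ℕ} {G S : Type*} [TopologicalSpace G] [ChartedSpace (EuclideanSpace ℝ (Fin n)) G]
  [Group G] [LieGroup (𝓡 n) ∞ G] [IsTopologicalGroup G] [T2Space G]
  [LocallyCompactSpace G] [SecondCountableTopology G] [MeasurableSpace G] [BorelSpace G]
  [AddCommGroup S] [Module ℂ S] [TopologicalSpace S] [Nontrivial S]
  {μ : Measure G} [μ.IsHaarMeasure]
  {B : Type*} [NormedAddCommGroup B] [NormedSpace ℂ B] [CompleteSpace B] [Nontrivial B]
  {ρ : ProjRep G S} {j : S →ₗ[ℂ] (S →L⋆[ℂ] ℂ)} {𝓑 : BFSpace μ B} {u : S}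
  {ι : Type} [Countable ι] {U : Set G} {x : ι → G} {ψ : ι → G → ℝ}

namespace SamplingAssumption

variable (X : Module.Basis (Fin n) ℝ (GroupLieAlgebra (𝓡 n) G))

lemma exists_rep_twBump (h : SamplingAssumption n ρ j 𝓑 u) (hU : IsCompact U)
    (hψ : IsBUPU U x ψ) (i : ι) : ∃ e : B, 𝓑.Rep e (twBump ρ.σ x ψ i) := by
  obtain ⟨M, hM⟩ := BFSpace.exists_dom_indicator h.solid h.locInt h.bddTransl_right h.cont_right
    (hU.image (continuous_const_mul (x i)))
  obtain ⟨e, he, -⟩ := hM.exists_rep h.solid (hψ.measurable_twBump ρ i).aestronglyMeasurable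
    (Eventually.of_forall fun y => by
      rw [hψ.enorm_twBump]
      refine (hψ.ofReal_le_indicator i y).trans ?_
      by_cases hy : (x i)⁻¹ * y ∈ U
      · have hy' : y ∈ (fun g => x i * g) '' U := ⟨_, hy, by simp⟩
        rw [indicator_of_mem hy, indicator_of_mem hy']
      · rw [indicator_of_notMem hy]; exact zero_le)
  exact ⟨e, he⟩

/-- Sums of multiples of the bumps `σ(·, ·⁻¹xᵢ)ψᵢ`. -/
lemma exists_bump_sum (h : SamplingAssumption n ρ j 𝓑 u) (hψ : IsBUPU U x ψ) {e : ι → B}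
    (he : ∀ i, 𝓑.Rep (e i) (twBump ρ.σ x ψ i)) {c : ι → ℂ} {M : ℝ}
    (hc : 𝓑.Dom (fun y => ∑' i, ENNReal.ofReal (ψ i y) * ‖c i‖ₑ) M) :
    ∃ b : B, 𝓑.Rep b (fun y => ∑' i, c i * twBump ρ.σ x ψ i y) ∧ ‖b‖ ≤ h.solid.const * M ∧
      ∀ v, HasSum (fun i => c i * h.synth (e i) v) (h.synth b v) := by
  obtain ⟨b, hb, hbn, hsum⟩ := h.exists_sum_of_dom h.solid (g := fun i => c i • e i)
    (g₀ := fun i y => c i * twBump ρ.σ x ψ i y) (fun i => (he i).smul (c i)) (M := M) (by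
      refine hc.mono (fun y => le_of_eq (tsum_congr fun i => ?_)) le_rfl
      rw [enorm_mul, hψ.enorm_twBump, mul_comm])
  refine ⟨b, hb, hbn, fun v => (hsum v).congr_fun fun i => ?_⟩
  rw [h.synth_smul]; rfl

include X in
lemma exists_dom_sample (h : SamplingAssumption n ρ j 𝓑 u) (hU : IsCompact U)
    (hψ : IsBUPU U x ψ) : ∃ C : ℝ, 0 ≤ C ∧ ∀ f : B,
      𝓑.Dom (fun y => ∑' i, ENNReal.ofReal (ψ i y) * ‖ρ.wav u (h.synth f) (x i)‖ₑ)
        (C * ‖f‖) := by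
  obtain ⟨C, hC0, hC⟩ := h.exists_right_max X hU.inv
  exact ⟨C, hC0, fun f => (hC f).mono (fun y => hψ.tsum_mul_le fun i hi => le_sup_right _ hi)
    le_rfl⟩

include X in
/-- The operator sampling a function and interpolating by the twisted bumps. -/
theorem exists_isT1 (h : SamplingAssumption n ρ j 𝓑 u) (hU : IsCompact U) (hx : WellSpread x)
    (hψ : IsBUPU U x ψ) : ∃ T : h.kernelSpace →L[ℂ] h.kernelSpace,
      IsT1 𝓑 ρ.σ (ρ.wav u (j u)) x ψ T := by
  choose e he using h.exists_rep_twBump hU hψ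
  obtain ⟨C, hC0, hC⟩ := h.exists_dom_sample X hU hψ
  obtain ⟨C', hC0', hC'⟩ := h.exists_dom_wav_synth
  choose b hb hbn hbs using fun f : h.kernelSpace => h.exists_bump_sum hψ he (hC f)
  obtain ⟨T, hT⟩ := h.exists_operator_of_hasSum (fun i => h.synth (e i))
    (fun f i => ρ.wav u (h.synth (f : B)) (x i))
    (fun f g i => by
      have := h.synth_add (f : B) g
      show h.synth ((f : B) + g) _ = _
      rw [this]; rfl)
    (fun c f i => by
      have := h.synth_smul c (f : B)
      show h.synth (c • (f : B)) _ = _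
      rw [this]; rfl)
    (C := C' * (h.solid.const * C)) fun f => ⟨h.synth (b f), hbs f, (hC' (b f)).mono
      (fun z => le_rfl) (by
        have := mul_le_mul_of_nonneg_left (hbn f) hC0'
        calc C' * ‖b f‖ ≤ _ := this
          _ = _ := by rw [mul_assoc, mul_assoc]; rfl)⟩
  refine ⟨T, fun f => ⟨fun y => hψ.summable_mul_twBump hU hx _ _ y, fun z => ?_⟩⟩
  have h1 : 𝓑.Rep (b f) (fun y => ∑' i, 𝓑.ev ρ.σ (ρ.wav u (j u)) (f : B) (x i) *
      twBump ρ.σ x ψ i y) := by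
    simp only [h.ev_eq]; exact hb f
  refine ⟨h.twConvExists h1 u z, ?_⟩
  rw [h.twConv_eq_wav_synth h1, h.ev_eq]
  exact (hT f _).unique (hbs f _)

/-- The characterizing property of the first sampling operator in terms of functionals. -/
lemma IsT1.synth_eq (h : SamplingAssumption n ρ j 𝓑 u) {T : h.kernelSpace → h.kernelSpace}
    (hT : IsT1 𝓑 ρ.σ (ρ.wav u (j u)) x ψ T) {f : h.kernelSpace} {b : B}
    (hb : 𝓑.Rep b (fun y => ∑' i, ρ.wav u (h.synth (f : B)) (x i) * twBump ρ.σ x ψ i y)) :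
    h.synth (T f : B) = h.synth b := by
  refine h.analyzing.1.ext fun z => ?_
  have h1 : 𝓑.Rep b (fun y => ∑' i, 𝓑.ev ρ.σ (ρ.wav u (j u)) (f : B) (x i) *
      twBump ρ.σ x ψ i y) := by
    simp only [h.ev_eq]; exact hb
  rw [← h.ev_eq, (hT f).2 z |>.2, h.twConv_eq_wav_synth h1]

include X in
/-- Operators defined by series of translates of the reproducing kernel, with coefficients bounded
by integrals of functions concentrated near the sampling points. -/
lemma exists_synthesis_operator (h : SamplingAssumption n ρ j 𝓑 u) {K : Set G}
    (hK : IsCompact K) (Λ : h.kernelSpace → ι → ℂ) (hadd : ∀ f g i, Λ (f + g) i = Λ f i + Λ g i)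
    (hsmul : ∀ (c : ℂ) f i, Λ (c • f) i = c * Λ f i) {C : ℝ} (a : h.kernelSpace → ι → G → ℝ≥0∞)
    (ham : ∀ f i, AEMeasurable (a f i) μ) (hca : ∀ f i, ‖Λ f i‖ₑ ≤ ∫⁻ y, a f i y ∂μ)
    (hsupp : ∀ f i y, a f i y ≠ 0 → y⁻¹ * x i ∈ K)
    (hM : ∀ f, 𝓑.Dom (fun y => ∑' i, a f i y) (C * ‖f‖)) :
    ∃ T : h.kernelSpace →L[ℂ] h.kernelSpace,
      ∀ f v, HasSum (fun i => Λ f i * ρ.dual (x i) (j u) v) (h.synth (T f : B) v) := by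
  obtain ⟨C', hC0', hC'⟩ := h.exists_dom_synthesis X hK
  refine h.exists_operator_of_hasSum (fun i => ρ.dual (x i) (j u)) Λ hadd hsmul (C := C' * C)
    fun f => ?_
  obtain ⟨γ, hγ, hγd⟩ := h.exists_synthesis X
    (hC' x (Λ f) (a f) _ (ham f) (hca f) (hsupp f) (hM f))
  exact ⟨γ, hγ, hγd.mono (fun _ => le_rfl) (le_of_eq (by rw [mul_assoc]))⟩

lemma wav_synth_add (h : SamplingAssumption n ρ j 𝓑 u) (f g : B) (y : G) :
    ρ.wav u (h.synth (f + g)) y = ρ.wav u (h.synth f) y + ρ.wav u (h.synth g) y := by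
  rw [h.synth_add]; rfl

lemma wav_synth_smul (h : SamplingAssumption n ρ j 𝓑 u) (c : ℂ) (f : B) (y : G) :
    ρ.wav u (h.synth (c • f)) y = c * ρ.wav u (h.synth f) y := by
  rw [h.synth_smul]; rfl

lemma integrable_mul_bump (h : SamplingAssumption n ρ j 𝓑 u) (hU : IsCompact U)
    (hψ : IsBUPU U x ψ) (f : h.kernelSpace) (i : ι) :
    Integrable (fun y => ρ.wav u (h.synth (f : B)) y * (ψ i y : ℂ)) μ := by
  have hKc : IsCompact ((fun g => x i * g) '' U) := hU.image (continuous_const_mul (x i))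
  have hi := (integrable_indicator_iff hKc.measurableSet).2
    (h.locInt.integrableOn hKc Subset.rfl (f : B))
  refine hi.mono ((ρ.measurable_wav u _).mul
    (Complex.measurable_ofReal.comp (hψ.measurable i))).aestronglyMeasurable ?_
  filter_upwards [h.rep_of_mem_repro f.2] with y hy
  by_cases h0 : ψ i y = 0
  · simp [h0]
  · have hy' : y ∈ (fun g => x i * g) '' U := ⟨_, hψ.supp i y h0, by simp⟩
    rw [indicator_of_mem hy', hy, norm_mul, Complex.norm_real, Real.norm_of_nonneg (hψ.nonneg i y)]
    exact mul_le_of_le_one_right (norm_nonneg _) (hψ.le_one i y)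

lemma integrable_lam (h : SamplingAssumption n ρ j 𝓑 u) (hU : IsCompact U)
    (hψ : IsBUPU U x ψ) (f : h.kernelSpace) (i : ι) :
    Integrable (fun y => 𝓑.ev ρ.σ (ρ.wav u (j u)) (f : B) y * (ψ i y : ℂ) *
      conj (ρ.σ y (y⁻¹ * x i) : ℂ)) μ := by
  simp only [h.ev_eq]
  have hm : Measurable fun y => conj (ρ.σ y (y⁻¹ * x i) : ℂ) :=
    Complex.continuous_conj.measurable.comp (ρ.measurable_twist (x i))
  refine (h.integrable_mul_bump hU hψ f i).mul_bdd (c := 1) hm.aestronglyMeasurable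
    (Eventually.of_forall fun y => ?_)
  rw [RCLike.norm_conj, Circle.norm_coe]

lemma enorm_lam_le (h : SamplingAssumption n ρ j 𝓑 u) (hψ : IsBUPU U x ψ) (f : h.kernelSpace)
    (i : ι) : ‖lam 𝓑 ρ.σ (ρ.wav u (j u)) x ψ (f : B) i‖ₑ ≤
      ∫⁻ y, ENNReal.ofReal (ψ i y) * ‖ρ.wav u (h.synth (f : B)) y‖ₑ ∂μ := by
  refine (enorm_integral_le_lintegral_enorm _).trans (le_of_eq (lintegral_congr fun y => ?_))
  rw [enorm_mul_circle, enorm_mul, enorm_ofReal_eq (hψ.nonneg i y), h.ev_eq, mul_comm]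

lemma dom_kernelSpace (h : SamplingAssumption n ρ j 𝓑 u) (f : h.kernelSpace) :
    𝓑.Dom (fun y => ‖ρ.wav u (h.synth (f : B)) y‖ₑ) (h.solid.const * ‖f‖) :=
  h.solid.dom (h.rep_of_mem_repro f.2)

lemma lam_add (h : SamplingAssumption n ρ j 𝓑 u) (hU : IsCompact U) (hψ : IsBUPU U x ψ)
    (f g : h.kernelSpace) (i : ι) :
    lam 𝓑 ρ.σ (ρ.wav u (j u)) x ψ ((f + g : h.kernelSpace) : B) i =
      lam 𝓑 ρ.σ (ρ.wav u (j u)) x ψ (f : B) i + lam 𝓑 ρ.σ (ρ.wav u (j u)) x ψ (g : B) i := by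
  rw [lam, lam, lam, ← integral_add (h.integrable_lam hU hψ f i) (h.integrable_lam hU hψ g i)]
  congr 1 with y
  rw [h.ev_eq, h.ev_eq, h.ev_eq, Submodule.coe_add, h.wav_synth_add]
  ring

lemma lam_smul (h : SamplingAssumption n ρ j 𝓑 u) (c : ℂ) (f : h.kernelSpace) (i : ι) :
    lam 𝓑 ρ.σ (ρ.wav u (j u)) x ψ ((c • f : h.kernelSpace) : B) i =
      c * lam 𝓑 ρ.σ (ρ.wav u (j u)) x ψ (f : B) i := by
  rw [lam, lam, ← integral_const_mul]
  congr 1 with y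
  rw [h.ev_eq, h.ev_eq, Submodule.coe_smul, h.wav_synth_smul]
  ring

include X in
/-- The operator replacing a function by a sum of translates of the kernel with local averages as
coefficients. -/
theorem exists_isT2 (h : SamplingAssumption n ρ j 𝓑 u) (hU : IsCompact U)
    (hψ : IsBUPU U x ψ) : ∃ T : h.kernelSpace →L[ℂ] h.kernelSpace,
      IsT2 𝓑 ρ.σ (ρ.wav u (j u)) x ψ T := by
  obtain ⟨T, hT⟩ := h.exists_synthesis_operator X hU.inv (x := x)
    (fun f i => lam 𝓑 ρ.σ (ρ.wav u (j u)) x ψ (f : B) i) (h.lam_add hU hψ) h.lam_smul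
    (C := h.solid.const)
    (fun f i y => ENNReal.ofReal (ψ i y) * ‖ρ.wav u (h.synth (f : B)) y‖ₑ)
    (fun f i => ((hψ.measurable i).ennreal_ofReal.mul (ρ.measurable_wav u _).enorm).aemeasurable)
    (fun f i => h.enorm_lam_le hψ f i)
    (fun f i y h0 => hψ.mem_inv fun h1 => h0 (by simp [h1]))
    (fun f => (h.dom_kernelSpace f).mono (fun y => hψ.tsum_mul_le fun i _ => le_rfl) le_rfl)
  refine ⟨T, fun f => ⟨fun i => h.integrable_lam hU hψ f i, fun z => ?_⟩⟩
  rw [h.ev_eq]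
  refine (hT f (ρ.toFun z u)).congr_fun fun i => ?_
  rw [ρ.twL_wav]

include X in
/-- The operator replacing a function by a sum of translates of the kernel with weighted samples as
coefficients. -/
theorem exists_isT3 (h : SamplingAssumption n ρ j 𝓑 u) (hU : IsCompact U)
    (hψ : IsBUPU U x ψ) : ∃ T : h.kernelSpace →L[ℂ] h.kernelSpace,
      IsT3 𝓑 ρ.σ (ρ.wav u (j u)) x ψ T := by
  obtain ⟨C, hC0, hC⟩ := h.exists_dom_sample X hU hψ
  obtain ⟨T, hT⟩ := h.exists_synthesis_operator X hU.inv (x := x)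
    (fun f i => wt μ ψ i * 𝓑.ev ρ.σ (ρ.wav u (j u)) (f : B) (x i))
    (fun f g i => by
      simp only [h.ev_eq, Submodule.coe_add, h.wav_synth_add]; ring)
    (fun c f i => by
      simp only [h.ev_eq, Submodule.coe_smul, h.wav_synth_smul]; ring)
    (C := C)
    (fun f i y => ENNReal.ofReal (ψ i y) * ‖ρ.wav u (h.synth (f : B)) (x i)‖ₑ)
    (fun f i => ((hψ.measurable i).ennreal_ofReal.mul_const _).aemeasurable)
    (fun f i => by
      rw [enorm_mul, hψ.enorm_wt hU, h.ev_eq, lintegral_mul_const' _ _ enorm_ne_top])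
    (fun f i y h0 => hψ.mem_inv fun h1 => h0 (by simp [h1]))
    (fun f => hC f)
  refine ⟨T, fun i => hψ.integrable hU μ i, fun f z => ?_⟩
  rw [h.ev_eq]
  refine (hT f (ρ.toFun z u)).congr_fun fun i => ?_
  rw [ρ.twL_wav]

end SamplingAssumption
end Operators

/-! ### Invertibility of the sampling operators -/

section Invertible

variable {n : ℕ} {G S : Type*} [TopologicalSpace G] [ChartedSpace (EuclideanSpace ℝ (Fin n)) G]
  [Group G] [LieGroup (𝓡 n) ∞ G] [IsTopologicalGroup G] [T2Space G]
  [LocallyCompactSpace G] [SecondCountableTopology G] [MeasurableSpace G] [BorelSpace G]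
  [AddCommGroup S] [Module ℂ S] [TopologicalSpace S] [Nontrivial S]
  {μ : Measure G} [μ.IsHaarMeasure]
  {B : Type*} [NormedAddCommGroup B] [NormedSpace ℂ B] [CompleteSpace B] [Nontrivial B]
  {ρ : ProjRep G S} {j : S →ₗ[ℂ] (S →L⋆[ℂ] ℂ)} {𝓑 : BFSpace μ B} {u : S}

namespace SamplingAssumption

lemma norm_le_of_dom (h : SamplingAssumption n ρ j 𝓑 u) (g : h.kernelSpace) {Φ : G → ℝ≥0∞}
    {M : ℝ} (hΦ : 𝓑.Dom Φ M) (hle : ∀ z, ‖ρ.wav u (h.synth (g : B)) z‖ₑ ≤ Φ z) :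
    ‖g‖ ≤ h.solid.const * M := by
  obtain ⟨f, hf, hfn⟩ := h.exists_rep_of_dom hΦ hle
  have : g = f := Subtype.ext ((h.rep_of_mem_repro g.2).unique hf)
  rwa [this]

lemma synth_sub (h : SamplingAssumption n ρ j 𝓑 u) (f g : B) :
    h.synth (f - g) = h.synth f - h.synth g := by
  rw [eq_sub_iff_add_eq, ← h.synth_add, sub_add_cancel]

lemma wav_synth_sub (h : SamplingAssumption n ρ j 𝓑 u) (f g : B) (z : G) :
    ρ.wav u (h.synth (f - g)) z = ρ.wav u (h.synth f) z - ρ.wav u (h.synth g) z := by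
  rw [h.synth_sub]; rfl

/-- The difference between a value of a wavelet transform and a twisted sample is bounded by the
oscillation. -/
lemma enorm_sample_sub_le (h : SamplingAssumption n ρ j 𝓑 u) {V : Set G} (f : B) {x y : G}
    (hxy : y⁻¹ * x ∈ V) :
    ‖ρ.wav u (h.synth f) x * (ρ.σ y (y⁻¹ * x) : ℂ) - ρ.wav u (h.synth f) y‖ₑ ≤
      ⨆ τ ∈ V, ‖h.synth f (ρ.toFun y (ρ.toFun τ u)) - h.synth f (ρ.toFun y u)‖ₑ := by
  refine le_trans (le_of_eq ?_) (le_iSup₂ (f := fun τ _ =>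
    ‖h.synth f (ρ.toFun y (ρ.toFun τ u)) - h.synth f (ρ.toFun y u)‖ₑ) (y⁻¹ * x) hxy)
  rw [ProjRep.wav, ρ.twist_mul_apply]
  rfl

variable (X : Module.Basis (Fin n) ℝ (GroupLieAlgebra (𝓡 n) G))

include X in
/-- The first sampling operator is close to the identity on fine partitions of unity. -/
theorem exists_norm_sub_T1_le (h : SamplingAssumption n ρ j 𝓑 u) {δ : ℝ} (hδ : 0 < δ) :
    ∃ V ∈ 𝓝 (1 : G), ∀ {ι : Type} [Countable ι] {U : Set G} {x : ι → G} {ψ : ι → G → ℝ},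
      IsCompact U → WellSpread x → IsBUPU U x ψ → U⁻¹ ⊆ V →
      ∀ T : h.kernelSpace → h.kernelSpace, IsT1 𝓑 ρ.σ (ρ.wav u (j u)) x ψ T →
        ∀ f, ‖f - T f‖ ≤ δ * ‖f‖ := by
  obtain ⟨C, hC0, hC⟩ := h.exists_dom_wav_synth
  set A : ℝ := h.solid.const * C * h.solid.const with hA
  have hs0 := h.solid.const_pos
  have hA0 : 0 ≤ A := by positivity
  obtain ⟨V, hV, hosc⟩ := h.exists_right_osc X (δ := δ / (A + 1)) (by positivity)
  refine ⟨V, hV, fun {ι} _ U x ψ hU hx hψ hUV T hT f => ?_⟩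
  choose e he using h.exists_rep_twBump hU hψ
  obtain ⟨C₂, -, hC₂⟩ := h.exists_dom_sample X hU hψ
  obtain ⟨b, hb, -, -⟩ := h.exists_bump_sum hψ he (hC₂ (f : B))
  have hTf := IsT1.synth_eq h hT hb
  have hle : ∀ y, ‖ρ.wav u (h.synth (f : B)) y -
      ∑' i, ρ.wav u (h.synth (f : B)) (x i) * twBump ρ.σ x ψ i y‖ₑ ≤
      ⨆ τ ∈ V, ‖h.synth (f : B) (ρ.toFun y (ρ.toFun τ u)) -
        h.synth (f : B) (ρ.toFun y u)‖ₑ := by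
    intro y
    have h1 : HasSum (fun i => ((ψ i y : ℝ) : ℂ) * ρ.wav u (h.synth (f : B)) y)
        (ρ.wav u (h.synth (f : B)) y) := by
      have := (Complex.hasSum_ofReal.2 (hψ.sum_one y)).mul_right (ρ.wav u (h.synth (f : B)) y)
      simpa using this
    have h2 := h1.sub (hψ.summable_mul_twBump hU hx ρ.σ
      (fun i => ρ.wav u (h.synth (f : B)) (x i)) y).hasSum
    refine (enorm_le_tsum_of_hasSum h2).trans ?_
    refine le_trans (le_of_eq (tsum_congr fun i => ?_)) (hψ.tsum_mul_le (y := y)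
      (A := fun i => ‖ρ.wav u (h.synth (f : B)) (x i) * (ρ.σ y (y⁻¹ * x i) : ℂ) -
        ρ.wav u (h.synth (f : B)) y‖ₑ) fun i hi => h.enorm_sample_sub_le _ (hUV hi))
    rw [← enorm_ofReal_eq (hψ.nonneg i y), ← enorm_mul, ← enorm_neg]
    congr 1
    rw [twBump]; ring
  obtain ⟨d, hd, hdn⟩ := (hosc (f : B)).exists_rep h.solid
    (((h.rep_of_mem_repro f.2).sub hb).aestronglyMeasurable) (Eventually.of_forall hle)
  have hdb : d = f - b := hd.unique ((h.rep_of_mem_repro f.2).sub hb)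
  have key := h.norm_le_of_dom (f - T f) (hC d) fun z => by
    rw [hdb, h.wav_synth_sub, Submodule.coe_sub, h.wav_synth_sub]
    rw [ProjRep.wav, ProjRep.wav, ProjRep.wav, hTf]
  calc ‖f - T f‖ ≤ h.solid.const * (C * ‖d‖) := key
    _ ≤ h.solid.const * (C * (h.solid.const * (δ / (A + 1) * ‖f‖))) := by
        gcongr; exact hdn
    _ = δ * ‖f‖ * (A / (A + 1)) := by rw [hA]; ring
    _ ≤ δ * ‖f‖ * 1 := by
        gcongr
        exact div_le_one_of_le₀ (by linarith) (by positivity)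
    _ = δ * ‖f‖ := mul_one _

include X in
/-- The second sampling operator is close to the identity on fine partitions of unity: the error is
governed by the left oscillation of the reproducing kernel. -/
theorem exists_norm_sub_T2_le (h : SamplingAssumption n ρ j 𝓑 u) {δ : ℝ} (hδ : 0 < δ) :
    ∃ V ∈ 𝓝 (1 : G), ∀ {ι : Type} [Countable ι] {U : Set G} {x : ι → G} {ψ : ι → G → ℝ},
      IsCompact U → IsBUPU U x ψ → U⁻¹ ⊆ V →
      ∀ T : h.kernelSpace → h.kernelSpace, IsT2 𝓑 ρ.σ (ρ.wav u (j u)) x ψ T →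
        ∀ f, ‖f - T f‖ ≤ δ * ‖f‖ := by
  set A : ℝ := h.solid.const * h.solid.const with hA
  have hs0 := h.solid.const_pos
  have hA0 : 0 ≤ A := by positivity
  obtain ⟨V, hV, hosc⟩ := h.exists_left_osc X (δ := δ / (A + 1)) (by positivity)
  refine ⟨V, hV, fun {ι} _ U x ψ hU hψ hUV T hT f => ?_⟩
  set F : G → ℂ := ρ.wav u (h.synth (f : B)) with hF
  have hFm : Measurable F := ρ.measurable_wav u _
  have hFr : 𝓑.Rep (f : B) F := h.rep_of_mem_repro f.2
  have hg : ∀ i, ∃ g : B, 𝓑.Rep g (fun y => F y * (ψ i y : ℂ)) := fun i => by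
    obtain ⟨g, hg, -⟩ := h.solid.exists_rep hFr (f₀ := fun y => F y * (ψ i y : ℂ))
      (hFm.mul (Complex.measurable_ofReal.comp (hψ.measurable i))).aestronglyMeasurable
      (Eventually.of_forall fun y => by
        rw [norm_mul, Complex.norm_real, Real.norm_of_nonneg (hψ.nonneg i y)]
        exact mul_le_of_le_one_right (norm_nonneg _) (hψ.le_one i y))
    exact ⟨g, hg⟩
  choose g hg using hg
  obtain ⟨b, hb, -, hbs⟩ := h.exists_sum_of_dom h.solid hg (M := h.solid.const * ‖f‖) (by
    refine (h.dom_kernelSpace f).mono (fun y => ?_) le_rfl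
    refine le_trans (le_of_eq (tsum_congr fun i => ?_)) (hψ.tsum_mul_le (y := y)
      (A := fun _ => ‖F y‖ₑ) fun i _ => le_rfl)
    rw [enorm_mul, enorm_ofReal_eq (hψ.nonneg i y), mul_comm])
  have hbf : b = f := hb.unique (hFr.congr (Eventually.of_forall fun y => by
    have := (Complex.hasSum_ofReal.2 (hψ.sum_one y)).mul_left (F y)
    simpa using this.tsum_eq.symm))
  have hle : ∀ z, ‖ρ.wav u (h.synth ((f - T f : h.kernelSpace) : B)) z‖ₑ ≤
      ∫⁻ y, ‖F y‖ₑ * ⨆ τ ∈ V, ‖ρ.dual τ (j u) (ρ.toFun (y⁻¹ * z) u) -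
        j u (ρ.toFun (y⁻¹ * z) u)‖ₑ ∂μ := by
    intro z
    set w := ρ.toFun z u with hw
    have h1 := (hbs w).sub ((hT f).2 z)
    rw [h.ev_eq, hbf] at h1
    rw [Submodule.coe_sub, h.wav_synth_sub]
    refine (enorm_le_tsum_of_hasSum h1).trans ?_
    have hterm : ∀ i, ‖h.synth (g i) w - lam 𝓑 ρ.σ (ρ.wav u (j u)) x ψ (f : B) i *
        twL ρ.σ (x i) (ρ.wav u (j u)) z‖ₑ ≤
        ∫⁻ y, ENNReal.ofReal (ψ i y) * (‖F y‖ₑ * ‖ρ.dual (y⁻¹ * x i) (j u)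
          (ρ.toFun (y⁻¹ * z) u) - j u (ρ.toFun (y⁻¹ * z) u)‖ₑ) ∂μ := by
      intro i
      have hi := (h.integrable_lam hU hψ f i).mul_const (ρ.dual (x i) (j u) w)
      rw [ρ.twL_wav, h.synth_apply (hg i), lam, ← integral_mul_const,
        ← integral_sub (h.integrable_pairing_rep (hg i) w) hi]
      refine (enorm_integral_le_lintegral_enorm _).trans (le_of_eq (lintegral_congr fun y => ?_))
      have e1 : F y * (ψ i y : ℂ) * ρ.dual y (j u) w -
          𝓑.ev ρ.σ (ρ.wav u (j u)) (f : B) y * (ψ i y : ℂ) *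
            conj (ρ.σ y (y⁻¹ * x i) : ℂ) * ρ.dual (x i) (j u) w =
          (ψ i y : ℂ) * (F y * ((ρ.dual (y⁻¹ * x i) (j u) (ρ.toFun (y⁻¹ * z) u) -
            j u (ρ.toFun (y⁻¹ * z) u)) * conj (ρ.σ y (y⁻¹ * z) : ℂ))) * (-1) := by
        have e2 : conj (ρ.σ y (y⁻¹ * x i) : ℂ) * ρ.dual (x i) (j u) w =
            ρ.dual (y⁻¹ * x i) (j u) (ρ.toFun (y⁻¹ * z) u) * conj (ρ.σ y (y⁻¹ * z) : ℂ) := by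
          rw [ρ.conj_twist_mul_dual, hw, ρ.symm_apply_apply, map_smulₛₗ, smul_eq_mul, mul_comm]
        have e3 : ρ.dual y (j u) w =
            j u (ρ.toFun (y⁻¹ * z) u) * conj (ρ.σ y (y⁻¹ * z) : ℂ) := by
          rw [ρ.dual_apply, hw, ρ.symm_apply_apply, map_smulₛₗ, smul_eq_mul, mul_comm]
        rw [mul_assoc _ (conj _) (ρ.dual (x i) (j u) w), e2, e3, h.ev_eq, ← hF]
        ring
      rw [e1, mul_neg_one, enorm_neg, enorm_mul, enorm_mul, enorm_mul_circle,
        enorm_ofReal_eq (hψ.nonneg i y)]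
    have hdm : ∀ i, Measurable fun y => ‖ρ.dual (y⁻¹ * x i) (j u)
        (ρ.toFun (y⁻¹ * z) u) - j u (ρ.toFun (y⁻¹ * z) u)‖ₑ := fun i =>
      (((ρ.measurable_dual_prod (j u) u).comp
        ((measurable_inv.mul_const (x i)).prodMk (measurable_inv.mul_const z))).sub
        ((ρ.measurable_wav u (j u)).comp (measurable_inv.mul_const z))).enorm
    have hpm : ∀ i, AEMeasurable (fun y => ENNReal.ofReal (ψ i y) * (‖F y‖ₑ *
        ‖ρ.dual (y⁻¹ * x i) (j u) (ρ.toFun (y⁻¹ * z) u) - j u (ρ.toFun (y⁻¹ * z) u)‖ₑ)) μ :=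
      fun i => ((hψ.measurable i).ennreal_ofReal.mul (hFm.enorm.mul (hdm i))).aemeasurable
    refine (ENNReal.tsum_le_tsum hterm).trans ?_
    rw [← lintegral_tsum hpm]
    refine lintegral_mono fun y => hψ.tsum_mul_le fun i hi => mul_le_mul_right ?_ _
    exact le_iSup₂ (f := fun τ _ => ‖ρ.dual τ (j u) (ρ.toFun (y⁻¹ * z) u) -
      j u (ρ.toFun (y⁻¹ * z) u)‖ₑ) (y⁻¹ * x i) (hUV hi)
  have key := h.norm_le_of_dom (f - T f) (hosc _ _ (h.dom_kernelSpace f)) hle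
  calc ‖f - T f‖ ≤ h.solid.const * (δ / (A + 1) * (h.solid.const * ‖f‖)) := key
    _ = δ * ‖f‖ * (A / (A + 1)) := by rw [hA]; ring
    _ ≤ δ * ‖f‖ * 1 := by
        gcongr
        exact div_le_one_of_le₀ (by linarith) (by positivity)
    _ = δ * ‖f‖ := mul_one _

include X in
/-- The second and third sampling operators are close to each other on fine partitions of unity. -/
theorem exists_norm_T2_sub_T3_le (h : SamplingAssumption n ρ j 𝓑 u) {δ : ℝ} (hδ : 0 < δ) :
    ∃ V ∈ 𝓝 (1 : G), ∀ {ι : Type} [Countable ι] {U : Set G} {x : ι → G} {ψ : ι → G → ℝ},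
      IsCompact U → IsBUPU U x ψ → U⁻¹ ⊆ V →
      ∀ T₂ T₃ : h.kernelSpace → h.kernelSpace, IsT2 𝓑 ρ.σ (ρ.wav u (j u)) x ψ T₂ →
        IsT3 𝓑 ρ.σ (ρ.wav u (j u)) x ψ T₃ → ∀ f, ‖T₂ f - T₃ f‖ ≤ δ * ‖f‖ := by
  obtain ⟨K, hK, hKn⟩ := exists_compact_mem_nhds (1 : G)
  obtain ⟨C, hC0, hC⟩ := h.exists_dom_synthesis X hK
  set A : ℝ := h.solid.const * C with hA
  have hs0 := h.solid.const_pos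
  have hA0 : 0 ≤ A := by positivity
  obtain ⟨V, hV, hosc⟩ := h.exists_right_osc X (δ := δ / (A + 1)) (by positivity)
  refine ⟨V ∩ K, inter_mem hV hKn, fun {ι} _ U x ψ hU hψ hUV T₂ T₃ hT₂ hT₃ f => ?_⟩
  set F : G → ℂ := ρ.wav u (h.synth (f : B)) with hF
  have hFm : Measurable F := ρ.measurable_wav u _
  have key := hC x (fun i => lam 𝓑 ρ.σ (ρ.wav u (j u)) x ψ (f : B) i -
      wt μ ψ i * 𝓑.ev ρ.σ (ρ.wav u (j u)) (f : B) (x i))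
    (fun i y => ENNReal.ofReal (ψ i y) * ‖F (x i) * (ρ.σ y (y⁻¹ * x i) : ℂ) - F y‖ₑ)
    (δ / (A + 1) * ‖f‖)
    (fun i => ((hψ.measurable i).ennreal_ofReal.mul
      (((ρ.measurable_twist (x i)).const_mul _).sub hFm).enorm).aemeasurable)
    (fun i => by
      have hi : Integrable (fun y => ((ψ i y : ℝ) : ℂ) * F (x i)) μ :=
        ((hψ.integrable hU μ i).ofReal).mul_const _
      have hw : wt μ ψ i * 𝓑.ev ρ.σ (ρ.wav u (j u)) (f : B) (x i) =
          ∫ y, ((ψ i y : ℝ) : ℂ) * F (x i) ∂μ := by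
        rw [integral_mul_const, h.ev_eq, wt]
        congr 1
        exact integral_ofReal.symm
      rw [hw, lam, ← integral_sub (h.integrable_lam hU hψ f i) hi]
      refine (enorm_integral_le_lintegral_enorm _).trans (le_of_eq (lintegral_congr fun y => ?_))
      have e1 : 𝓑.ev ρ.σ (ρ.wav u (j u)) (f : B) y * (ψ i y : ℂ) *
          conj (ρ.σ y (y⁻¹ * x i) : ℂ) - (ψ i y : ℂ) * F (x i) =
          (ψ i y : ℂ) * (F (x i) * (ρ.σ y (y⁻¹ * x i) : ℂ) - F y) *
            conj (ρ.σ y (y⁻¹ * x i) : ℂ) * (-1) := by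
        rw [h.ev_eq, ← hF]
        linear_combination (ψ i y : ℂ) * F (x i) * circle_mul_conj_self (ρ.σ y (y⁻¹ * x i))
      rw [e1, mul_neg_one, enorm_neg, enorm_mul_circle, enorm_mul,
        enorm_ofReal_eq (hψ.nonneg i y)])
    (fun i y h0 => (hUV (hψ.mem_inv fun h1 => h0 (by simp [h1]))).2)
    ((hosc (f : B)).mono (fun y => hψ.tsum_mul_le fun i hi =>
      h.enorm_sample_sub_le _ (hUV hi).1) le_rfl)
  have key' := h.norm_le_of_dom (T₂ f - T₃ f) key fun z => by
    rw [Submodule.coe_sub, h.wav_synth_sub, ← h.ev_eq, ← h.ev_eq]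
    refine (enorm_le_tsum_of_hasSum (((hT₂ f).2 z).sub (hT₃.2 f z))).trans
      (le_of_eq (tsum_congr fun i => ?_))
    rw [← sub_mul, enorm_mul, ρ.twL_wav, ρ.enorm_dual_apply]
  calc ‖T₂ f - T₃ f‖ ≤ h.solid.const * (C * (δ / (A + 1) * ‖f‖)) := key'
    _ = δ * ‖f‖ * (A / (A + 1)) := by rw [hA]; ring
    _ ≤ δ * ‖f‖ * 1 := by
        gcongr
        exact div_le_one_of_le₀ (by linarith) (by positivity)
    _ = δ * ‖f‖ := mul_one _

include X in
/-- On sufficiently fine partitions of unity the sampling operators are invertible. -/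
theorem exists_sampling_equiv (h : SamplingAssumption n ρ j 𝓑 u) :
    ∃ V ∈ 𝓝 (1 : G), ∀ {ι : Type} [Countable ι] {U : Set G} {x : ι → G} {ψ : ι → G → ℝ},
      IsCompact U → WellSpread x → IsBUPU U x ψ → U⁻¹ ⊆ V →
      ∃ T₁ T₂ T₃ : h.kernelSpace ≃L[ℂ] h.kernelSpace,
        IsT1 𝓑 ρ.σ (ρ.wav u (j u)) x ψ T₁ ∧ IsT2 𝓑 ρ.σ (ρ.wav u (j u)) x ψ T₂ ∧
        IsT3 𝓑 ρ.σ (ρ.wav u (j u)) x ψ T₃ := by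
  obtain ⟨V₁, hV₁, h₁⟩ := h.exists_norm_sub_T1_le X (δ := 1 / 4) (by norm_num)
  obtain ⟨V₂, hV₂, h₂⟩ := h.exists_norm_sub_T2_le X (δ := 1 / 4) (by norm_num)
  obtain ⟨V₃, hV₃, h₃⟩ := h.exists_norm_T2_sub_T3_le X (δ := 1 / 4) (by norm_num)
  have := h.completeSpace_repro
  refine ⟨V₁ ∩ (V₂ ∩ V₃), inter_mem hV₁ (inter_mem hV₂ hV₃),
    fun {ι} _ U x ψ hU hx hψ hUV => ?_⟩
  obtain ⟨T₁, hT₁⟩ := h.exists_isT1 X hU hx hψ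
  obtain ⟨T₂, hT₂⟩ := h.exists_isT2 X hU hψ
  obtain ⟨T₃, hT₃⟩ := h.exists_isT3 X hU hψ
  have b₁ := h₁ hU hx hψ (fun y hy => (hUV hy).1) T₁ hT₁
  have b₂ := h₂ hU hψ (fun y hy => (hUV hy).2.1) T₂ hT₂
  have b₃ : ∀ f, ‖f - T₃ f‖ ≤ 1 / 2 * ‖f‖ := fun f => by
    have := h₃ hU hψ (fun y hy => (hUV hy).2.2) T₂ T₃ hT₂ hT₃ f
    calc ‖f - T₃ f‖ = ‖(f - T₂ f) + (T₂ f - T₃ f)‖ := by rw [sub_add_sub_cancel]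
      _ ≤ 1 / 4 * ‖f‖ + 1 / 4 * ‖f‖ := (norm_add_le _ _).trans (add_le_add (b₂ f) this)
      _ = 1 / 2 * ‖f‖ := by ring
  obtain ⟨T₁', hT₁'⟩ := exists_continuousLinearEquiv T₁ (by norm_num) (by norm_num) b₁
  obtain ⟨T₂', hT₂'⟩ := exists_continuousLinearEquiv T₂ (by norm_num) (by norm_num) b₂
  obtain ⟨T₃', hT₃'⟩ := exists_continuousLinearEquiv T₃ (by norm_num) (by norm_num) b₃
  refine ⟨T₁', T₂', T₃', ?_, ?_, ?_⟩
  · rw [show (T₁' : h.kernelSpace → h.kernelSpace) = T₁ from funext hT₁']; exact hT₁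
  · rw [show (T₂' : h.kernelSpace → h.kernelSpace) = T₂ from funext hT₂']; exact hT₂
  · rw [show (T₃' : h.kernelSpace → h.kernelSpace) = T₃ from funext hT₃']; exact hT₃

end SamplingAssumption
end Invertible

/-! ### Analysis and synthesis on the sequence space -/

section Frames

variable {n : ℕ} {G S : Type*} [TopologicalSpace G] [ChartedSpace (EuclideanSpace ℝ (Fin n)) G]
  [Group G] [LieGroup (𝓡 n) ∞ G] [IsTopologicalGroup G] [T2Space G]
  [LocallyCompactSpace G] [SecondCountableTopology G] [MeasurableSpace G] [BorelSpace G]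
  [AddCommGroup S] [Module ℂ S] [TopologicalSpace S] [Nontrivial S]
  {μ : Measure G} [μ.IsHaarMeasure]
  {B : Type*} [NormedAddCommGroup B] [NormedSpace ℂ B] [CompleteSpace B] [Nontrivial B]
  {ρ : ProjRep G S} {j : S →ₗ[ℂ] (S →L⋆[ℂ] ℂ)} {𝓑 : BFSpace μ B} {u : S}
  {ι : Type} [Countable ι] {U : Set G} {x : ι → G} {ψ : ι → G → ℝ}

/-- The function `∑ᵢ |cᵢ| 1_{xᵢU}` with values in `[0, ∞]`. -/
noncomputable def stepSum (U : Set G) (x : ι → G) (c : ι → ℂ) (y : G) : ℝ≥0∞ :=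
  ∑' i, ‖c i‖ₑ * U.indicator (fun _ => 1) ((x i)⁻¹ * y)

lemma memSeq_iff (hs : 𝓑.Solid) (hx : WellSpread x) (hU : IsCompact U) {c : ι → ℂ} :
    MemSeq 𝓑 U x c ↔ ∃ M, 𝓑.Dom (stepSum U x c) M :=
  ⟨fun hc => ⟨_, hc.dom hs hx hU⟩, fun ⟨_, hM⟩ => (BFSpace.Dom.memSeq hs hx hU hM).1⟩

lemma stepSum_add_le (c d : ι → ℂ) (y : G) :
    stepSum U x (c + d) y ≤ stepSum U x c y + stepSum U x d y := by
  rw [stepSum, stepSum, stepSum, ← ENNReal.tsum_add]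
  refine ENNReal.tsum_le_tsum fun i => ?_
  rw [← add_mul]
  exact mul_le_mul_left (enorm_add_le _ _) _

lemma stepSum_smul (a : ℂ) (c : ι → ℂ) (y : G) :
    stepSum U x (a • c) y = ‖a‖₊ * stepSum U x c y := by
  rw [stepSum, stepSum, ← ENNReal.tsum_mul_left]
  refine tsum_congr fun i => ?_
  rw [Pi.smul_apply, smul_eq_mul, enorm_mul, mul_assoc]
  rfl

/-- The sequence space as a space of families of complex numbers. -/
def seqSubmodule (hs : 𝓑.Solid) (hx : WellSpread x) (hU : IsCompact U) :
    Submodule ℂ (ι → ℂ) where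
  carrier := {c | MemSeq 𝓑 U x c}
  zero_mem' := (memSeq_iff hs hx hU).2 ⟨0, BFSpace.Dom.zero.mono
    (fun y => le_of_eq (by simp [stepSum])) le_rfl⟩
  add_mem' := fun {c d} hc hd => by
    obtain ⟨M, hM⟩ := (memSeq_iff hs hx hU).1 hc
    obtain ⟨M', hM'⟩ := (memSeq_iff hs hx hU).1 hd
    exact (memSeq_iff hs hx hU).2 ⟨_, (hM.add hM').mono (fun y => stepSum_add_le c d y) le_rfl⟩
  smul_mem' := fun a c hc => by
    obtain ⟨M, hM⟩ := (memSeq_iff hs hx hU).1 hc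
    exact (memSeq_iff hs hx hU).2 ⟨_, (hM.const_mul ‖a‖₊).mono
      (fun y => (stepSum_smul a c y).le) le_rfl⟩

namespace SamplingAssumption

variable (X : Module.Basis (Fin n) ℝ (GroupLieAlgebra (𝓡 n) G))

/-- Coefficients are bounded by the norm of the sequence space, since the sets `xᵢU` have positive
measure. -/
lemma exists_norm_coeff_le (h : SamplingAssumption n ρ j 𝓑 u) (hU : IsCompact U)
    (hd : UDense U x) (i : ι) : ∃ C : ℝ, 0 ≤ C ∧ ∀ (c : ι → ℂ) (M : ℝ),
      𝓑.Dom (stepSum U x c) M → ‖c i‖ ≤ C * M := by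
  have hK : IsCompact ((fun g => x i * g) '' U) := hU.image (continuous_const_mul (x i))
  have hmem : ∀ y, y ∈ (fun g => x i * g) '' U ↔ (x i)⁻¹ * y ∈ U := fun y =>
    ⟨by rintro ⟨g, hg, rfl⟩; simpa using hg, fun hy => ⟨_, hy, by simp⟩⟩
  have hKm : Measurable (((fun g => x i * g) '' U).indicator fun _ => (1 : ℂ)) :=
    measurable_const.indicator hK.measurableSet
  obtain ⟨M₁, hM₁⟩ := BFSpace.exists_dom_indicator h.solid h.locInt h.bddTransl_right h.cont_right
    hK
  obtain ⟨d, hdr, -⟩ := hM₁.exists_rep h.solid hKm.aestronglyMeasurable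
    (Eventually.of_forall fun y => by
      by_cases hy : y ∈ (fun g => x i * g) '' U
      · rw [indicator_of_mem hy, indicator_of_mem hy, enorm_one]
      · rw [indicator_of_notMem hy, enorm_zero]; exact zero_le)
  have hd0 : 0 < ‖d‖ := by
    rw [norm_pos_iff]
    rintro rfl
    have h0 : ((fun g => x i * g) '' U).indicator (fun _ => (1 : ℂ)) =ᵐ[μ] 0 :=
      hdr.symm.trans BFSpace.Rep.zero
    rw [indicator_ae_eq_zero] at h0
    have hsupp : Function.support (fun _ : G => (1 : ℂ)) = univ := by
      ext; simp
    have hKU : (fun g => x i * g) '' U = (fun y => (x i)⁻¹ * y) ⁻¹' U := by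
      ext y; exact hmem y
    rw [hsupp, inter_univ, hKU, measure_preimage_mul] at h0
    exact (measure_pos_of_uDense (μ := μ) hd).ne' h0
  have hs0 := h.solid.const_pos
  refine ⟨h.solid.const / ‖d‖, by positivity, fun c M hM => ?_⟩
  obtain ⟨f, hf, hfn⟩ := hM.exists_rep h.solid (f₀ := fun y => c i *
    ((fun g => x i * g) '' U).indicator (fun _ => (1 : ℂ)) y) (hKm.const_mul _).aestronglyMeasurable
    (Eventually.of_forall fun y => by
      refine le_trans ?_ (ENNReal.le_tsum i)
      rw [enorm_mul]
      refine mul_le_mul_right ?_ _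
      by_cases hy : y ∈ (fun g => x i * g) '' U
      · rw [indicator_of_mem hy, indicator_of_mem ((hmem y).1 hy), enorm_one]
      · rw [indicator_of_notMem hy, enorm_zero]; exact zero_le)
  have hfd : f = c i • d := hf.unique (hdr.smul (c i))
  rw [hfd, norm_smul] at hfn
  rw [div_mul_eq_mul_div, le_div_iff₀ hd0]
  exact hfn

include X in
/-- Coefficients bounded near `xᵢ` by local maxima of a transform are controlled in the sequence
space. -/
lemma exists_dom_stepSum (h : SamplingAssumption n ρ j 𝓑 u) (hU : IsCompact U)
    (hx : WellSpread x) {Q : Set G} (hQ : IsCompact Q) (D : ℝ≥0) :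
    ∃ C : ℝ, 0 ≤ C ∧ ∀ (f : B) (c : ι → ℂ),
      (∀ i y, (x i)⁻¹ * y ∈ U → ‖c i‖ₑ ≤ D * ⨆ τ ∈ Q, ‖ρ.wav u (h.synth f) (y * τ)‖ₑ) →
      𝓑.Dom (stepSum U x c) (C * ‖f‖) := by
  obtain ⟨C, hC0, hC⟩ := h.exists_right_max X hQ
  obtain ⟨N, hN⟩ := hx.exists_encard_le hU
  refine ⟨(N * D : ℝ≥0) * C, by positivity, fun f c hc => ?_⟩
  refine ((hC f).const_mul (N * D)).mono (fun y => ?_) (by rw [mul_assoc])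
  refine (tsum_le_of_encard_le (hN y) (D := D * ⨆ τ ∈ Q, ‖ρ.wav u (h.synth f) (y * τ)‖ₑ)
    (fun i hi => ?_) fun i hi => ?_).trans (le_of_eq ?_)
  · have hi' : (x i)⁻¹ * y ∉ U := hi
    rw [indicator_of_notMem hi', mul_zero]
  · have hi' : (x i)⁻¹ * y ∈ U := hi
    rw [indicator_of_mem hi', mul_one]; exact hc i y hi'
  · push_cast; rw [mul_assoc]

include X in
lemma exists_dom_stepSum_sample (h : SamplingAssumption n ρ j 𝓑 u) (hU : IsCompact U)
    (hx : WellSpread x) : ∃ C : ℝ, 0 ≤ C ∧ ∀ f : h.kernelSpace,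
      𝓑.Dom (stepSum U x fun i => 𝓑.ev ρ.σ (ρ.wav u (j u)) (f : B) (x i)) (C * ‖f‖) := by
  obtain ⟨C, hC0, hC⟩ := h.exists_dom_stepSum X hU hx hU.inv 1
  refine ⟨C, hC0, fun f => hC f _ fun i y hy => ?_⟩
  rw [h.ev_eq, ENNReal.coe_one, one_mul]
  exact le_sup_right _ (by simpa using hy)

include X in
lemma exists_dom_stepSum_wt (h : SamplingAssumption n ρ j 𝓑 u) (hU : IsCompact U)
    (hx : WellSpread x) (hψ : IsBUPU U x ψ) : ∃ C : ℝ, 0 ≤ C ∧ ∀ f : h.kernelSpace,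
      𝓑.Dom (stepSum U x fun i => wt μ ψ i * 𝓑.ev ρ.σ (ρ.wav u (j u)) (f : B) (x i))
        (C * ‖f‖) := by
  obtain ⟨C, hC0, hC⟩ := h.exists_dom_stepSum X hU hx hU.inv (μ U).toNNReal
  refine ⟨C, hC0, fun f => hC f _ fun i y hy => ?_⟩
  rw [h.ev_eq, ENNReal.coe_toNNReal hU.measure_lt_top.ne, enorm_mul, hψ.enorm_wt hU]
  exact mul_le_mul' (hψ.lintegral_le hU μ i) (le_sup_right _ (by simpa using hy))

include X in
lemma exists_dom_stepSum_lam (h : SamplingAssumption n ρ j 𝓑 u) (hU : IsCompact U)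
    (hx : WellSpread x) (hψ : IsBUPU U x ψ) : ∃ C : ℝ, 0 ≤ C ∧ ∀ f : h.kernelSpace,
      𝓑.Dom (stepSum U x fun i => lam 𝓑 ρ.σ (ρ.wav u (j u)) x ψ (f : B) i) (C * ‖f‖) := by
  obtain ⟨C, hC0, hC⟩ := h.exists_dom_stepSum X hU hx (hU.inv.mul hU) (μ U).toNNReal
  refine ⟨C, hC0, fun f => hC f _ fun i y hy => ?_⟩
  rw [ENNReal.coe_toNNReal hU.measure_lt_top.ne]
  refine (h.enorm_lam_le hψ f i).trans ?_
  calc ∫⁻ z, ENNReal.ofReal (ψ i z) * ‖ρ.wav u (h.synth (f : B)) z‖ₑ ∂μ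
      ≤ ∫⁻ z, ENNReal.ofReal (ψ i z) *
          ⨆ τ ∈ U⁻¹ * U, ‖ρ.wav u (h.synth (f : B)) (y * τ)‖ₑ ∂μ := by
        refine lintegral_mono fun z => ?_
        by_cases h0 : ψ i z = 0
        · simp [h0]
        · refine mul_le_mul_right (le_sup_right _ ?_) _
          -- both `y` and `z` lie in `xᵢU`
          exact ⟨y⁻¹ * x i, by simpa using hy, (x i)⁻¹ * z, hψ.supp i z h0, by group⟩
    _ = (∫⁻ z, ENNReal.ofReal (ψ i z) ∂μ) *
          ⨆ τ ∈ U⁻¹ * U, ‖ρ.wav u (h.synth (f : B)) (y * τ)‖ₑ :=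
        lintegral_mul_const _ (hψ.measurable i).ennreal_ofReal
    _ ≤ _ := mul_le_mul_left (hψ.lintegral_le hU μ i) _

end SamplingAssumption

/-- The functionals `αᵢ` synthesize the sequence space: for every dominated family `c` the series
`∑ᵢ cᵢ αᵢ` converges weakly, and its transform is dominated accordingly. -/
def Synthesizes (𝓑 : BFSpace μ B) (ρ : ProjRep G S) (u : S) (U : Set G) (x : ι → G)
    (α : ι → S →L⋆[ℂ] ℂ) : Prop :=
  ∃ C : ℝ, 0 ≤ C ∧ ∀ (c : ι → ℂ) (M : ℝ), 𝓑.Dom (stepSum U x c) M →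
    ∃ γ : S →L⋆[ℂ] ℂ, (∀ v, HasSum (fun i => c i * α i v) (γ v)) ∧
      𝓑.Dom (fun z => ‖ρ.wav u γ z‖ₑ) (C * M)

namespace SamplingAssumption

variable (X : Module.Basis (Fin n) ℝ (GroupLieAlgebra (𝓡 n) G))

include X in
/-- The translates of the analyzing vector synthesize the sequence space. -/
lemma synthesizes_dual (h : SamplingAssumption n ρ j 𝓑 u) (hU : IsCompact U) (hd : UDense U x) :
    Synthesizes 𝓑 ρ u U x fun i => ρ.dual (x i) (j u) := by
  obtain ⟨C, hC0, hC⟩ := h.exists_dom_synthesis X hU.inv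
  have hU0 : μ U ≠ 0 := (measure_pos_of_uDense hd).ne'
  set d : ℝ≥0 := (μ U)⁻¹.toNNReal with hdd
  have hd' : (d : ℝ≥0∞) = (μ U)⁻¹ := ENNReal.coe_toNNReal (ENNReal.inv_ne_top.2 hU0)
  refine ⟨C * d, by positivity, fun c M hM => ?_⟩
  have hm : Measurable fun y => U.indicator (fun _ => (1 : ℝ≥0∞)) y :=
    measurable_const.indicator hU.measurableSet
  have hmi : ∀ i, Measurable fun y => U.indicator (fun _ => (1 : ℝ≥0∞)) ((x i)⁻¹ * y) :=
    fun i => hm.comp (measurable_const_mul _)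
  have key := hC x c (fun i y => d * (‖c i‖ₑ * U.indicator (fun _ => 1) ((x i)⁻¹ * y))) (d * M)
    (fun i => (((hmi i).const_mul _).const_mul _).aemeasurable)
    (fun i => by
      rw [lintegral_const_mul _ ((hmi i).const_mul _), lintegral_const_mul _ (hmi i),
        lintegral_mul_left_eq_self (fun y => U.indicator (fun _ => (1 : ℝ≥0∞)) y),
        lintegral_indicator hU.measurableSet, lintegral_one, Measure.restrict_apply_univ, hd',
        mul_left_comm, ENNReal.inv_mul_cancel hU0 hU.measure_lt_top.ne, mul_one])
    (fun i y hy => by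
      by_contra hy'
      rw [indicator_of_notMem (fun h1 => hy' (by simpa using h1)), mul_zero, mul_zero] at hy
      exact hy rfl)
    ((hM.const_mul d).mono (fun y => le_of_eq (by rw [stepSum, ENNReal.tsum_mul_left])) le_rfl)
  obtain ⟨γ, hγ, hγd⟩ := h.exists_synthesis X key
  exact ⟨γ, hγ, hγd.mono (fun _ => le_rfl) (le_of_eq (by ring))⟩

/-- The projections of the bumps `σ(·, ·⁻¹xᵢ)ψᵢ` synthesize the sequence space. -/
lemma synthesizes_bump (h : SamplingAssumption n ρ j 𝓑 u) (hψ : IsBUPU U x ψ) {e : ι → B}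
    (he : ∀ i, 𝓑.Rep (e i) (twBump ρ.σ x ψ i)) :
    Synthesizes 𝓑 ρ u U x fun i => h.synth (e i) := by
  obtain ⟨C, hC0, hC⟩ := h.exists_dom_wav_synth
  have hs0 := h.solid.const_pos
  refine ⟨C * h.solid.const, by positivity, fun c M hM => ?_⟩
  obtain ⟨b, -, hbn, hb⟩ := h.exists_bump_sum hψ he (c := c) (hM.mono (fun y =>
    ENNReal.tsum_le_tsum fun i => by
      rw [mul_comm]; exact mul_le_mul_right (hψ.ofReal_le_indicator i y) _) le_rfl)
  refine ⟨h.synth b, hb, (hC b).mono (fun _ => le_rfl) ?_⟩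
  rw [mul_assoc]
  exact mul_le_mul_of_nonneg_left hbn hC0

lemma synth_waveletEquiv (h : SamplingAssumption n ρ j 𝓑 u) (γ : coorbit ρ 𝓑 u) :
    h.synth (h.waveletEquiv γ : B) = γ := h.synth_eq_of_rep (h.rep_waveletEquiv γ)

lemma ext_synth (h : SamplingAssumption n ρ j 𝓑 u) {f g : h.kernelSpace}
    (hfg : h.synth (f : B) = h.synth (g : B)) : f = g := by
  refine Subtype.ext ((h.rep_of_mem_repro f.2).unique ?_)
  rw [hfg]
  exact h.rep_of_mem_repro g.2

/-- Coefficients of a weakly convergent expansion bound the norm of its sum. -/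
lemma exists_norm_le_of_hasSum (h : SamplingAssumption n ρ j 𝓑 u) {α : ι → S →L⋆[ℂ] ℂ}
    (hα : Synthesizes 𝓑 ρ u U x α) : ∃ C : ℝ, 0 ≤ C ∧ ∀ (f : h.kernelSpace) (c : ι → ℂ) (M : ℝ),
      𝓑.Dom (stepSum U x c) M → (∀ v, HasSum (fun i => c i * α i v) (h.synth (f : B) v)) →
      ‖f‖ ≤ C * M := by
  obtain ⟨C, hC0, hC⟩ := hα
  have hs0 := h.solid.const_pos
  refine ⟨h.solid.const * C, by positivity, fun f c M hM hf => ?_⟩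
  obtain ⟨γ, hγ, hγd⟩ := hC c M hM
  have : h.synth (f : B) = γ := ContinuousLinearMap.ext fun v => (hf v).unique (hγ v)
  rw [mul_assoc]
  exact h.norm_le_of_dom f hγd fun z => by rw [this]

/-- The synthesis operator on the sequence space. -/
lemma exists_synthesisMap (h : SamplingAssumption n ρ j 𝓑 u) (hU : IsCompact U)
    (hx : WellSpread x) {α : ι → S →L⋆[ℂ] ℂ} (hα : Synthesizes 𝓑 ρ u U x α) :
    ∃ R : (ι → ℂ) →ₗ.[ℂ] h.kernelSpace, (∀ c, c ∈ R.domain ↔ MemSeq 𝓑 U x c) ∧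
      (∃ C : ℝ, 0 ≤ C ∧ ∀ c : R.domain, ‖R c‖ ≤ C * seqNorm 𝓑 U x c) ∧
      ∀ (c : R.domain) v, HasSum (fun i => (c : ι → ℂ) i * α i v) (h.synth (R c : B) v) := by
  obtain ⟨C', hC0', hC'⟩ := h.exists_norm_le_of_hasSum hα
  have hex : ∀ c : seqSubmodule h.solid hx hU (𝓑 := 𝓑), ∃ f : h.kernelSpace,
      ∀ v, HasSum (fun i => (c : ι → ℂ) i * α i v) (h.synth (f : B) v) := by
    intro c
    obtain ⟨C, hC0, hC⟩ := hα
    obtain ⟨M, hM⟩ := (memSeq_iff h.solid hx hU).1 c.2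
    obtain ⟨γ, hγ, hγd⟩ := hC c M hM
    obtain ⟨f, hf, -⟩ := h.exists_rep_of_dom hγd fun z => le_rfl
    exact ⟨f, by rwa [h.synth_eq_of_rep hf]⟩
  choose F hF using hex
  let R : seqSubmodule h.solid hx hU (𝓑 := 𝓑) →ₗ[ℂ] h.kernelSpace :=
    { toFun := F
      map_add' := fun c d => h.ext_synth <| ContinuousLinearMap.ext fun v => by
        refine (hF (c + d) v).unique ?_
        rw [Submodule.coe_add (F c), h.synth_add]
        refine ((hF c v).add (hF d v)).congr_fun fun i => ?_
        simp [add_mul]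
      map_smul' := fun a c => h.ext_synth <| ContinuousLinearMap.ext fun v => by
        refine (hF (a • c) v).unique ?_
        rw [RingHom.id_apply, Submodule.coe_smul a (F c), h.synth_smul]
        refine ((hF c v).mul_left a).congr_fun fun i => ?_
        simp [mul_assoc] }
  refine ⟨⟨seqSubmodule h.solid hx hU, R⟩, fun c => Iff.rfl,
    ⟨C' * h.solid.const, mul_nonneg hC0' h.solid.const_pos.le, fun c => ?_⟩, hF⟩
  rw [mul_assoc]
  exact hC' (F c) c _ (MemSeq.dom h.solid hx hU c.2) (hF c)

/-- If `C_c(G)` is dense in the BF-space, then expansions with coefficients in the sequence space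
converge in norm. -/
lemma hasSum_of_ccDense (h : SamplingAssumption n ρ j 𝓑 u) (hU : IsCompact U)
    (hx : WellSpread x) {α : ι → S →L⋆[ℂ] ℂ} (hα : Synthesizes 𝓑 ρ u U x α)
    (hd : 𝓑.CcDense) {c : ι → ℂ} (hc : MemSeq 𝓑 U x c) {a : ι → h.kernelSpace} {s : h.kernelSpace}
    (ha : ∀ i, h.synth (a i : B) = α i)
    (hs : ∀ v, HasSum (fun i => c i * α i v) (h.synth (s : B) v)) :
    HasSum (fun i => c i • a i) s := by
  classical
  obtain ⟨C, hC0, hC⟩ := h.exists_norm_le_of_hasSum hα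
  rw [HasSum, Metric.tendsto_nhds]
  intro ε hε
  obtain ⟨J₀, hJ₀⟩ := hc.exists_tail_le h.solid hd hx hU (δ := ε / (C + 1)) (by positivity)
  rw [SummationFilter.unconditional_filter]
  filter_upwards [eventually_ge_atTop J₀] with J hJ
  -- the error has an expansion with the coefficients in `J` removed
  have key := hC (s - ∑ i ∈ J, c i • a i) (fun i => if i ∈ J then 0 else c i) _
    (hJ₀ J hJ _ (fun i hi => if_pos hi) fun i => by
      show ‖(if i ∈ J then 0 else c i : ℂ)‖ ≤ _
      split_ifs <;> simp) (fun v => by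
      have h1 := (hs v).sub (hasSum_sum_of_ne_finset_zero (s := J)
        (f := fun i => if i ∈ J then c i * α i v else 0) fun i hi => if_neg hi)
      have h2 : h.synth ((∑ i ∈ J, c i • a i : h.kernelSpace) : B) v =
          ∑ i ∈ J, if i ∈ J then c i * α i v else 0 := by
        have hlin : ∀ J : Finset ι, h.synth ((∑ i ∈ J, c i • a i : h.kernelSpace) : B) v =
            ∑ i ∈ J, c i * α i v := fun J => by
          induction J using Finset.induction_on with
          | empty =>
            have := h.synth_sub 0 0
            rw [sub_self, sub_self] at this
            rw [Finset.sum_empty, Finset.sum_empty, Submodule.coe_zero, this]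
            rfl
          | insert i J hi ih =>
            rw [Finset.sum_insert hi, Finset.sum_insert hi, Submodule.coe_add, h.synth_add, ← ih,
              Submodule.coe_smul, h.synth_smul, ha]
            rfl
        rw [hlin]
        exact Finset.sum_congr rfl fun i hi => (if_pos hi).symm
      rw [Submodule.coe_sub, h.synth_sub, sub_apply, h2]
      refine h1.congr_fun fun i => ?_
      by_cases hi : i ∈ J <;> simp [hi])
  rw [dist_eq_norm, ← norm_neg, neg_sub]
  calc ‖s - ∑ i ∈ J, c i • a i‖ ≤ C * (ε / (C + 1)) := key
    _ = ε * (C / (C + 1)) := by ring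
    _ < ε * 1 := by
        gcongr
        rw [div_lt_one (by positivity)]; linarith
    _ = ε := mul_one ε

end SamplingAssumption
end Frames

/-! ### Banach frames and atomic decompositions -/

section Decompositions

variable {n : ℕ} {G S : Type*} [TopologicalSpace G] [ChartedSpace (EuclideanSpace ℝ (Fin n)) G]
  [Group G] [LieGroup (𝓡 n) ∞ G] [IsTopologicalGroup G] [T2Space G]
  [LocallyCompactSpace G] [SecondCountableTopology G] [MeasurableSpace G] [BorelSpace G]
  [AddCommGroup S] [Module ℂ S] [TopologicalSpace S] [Nontrivial S]
  {μ : Measure G} [μ.IsHaarMeasure]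
  {B : Type*} [NormedAddCommGroup B] [NormedSpace ℂ B] [CompleteSpace B] [Nontrivial B]
  {ρ : ProjRep G S} {j : S →ₗ[ℂ] (S →L⋆[ℂ] ℂ)} {𝓑 : BFSpace μ B} {u : S}
  {ι : Type} [Countable ι] {U : Set G} {x : ι → G} {ψ : ι → G → ℝ}

namespace SamplingAssumption

/-- A linear functional bounded by one coordinate of a dominated family is bounded. -/
lemma isBddFunctional (h : SamplingAssumption n ρ j 𝓑 u) (hU : IsCompact U) (hd : UDense U x)
    {Λ : ι → coorbit ρ 𝓑 u → ℂ} (hadd : ∀ i γ γ', Λ i (γ + γ') = Λ i γ + Λ i γ')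
    (hsmul : ∀ i (c : ℂ) γ, Λ i (c • γ) = c * Λ i γ) {C : ℝ}
    (hdom : ∀ γ, 𝓑.Dom (stepSum U x fun i => Λ i γ) (C * coNorm ρ 𝓑 u γ)) (i : ι) :
    IsBddFunctional ρ 𝓑 u (Λ i) := by
  obtain ⟨C', -, hC'⟩ := h.exists_norm_coeff_le hU hd i
  refine ⟨{ toFun := Λ i, map_add' := hadd i, map_smul' := hsmul i }, fun γ => rfl, C' * C,
    fun γ => ?_⟩
  rw [mul_assoc]
  exact hC' _ _ (hdom γ)

/-- The lower frame bound is obtained by synthesis followed by an invertible operator. -/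
lemma normEquiv (h : SamplingAssumption n ρ j 𝓑 u) (hU : IsCompact U) (hx : WellSpread x)
    {α : ι → S →L⋆[ℂ] ℂ} (hα : Synthesizes 𝓑 ρ u U x α) {Λ : ι → coorbit ρ 𝓑 u → ℂ} {C : ℝ}
    (hdom : ∀ γ, 𝓑.Dom (stepSum U x fun i => Λ i γ) (C * coNorm ρ 𝓑 u γ))
    (T : h.kernelSpace ≃L[ℂ] h.kernelSpace)
    (hsum : ∀ γ v, HasSum (fun i => Λ i γ * α i v) (h.synth (T (h.waveletEquiv γ) : B) v)) :
    NormEquiv ρ 𝓑 u U x Λ := by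
  have hs0 := h.solid.const_pos
  obtain ⟨C', hC0', hC'⟩ := h.exists_norm_le_of_hasSum hα
  set D : ℝ := ‖(T.symm : h.kernelSpace →L[ℂ] h.kernelSpace)‖ * C' * h.solid.const with hD
  have hD0 : 0 ≤ D := by positivity
  have hmem : ∀ γ, MemSeq 𝓑 U x fun i => Λ i γ := fun γ =>
    (memSeq_iff h.solid hx hU).2 ⟨_, hdom γ⟩
  refine ⟨hmem, 1 / (D + 1), by positivity, h.solid.const * C, fun γ => ⟨?_, ?_⟩⟩
  · have h1 : coNorm ρ 𝓑 u γ ≤ D * seqNorm 𝓑 U x fun i => Λ i γ := by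
      calc coNorm ρ 𝓑 u γ = ‖T.symm (T (h.waveletEquiv γ))‖ := by
            rw [T.symm_apply_apply, h.norm_waveletEquiv]
        _ ≤ ‖(T.symm : h.kernelSpace →L[ℂ] h.kernelSpace)‖ * ‖T (h.waveletEquiv γ)‖ :=
            (T.symm : h.kernelSpace →L[ℂ] h.kernelSpace).le_opNorm _
        _ ≤ ‖(T.symm : h.kernelSpace →L[ℂ] h.kernelSpace)‖ *
              (C' * (h.solid.const * seqNorm 𝓑 U x fun i => Λ i γ)) := by
            gcongr
            exact hC' _ _ _ (MemSeq.dom h.solid hx hU (hmem γ)) (hsum γ)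
        _ = _ := by rw [hD]; ring
    have h0 : 0 ≤ seqNorm 𝓑 U x fun i => Λ i γ := by
      obtain ⟨f, hf⟩ := hmem γ
      rw [seqNorm_eq hf]; exact norm_nonneg f
    rw [one_div, inv_mul_le_iff₀ (by positivity)]
    linarith
  · rw [mul_assoc]
    exact (BFSpace.Dom.memSeq h.solid hx hU (hdom γ)).2

/-- Expansions into translates of the reproducing kernel hold weakly in the conjugate dual. -/
lemma hasSum_dual_of_hasSum_twL (h : SamplingAssumption n ρ j 𝓑 u)
    (hα : Synthesizes 𝓑 ρ u U x fun i => ρ.dual (x i) (j u)) {c : ι → ℂ} {M : ℝ}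
    (hc : 𝓑.Dom (stepSum U x c) M) {f : h.kernelSpace}
    (hf : ∀ z, HasSum (fun i => c i * twL ρ.σ (x i) (ρ.wav u (j u)) z)
      (𝓑.ev ρ.σ (ρ.wav u (j u)) (f : B) z)) (v : S) :
    HasSum (fun i => c i * ρ.dual (x i) (j u) v) (h.synth (f : B) v) := by
  obtain ⟨C, -, hC⟩ := hα
  -- the weak sum exists, and it is determined by its values on the orbit of the cyclic vector
  obtain ⟨γ, hγ, -⟩ := hC c M hc
  have : h.synth (f : B) = γ := h.analyzing.1.ext fun z => by
    rw [← h.ev_eq]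
    refine (hf z).unique ((hγ (ρ.toFun z u)).congr_fun fun i => ?_)
    rw [ρ.twL_wav]
  rw [this]
  exact hγ v

/-- The weak expansion of the first sampling operator. -/
lemma hasSum_bump_of_isT1 (h : SamplingAssumption n ρ j 𝓑 u) (hψ : IsBUPU U x ψ) {e : ι → B}
    (he : ∀ i, 𝓑.Rep (e i) (twBump ρ.σ x ψ i)) {T : h.kernelSpace → h.kernelSpace}
    (hT : IsT1 𝓑 ρ.σ (ρ.wav u (j u)) x ψ T) {f : h.kernelSpace} {M : ℝ}
    (hM : 𝓑.Dom (stepSum U x fun i => 𝓑.ev ρ.σ (ρ.wav u (j u)) (f : B) (x i)) M) (v : S) :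
    HasSum (fun i => 𝓑.ev ρ.σ (ρ.wav u (j u)) (f : B) (x i) * h.synth (e i) v)
      (h.synth (T f : B) v) := by
  obtain ⟨b, hb, -, hbs⟩ := h.exists_bump_sum hψ he (hM.mono (fun y =>
    ENNReal.tsum_le_tsum fun i => by
      rw [mul_comm]; exact mul_le_mul_right (hψ.ofReal_le_indicator i y) _) le_rfl)
  simp only [h.ev_eq] at hb
  rw [IsT1.synth_eq h hT hb]
  exact hbs v

variable (X : Module.Basis (Fin n) ℝ (GroupLieAlgebra (𝓡 n) G))

include X in
/-- Sampling of the wavelet transform gives a Banach frame if the first sampling operator is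
invertible; the reconstruction operator is synthesis by bumps followed by the inverse. -/
theorem isBanachFrame (h : SamplingAssumption n ρ j 𝓑 u) (hU : IsCompact U) (hd : UDense U x)
    (hx : WellSpread x) (hψ : IsBUPU U x ψ) {T : h.kernelSpace ≃L[ℂ] h.kernelSpace}
    (hT : IsT1 𝓑 ρ.σ (ρ.wav u (j u)) x ψ T) :
    IsBanachFrame ρ 𝓑 u U x (fun i γ => ρ.wav u γ (x i)) := by
  choose e he using h.exists_rep_twBump hU hψ
  have hα := h.synthesizes_bump hψ he
  obtain ⟨C, hC0, hC⟩ := h.exists_dom_stepSum_sample X hU hx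
  have hdom : ∀ γ : coorbit ρ 𝓑 u,
      𝓑.Dom (stepSum U x fun i => ρ.wav u γ (x i)) (C * coNorm ρ 𝓑 u γ) := fun γ => by
    have := hC (h.waveletEquiv γ)
    simp only [h.ev_waveletEquiv] at this
    exact this
  have hsum : ∀ (γ : coorbit ρ 𝓑 u) v, HasSum (fun i => ρ.wav u γ (x i) * h.synth (e i) v)
      (h.synth (T (h.waveletEquiv γ) : B) v) := fun γ v => by
    have := h.hasSum_bump_of_isT1 hψ he hT (hC (h.waveletEquiv γ)) v
    simp only [h.ev_waveletEquiv] at this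
    exact this
  obtain ⟨R, hRd, ⟨C', hC0', hC'⟩, hR⟩ := h.exists_synthesisMap hU hx hα
  refine ⟨h.isBddFunctional hU hd (fun _ _ _ => rfl) (fun _ _ _ => rfl) hdom,
    h.normEquiv hU hx hα hdom T hsum,
    (h.waveletEquiv.symm.toLinearMap ∘ₗ T.symm.toLinearEquiv.toLinearMap).compPMap R, hRd,
    ⟨‖(T.symm : h.kernelSpace →L[ℂ] h.kernelSpace)‖ * C', fun c => ?_⟩, fun γ c hc => ?_⟩
  · show coNorm ρ 𝓑 u (h.waveletEquiv.symm (T.symm (R c))) ≤ _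
    rw [← h.norm_waveletEquiv, LinearEquiv.apply_symm_apply, mul_assoc]
    exact ((T.symm : h.kernelSpace →L[ℂ] h.kernelSpace).le_opNorm _).trans
      (mul_le_mul_of_nonneg_left (hC' c) (norm_nonneg _))
  · show h.waveletEquiv.symm (T.symm (R c)) = γ
    have h1 : R c = T (h.waveletEquiv γ) := h.ext_synth <| ContinuousLinearMap.ext fun v => by
      refine (hR c v).unique ((hsum γ v).congr_fun fun i => ?_)
      rw [hc i]
    rw [h1, T.symm_apply_apply, LinearEquiv.symm_apply_apply]

include X in
/-- Coefficients for which the series of translates of the kernel defines an invertible operator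
give an atomic decomposition. -/
theorem isAtomicDecomp (h : SamplingAssumption n ρ j 𝓑 u) (hU : IsCompact U) (hd : UDense U x)
    (hx : WellSpread x) {Λ : h.kernelSpace → ι → ℂ} (hadd : ∀ f g i, Λ (f + g) i = Λ f i + Λ g i)
    (hsmul : ∀ (c : ℂ) f i, Λ (c • f) i = c * Λ f i) {C : ℝ} (hC0 : 0 ≤ C)
    (hC : ∀ f, 𝓑.Dom (stepSum U x (Λ f)) (C * ‖f‖)) {T : h.kernelSpace ≃L[ℂ] h.kernelSpace}
    (hT : ∀ f z, HasSum (fun i => Λ f i * twL ρ.σ (x i) (ρ.wav u (j u)) z)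
      (𝓑.ev ρ.σ (ρ.wav u (j u)) (T f : B) z)) {a : ι → coorbit ρ 𝓑 u}
    (ha : ∀ i, (a i : S →L⋆[ℂ] ℂ) = ρ.dual (x i) (j u)) :
    IsAtomicDecomp ρ 𝓑 u U x (fun i γ => Λ (T.symm (h.waveletEquiv γ)) i) a ∧
      (𝓑.CcDense → ∀ γ : coorbit ρ 𝓑 u,
        HasSum (fun i => Λ (T.symm (h.waveletEquiv γ)) i • h.waveletEquiv (a i))
          (h.waveletEquiv γ)) := by
  have hα := h.synthesizes_dual X hU hd
  have hdom : ∀ γ : coorbit ρ 𝓑 u,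
      𝓑.Dom (stepSum U x fun i => Λ (T.symm (h.waveletEquiv γ)) i)
        (C * ‖(T.symm : h.kernelSpace →L[ℂ] h.kernelSpace)‖ * coNorm ρ 𝓑 u γ) := fun γ => by
    refine (hC (T.symm (h.waveletEquiv γ))).mono (fun _ => le_rfl) ?_
    rw [mul_assoc]
    refine mul_le_mul_of_nonneg_left ?_ hC0
    rw [← h.norm_waveletEquiv]
    exact (T.symm : h.kernelSpace →L[ℂ] h.kernelSpace).le_opNorm _
  have hsum : ∀ (γ : coorbit ρ 𝓑 u) v, HasSum
      (fun i => Λ (T.symm (h.waveletEquiv γ)) i * ρ.dual (x i) (j u) v)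
      ((γ : S →L⋆[ℂ] ℂ) v) := fun γ v => by
    have := h.hasSum_dual_of_hasSum_twL hα (hdom γ) (hT (T.symm (h.waveletEquiv γ))) v
    rwa [T.apply_symm_apply, h.synth_waveletEquiv] at this
  refine ⟨⟨h.isBddFunctional hU hd (fun i γ γ' => by simp only [map_add, hadd])
    (fun i c γ => by simp only [map_smul, hsmul]) hdom,
    h.normEquiv hU hx hα hdom (ContinuousLinearEquiv.refl ℂ _) (fun γ v => by
      rw [ContinuousLinearEquiv.refl_apply, h.synth_waveletEquiv]; exact hsum γ v),
    fun γ v => by simp only [ha]; exact hsum γ v⟩, fun hcc γ => ?_⟩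
  refine h.hasSum_of_ccDense hU hx hα hcc ((memSeq_iff h.solid hx hU).2 ⟨_, hdom γ⟩)
    (fun i => by rw [h.synth_waveletEquiv, ha]) fun v => ?_
  rw [h.synth_waveletEquiv]
  exact hsum γ v

/-- The members of the coorbit space whose transforms are the twisted convolutions of the bumps
with the reproducing kernel. -/
lemma exists_bump_coorbit (h : SamplingAssumption n ρ j 𝓑 u) {e : ι → B}
    (he : ∀ i, 𝓑.Rep (e i) (twBump ρ.σ x ψ i)) :
    ∃ b : ι → coorbit ρ 𝓑 u, (∀ i, (b i : S →L⋆[ℂ] ℂ) = h.synth (e i)) ∧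
      ∀ i z, TwConvExists μ ρ.σ (twBump ρ.σ x ψ i) (ρ.wav u (j u)) z ∧
        ρ.wav u (b i) z = twConv μ ρ.σ (twBump ρ.σ x ψ i) (ρ.wav u (j u)) z := by
  obtain ⟨P, hP⟩ := h.exists_proj
  refine ⟨fun i => ⟨h.synth (e i), P (e i), hP (e i)⟩, fun i => rfl, fun i z =>
    ⟨h.twConvExists (he i) u z, ?_⟩⟩
  rw [h.twConv_eq_wav_synth (he i)]

include X in
/-- Reconstruction of a member of the coorbit space from the samples of its transform. -/
theorem exists_reconstruction (h : SamplingAssumption n ρ j 𝓑 u) (hU : IsCompact U)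
    (hx : WellSpread x) (hψ : IsBUPU U x ψ) {T : h.kernelSpace ≃L[ℂ] h.kernelSpace}
    (hT : IsT1 𝓑 ρ.σ (ρ.wav u (j u)) x ψ T) {e : ι → B}
    (he : ∀ i, 𝓑.Rep (e i) (twBump ρ.σ x ψ i)) {b : ι → coorbit ρ 𝓑 u}
    (hb : ∀ i, (b i : S →L⋆[ℂ] ℂ) = h.synth (e i)) (γ : coorbit ρ 𝓑 u) :
    ∃ s : h.kernelSpace,
      (∀ v : S, HasSum (fun i => ρ.wav u γ (x i) * (b i : S →L⋆[ℂ] ℂ) v)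
        ((h.waveletEquiv.symm s : S →L⋆[ℂ] ℂ) v)) ∧
      γ = h.waveletEquiv.symm (T.symm s) ∧
      (𝓑.CcDense → HasSum (fun i => ρ.wav u γ (x i) • h.waveletEquiv (b i)) s) := by
  have hα := h.synthesizes_bump hψ he
  obtain ⟨C, hC0, hC⟩ := h.exists_dom_stepSum_sample X hU hx
  have hsum : ∀ v, HasSum (fun i => ρ.wav u γ (x i) * h.synth (e i) v)
      (h.synth (T (h.waveletEquiv γ) : B) v) := fun v => by
    have := h.hasSum_bump_of_isT1 hψ he hT (hC (h.waveletEquiv γ)) v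
    simp only [h.ev_waveletEquiv] at this
    exact this
  refine ⟨T (h.waveletEquiv γ), fun v => ?_, ?_, fun hcc => ?_⟩
  · simp only [hb]; exact hsum v
  · rw [T.symm_apply_apply, LinearEquiv.symm_apply_apply]
  · have hM := hC (h.waveletEquiv γ)
    simp only [h.ev_waveletEquiv] at hM
    exact h.hasSum_of_ccDense hU hx hα hcc ((memSeq_iff h.solid hx hU).2 ⟨_, hM⟩)
      (fun i => by rw [h.synth_waveletEquiv, hb]) hsum

end SamplingAssumption
end Decompositions

end ProjCoorbit

theorem mainTheorem4 {n : ℕ}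
    {G : Type*} [TopologicalSpace G] [ChartedSpace (EuclideanSpace ℝ (Fin n)) G] [Group G]
    [LieGroup (𝓡 n) ∞ G] [T2Space G] [SecondCountableTopology G] [ConnectedSpace G]
    [MeasurableSpace G] [BorelSpace G] (μ : Measure G) [μ.IsHaarMeasure]
    {S : Type*} [AddCommGroup S] [Module ℂ S] [TopologicalSpace S] [IsTopologicalAddGroup S]
    [ContinuousSMul ℂ S] [LocallyConvexSpace ℝ S] [T2Space S]
    {B : Type*} [NormedAddCommGroup B] [NormedSpace ℂ B] [CompleteSpace B] [Nontrivial B]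
    (ρ : ProjCoorbit.ProjRep G S) (hρ : ρ.WeaklyContinuousNearOne)
    (hσ : ProjCoorbit.SmoothNear (n := n) ρ.σ {((1 : G), (1 : G))})
    (j : S →ₗ[ℂ] (S →L⋆[ℂ] ℂ)) (hj : Function.Injective j)
    (hj' : ∀ v : S, Continuous fun w : S => j w v)
    (𝓑 : ProjCoorbit.BFSpace μ B) (u : S)
    (hu : ProjCoorbit.AtomicAssumption (n := n) ρ j 𝓑 u)
    (X : Module.Basis (Fin n) ℝ (GroupLieAlgebra (𝓡 n) G)) :
    (∀ ε : ℝ, 0 < ε →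
      ProjCoorbit.SmoothNear (n := n) ρ.σ
        (ProjCoorbit.boxNhd X ε ×ˢ ProjCoorbit.boxNhd X ε) →
      ∀ (ι : Type) [Countable ι] (x : ι → G) (ψ : ι → G → ℝ),
        ProjCoorbit.UDense (ProjCoorbit.boxNhd X ε) x → ProjCoorbit.WellSpread x →
        ProjCoorbit.IsBUPU (ProjCoorbit.boxNhd X ε) x ψ →
        ∃ T₁ T₂ T₃ : 𝓑.repro ρ.σ (ρ.wav u (j u)) →L[ℂ] 𝓑.repro ρ.σ (ρ.wav u (j u)),
          ProjCoorbit.IsT1 𝓑 ρ.σ (ρ.wav u (j u)) x ψ T₁ ∧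
          ProjCoorbit.IsT2 𝓑 ρ.σ (ρ.wav u (j u)) x ψ T₂ ∧
          ProjCoorbit.IsT3 𝓑 ρ.σ (ρ.wav u (j u)) x ψ T₃) ∧
    (∃ ε₀ : ℝ, 0 < ε₀ ∧ ∀ ε : ℝ, 0 < ε → ε ≤ ε₀ →
      ProjCoorbit.SmoothNear (n := n) ρ.σ
        (ProjCoorbit.boxNhd X ε ×ˢ ProjCoorbit.boxNhd X ε) ∧
      ∀ (ι : Type) [Countable ι] (x : ι → G) (ψ : ι → G → ℝ),
        ProjCoorbit.UDense (ProjCoorbit.boxNhd X ε) x → ProjCoorbit.WellSpread x →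
        ProjCoorbit.IsBUPU (ProjCoorbit.boxNhd X ε) x ψ →
        ∃ (W : ProjCoorbit.coorbit ρ 𝓑 u ≃ₗ[ℂ] 𝓑.repro ρ.σ (ρ.wav u (j u)))
          (T₁ T₂ T₃ : 𝓑.repro ρ.σ (ρ.wav u (j u)) ≃L[ℂ] 𝓑.repro ρ.σ (ρ.wav u (j u)))
          (a b : ι → ProjCoorbit.coorbit ρ 𝓑 u),
          -- `W` is the wavelet transform, `a i = ρ*(xᵢ)u`, and `W_u(b i)` is the twisted
          -- convolution of `σ(·, ·⁻¹xᵢ)ψᵢ` with `W_u(u)`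
          (∀ γ, (W γ : B) = ProjCoorbit.coorbitW ρ 𝓑 u γ) ∧
          ProjCoorbit.IsT1 𝓑 ρ.σ (ρ.wav u (j u)) x ψ T₁ ∧
          ProjCoorbit.IsT2 𝓑 ρ.σ (ρ.wav u (j u)) x ψ T₂ ∧
          ProjCoorbit.IsT3 𝓑 ρ.σ (ρ.wav u (j u)) x ψ T₃ ∧
          (∀ i, (a i : S →L⋆[ℂ] ℂ) = ρ.dual (x i) (j u)) ∧
          (∀ i z,
            ProjCoorbit.TwConvExists μ ρ.σ (ProjCoorbit.twBump ρ.σ x ψ i) (ρ.wav u (j u)) z ∧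
            ρ.wav u (b i) z =
              ProjCoorbit.twConv μ ρ.σ (ProjCoorbit.twBump ρ.σ x ψ i) (ρ.wav u (j u)) z) ∧
          -- Banach frame and atomic decompositions
          ProjCoorbit.IsBanachFrame ρ 𝓑 u (ProjCoorbit.boxNhd X ε) x
            (fun i γ => ρ.wav u γ (x i)) ∧
          ProjCoorbit.IsAtomicDecomp ρ 𝓑 u (ProjCoorbit.boxNhd X ε) x
            (fun i γ => ProjCoorbit.lam 𝓑 ρ.σ (ρ.wav u (j u)) x ψ (T₂.symm (W γ)) i) a ∧
          ProjCoorbit.IsAtomicDecomp ρ 𝓑 u (ProjCoorbit.boxNhd X ε) x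
            (fun i γ => ProjCoorbit.wt μ ψ i *
              𝓑.ev ρ.σ (ρ.wav u (j u)) (T₃.symm (W γ)) (x i)) a ∧
          -- reconstruction formulas, with weak-* convergence in `S*`
          (∀ γ : ProjCoorbit.coorbit ρ 𝓑 u, ∃ s : 𝓑.repro ρ.σ (ρ.wav u (j u)),
            (∀ v : S, HasSum (fun i => ρ.wav u γ (x i) * (b i : S →L⋆[ℂ] ℂ) v)
              ((W.symm s : S →L⋆[ℂ] ℂ) v)) ∧
            γ = W.symm (T₁.symm s) ∧
            (𝓑.CcDense → HasSum (fun i => ρ.wav u γ (x i) • W (b i)) s)) ∧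
          (∀ (γ : ProjCoorbit.coorbit ρ 𝓑 u) (v : S),
            HasSum (fun i => ProjCoorbit.lam 𝓑 ρ.σ (ρ.wav u (j u)) x ψ (T₂.symm (W γ)) i *
              ρ.dual (x i) (j u) v) ((γ : S →L⋆[ℂ] ℂ) v)) ∧
          (∀ (γ : ProjCoorbit.coorbit ρ 𝓑 u) (v : S),
            HasSum (fun i => ProjCoorbit.wt μ ψ i *
              𝓑.ev ρ.σ (ρ.wav u (j u)) (T₃.symm (W γ)) (x i) *
              ρ.dual (x i) (j u) v) ((γ : S →L⋆[ℂ] ℂ) v)) ∧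
          -- convergence in the norm of the coorbit space
          (𝓑.CcDense → ∀ γ : ProjCoorbit.coorbit ρ 𝓑 u,
            HasSum (fun i => ProjCoorbit.lam 𝓑 ρ.σ (ρ.wav u (j u)) x ψ (T₂.symm (W γ)) i •
              W (a i)) (W γ) ∧
            HasSum (fun i => (ProjCoorbit.wt μ ψ i *
              𝓑.ev ρ.σ (ρ.wav u (j u)) (T₃.symm (W γ)) (x i)) • W (a i)) (W γ))) := by
  classical
  have : IsTopologicalGroup G := topologicalGroup_of_lieGroup (𝓡 n) ∞
  have : LocallyCompactSpace G := Manifold.locallyCompact_of_finiteDimensional (𝓡 n)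
  have : Nontrivial S := ⟨u, 0, hu.ne_zero⟩
  have h : ProjCoorbit.SamplingAssumption n ρ j 𝓑 u :=
    { toAtomicAssumption := hu, weakCont := hρ, smooth := hσ, injective := hj }
  refine ⟨fun ε _ _ ι _ x ψ _ hx hψ => ?_, ?_⟩
  · have hU := ProjCoorbit.isCompact_boxNhd X ε
    obtain ⟨T₁, hT₁⟩ := h.exists_isT1 X hU hx hψ
    obtain ⟨T₂, hT₂⟩ := h.exists_isT2 X hU hψ
    obtain ⟨T₃, hT₃⟩ := h.exists_isT3 X hU hψ
    exact ⟨T₁, T₂, T₃, hT₁, hT₂, hT₃⟩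
  obtain ⟨V, hV, hequiv⟩ := h.exists_sampling_equiv X
  obtain ⟨O, hO, h1O, hOs⟩ := hσ
  obtain ⟨V', hV', hVO⟩ : ∃ V' ∈ 𝓝 (1 : G), V' ×ˢ V' ⊆ O := by
    have hn : O ∈ 𝓝 ((1 : G), (1 : G)) := hO.mem_nhds (h1O rfl)
    rw [nhds_prod_eq, Filter.mem_prod_self_iff] at hn
    exact hn
  -- the invertibility criterion asks for `U_ε⁻¹ ⊆ V`, smoothness of `σ` for `U_ε ⊆ V'`
  have hVi : V⁻¹ ∈ 𝓝 (1 : G) := by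
    have := continuous_inv.continuousAt.preimage_mem_nhds (x := (1 : G)) (t := V)
      (by rwa [inv_one])
    exact this
  obtain ⟨ε₀, hε₀, hsub⟩ := ProjCoorbit.exists_boxNhd_subset X (inter_mem hV' hVi)
  refine ⟨ε₀, hε₀, fun ε _ hε => ⟨⟨O, hO, (prod_mono (fun g hg => (hsub ε hε hg).1)
    fun g hg => (hsub ε hε hg).1).trans hVO, hOs⟩, fun ι _ x ψ hd hx hψ => ?_⟩⟩
  have hU := ProjCoorbit.isCompact_boxNhd X ε
  obtain ⟨T₁, T₂, T₃, hT₁, hT₂, hT₃⟩ := hequiv hU hx hψ fun g hg => by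
    have := (hsub ε hε hg).2
    rwa [Set.inv_mem_inv] at this
  choose e he using h.exists_rep_twBump hU hψ
  obtain ⟨b, hb, hbz⟩ := h.exists_bump_coorbit he
  choose fa hfa using fun i => h.exists_rep_dual X (x i)
  let a : ι → ProjCoorbit.coorbit ρ 𝓑 u := fun i => ⟨ρ.dual (x i) (j u), fa i, hfa i⟩
  have ha : ∀ i, (a i : S →L⋆[ℂ] ℂ) = ρ.dual (x i) (j u) := fun i => rfl
  obtain ⟨C₂, hC₂0, hC₂⟩ := h.exists_dom_stepSum_lam X hU hx hψ
  obtain ⟨C₃, hC₃0, hC₃⟩ := h.exists_dom_stepSum_wt X hU hx hψ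
  obtain ⟨hA₂, hN₂⟩ := h.isAtomicDecomp X hU hd hx (h.lam_add hU hψ) h.lam_smul hC₂0 hC₂
    (fun f => (hT₂ f).2) ha
  obtain ⟨hA₃, hN₃⟩ := h.isAtomicDecomp X hU hd hx
    (Λ := fun f i => ProjCoorbit.wt μ ψ i * 𝓑.ev ρ.σ (ρ.wav u (j u)) (f : B) (x i))
    (fun f g i => by
      simp only [h.ev_eq, Submodule.coe_add, h.wav_synth_add]; ring)
    (fun c f i => by
      simp only [h.ev_eq, Submodule.coe_smul, h.wav_synth_smul]; ring)
    hC₃0 hC₃ hT₃.2 ha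
  exact ⟨h.waveletEquiv, T₁, T₂, T₃, a, b, h.coe_waveletEquiv, hT₁, hT₂, hT₃, ha, hbz,
    h.isBanachFrame X hU hd hx hψ hT₁, hA₂, hA₃,
    fun γ => h.exists_reconstruction X hU hx hψ hT₁ he hb γ, hA₂.2.2, hA₃.2.2,
    fun hcc γ => ⟨hN₂ hcc γ, hN₃ hcc γ⟩⟩
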